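/- **Model.** There are $K\ge 1$ arms and $M$ players, $1\le M\le K$. The qualities $X_k(t)\in[0,1]$ ($k\le K$, $t\ge 1$) are independent, $X_k(t)$ having law $\nu_k$ with mean $\mu_k$; the means are positive and pairwise distinct, and $\mu_{(1)}>\dots>\mu_{(K)}>0$ denote the ordered means. At each round $t$ every player $j$ pulls an arm $\pi^j(t)$, chosen from her own past observations and private randomness, and observes $X_{\pi^j(t)}(t)$ and her reward $r^j(t)=X_{\pi^j(t)}(t)(1-\eta_{\pi^j(t)}(t))$ (statistic sensing), where $\eta_k(t)=1$ if at least two players pull $k$ at round $t$ and $\eta_k(t)=0$ otherwise. The collective regret is $R_T=T\sum_{k\le M}\mu_{(k)}-\sum_{t\le T}\sum_{j\le M}\mu_{\pi^j(t)}(1-\eta_{\pi^j(t)}(t))$. For $p,q\in[0,1]$, $\mathrm{kl}(p,q)=p\log\frac pq+(1-p)\log\frac{1-p}{1-q}\in[0,\infty]$ is the Bernoulli relative entropy (and $x/\infty=0$). **Algorithm (Selfish-Robust MMAB)**, run by each player with inputs $K$ and $T$ only. Put $\gamma_1=\frac{13}{14}$, $\gamma_2=\frac{16}{15}$, $\beta=39$,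 $n=\beta^2K^2\log T$. 1. *Estimation of $M$.* Pull arms uniformly at random in $[K]$ until, for every arm $k$, the number $|N_k|$ of own rounds on $k$ with $X_k>0$ is at least $n$; let $t_m$ be the number of rounds used and $\hat p_k$ the fraction of the rounds in $N_k$ with a collision ($r=0$). Put $\widehat M=1+\mathrm{round}\big(\log(1-\frac1K\sum_k\hat p_k)/\log(1-\frac1K)\big)$, projected on $\{1,\dots,K\}$. Keep pulling uniformly in $[K]$ until round $\lceil\frac{\gamma_2}{\gamma_1}t_m\rceil$. 2. *Rank.* During the next $\lceil t_m\log(T)/(\gamma_1 n)\rceil$ rounds pull uniformly at random in $[\widehat M]$ until a positive reward is obtained; the arm $j$ of that round is the rank, and it is pulled from then on until round $\lceil(\frac{\gamma_2}{\gamma_1^2\beta^2K^2}+\frac{\gamma_2^2}{\gamma_1^2})t_m\rceil$. (Without such a round, $j=-1$ and the player keeps pulling uniformly in $[\widehat M]$ until that round.) 3. *Exploration/exploitation.* From then on, at round $t$, use the statistics of the last round $b\le t$ divisible by $\widehat M$: from all her rounds before $b$, the numbers of pulls $T_k$, the empirical means $\hat\mu_k$ of the observed $X_k$, the list $l_1<\dots<l_{\widehat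 M}$ of the $\widehat M$ empirically best arms, the $\widehat M$-th empirically best arm $\hat m$, and the indices $b_k=\sup\{q\in[0,1]: T_k\,\mathrm{kl}(\hat\mu_k,q)\le \log b+4\log\log b\}$. Let $\pi=((t+j)\bmod \widehat M)+1$. If $l_\pi\ne\hat m$, pull $l_\pi$. Otherwise let $\mathcal B$ be the set of arms $k$ outside the list with $b_k\ge\hat\mu_{\hat m}$; if $\mathcal B=\emptyset$ pull $l_\pi$, else pull $l_\pi$ with probability $\frac12$ and a uniformly random arm of $\mathcal B$ otherwise. **Theorem.** There is a universal constant $C>0$ such that for all $K$, $M$ and $(\nu_k)_{k\le K}$ as above, if all $M$ players run Selfish-Robust MMAB with horizon $T$, then for all $T$ large enough (depending on the instance $K,M,(\nu_k)$) $$\mathbb E[R_T]\le M\sum_{k=M+1}^{K}\frac{\mu_{(M)}-\mu_{(k)}}{\mathrm{kl}(\mu_{(k)},\mu_{(M)})}\log T+C\,\frac{MK^3}{\mu_{(K)}}\log T .$$ -/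

import Mathlib

open scoped Classical ENNReal unitInterval

noncomputable section

namespace MMAB

/-! ## The bandit instance -/

/-- Mean of arm `k`. A distribution of transmission qualities is a measure on `[0,1]`. -/
def mean {K : ℕ} (ν : Fin K → MeasureTheory.Measure I) (k : Fin K) : ℝ :=
  ∫ x, (x : ℝ) ∂(ν k)

/-- `ordMean m i` is the `i`-th largest entry `m_(i)` of `m`, for `1 ≤ i ≤ K`
(and `0` outside this range). -/
def ordMean {K : ℕ} (m : Fin K → ℝ) (i : ℕ) : ℝ :=
  if h : 1 ≤ i ∧ i ≤ K then m (Tuple.sort (fun k => -m k) ⟨i - 1, by omega⟩) else 0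

/-- Kullback-Leibler divergence between the Bernoulli distributions of parameters
`p, q ∈ [0,1]`, with value `∞` when absolute continuity fails. -/
def kl (p q : ℝ) : ℝ≥0∞ :=
  if (q = 0 ∧ p ≠ 0) ∨ (q = 1 ∧ p ≠ 1) then ⊤
  else ENNReal.ofReal
    (p * Real.log (p / q) + (1 - p) * Real.log ((1 - p) / (1 - q)))

/-! ## The game with statistic sensing -/

/-- What a player knows about one past round: the arm `π` she pulled, the quality
`X_π` of that arm, and her reward `r`. -/
abbrev Record (K : ℕ) := Fin K × ℝ × ℝ

/-- A (randomized) strategy: the arm pulled at round `t + 1`, as a function of the player's own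
records of rounds `1, …, t` (entry `i : Fin t` is round `i + 1`) and of a fresh private random
number, uniform in `[0,1]`. -/
abbrev Strategy (K : ℕ) := (t : ℕ) → (Fin t → Record K) → ℝ → Fin K

/-- Collision indicator `η_k` when the players pull the arms `a`. -/
def collision {K M : ℕ} (a : Fin M → Fin K) (k : Fin K) : ℝ :=
  if 1 < (Finset.univ.filter fun j => a j = k).card then 1 else 0

/-- Sample space: for every round, the qualities of the arms and the players' private random
numbers. Entry `t : ℕ` is round `t + 1`. -/
abbrev Outcome (K M : ℕ) := ℕ → (Fin K → I) × (Fin M → I)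

/-- All the qualities are independent, `X_k(t)` has law `ν k`; the private random numbers are
independent of them, mutually independent and uniform in `[0,1]`. -/
def law {K : ℕ} (M : ℕ) (ν : Fin K → MeasureTheory.Measure I)
    [∀ k, MeasureTheory.IsProbabilityMeasure (ν k)] : MeasureTheory.Measure (Outcome K M) :=
  MeasureTheory.Measure.infinitePi fun _ : ℕ =>
    (MeasureTheory.Measure.pi ν).prod
      (MeasureTheory.Measure.pi fun _ : Fin M => (MeasureTheory.volume : MeasureTheory.Measure I))

/-- The records of all players after `t` rounds, when they play the profile `s`. -/
def history {K M : ℕ} (s : Fin M → Strategy K) (ω : Outcome K M) :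
    (t : ℕ) → Fin M → Fin t → Record K
  | 0 => fun _ i => i.elim0
  | t + 1 => fun j =>
      let a : Fin M → Fin K := fun i => s i t (history s ω t i) ((ω t).2 i)
      let x : ℝ := (ω t).1 (a j)
      Fin.snoc (α := fun _ => Record K) (history s ω t j) (a j, x, x * (1 - collision a (a j)))

/-- The arm `π^j(t + 1)`. -/
def action {K M : ℕ} (s : Fin M → Strategy K) (ω : Outcome K M) (t : ℕ) (j : Fin M) : Fin K :=
  s j t (history s ω t j) ((ω t).2 j)

/-- The collective regret `R_T` of the profile `s`. -/
def regret {K M : ℕ} (ν : Fin K → MeasureTheory.Measure I) (s : Fin M → Strategy K) (T : ℕ)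
    (ω : Outcome K M) : ℝ :=
  T * ∑ k ∈ Finset.Icc 1 M, ordMean (mean ν) k
    - ∑ t ∈ Finset.range T, ∑ j : Fin M,
        mean ν (action s ω t j) * (1 - collision (action s ω t) (action s ω t j))

/-! ## Sampling and statistics -/

section Algorithm

variable {K : ℕ} [NeZero K]

/-- `⌊u |s|⌋`-th element of `s` (counted from `0`): for `u` uniform in `[0,1)`, this is uniform
in the nonempty set `s`. -/
def pick (s : Finset (Fin K)) (u : ℝ) : Fin K :=
  (s.sort (· ≤ ·)).getD ⌊u * s.card⌋₊ 0

/-- `card N_k(s)`: rounds among the first `s` where arm `k` was pulled with positive quality. -/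
def numObs {t : ℕ} (h : Fin t → Record K) (k : Fin K) (s : ℕ) : ℕ :=
  (Finset.univ.filter fun i : Fin t => i.val < s ∧ (h i).1 = k ∧ 0 < (h i).2.1).card

/-- `card C_k(s)`: those rounds of `N_k(s)` where a collision was observed (null reward in spite
of a positive quality). -/
def numColl {t : ℕ} (h : Fin t → Record K) (k : Fin K) (s : ℕ) : ℕ :=
  (Finset.univ.filter fun i : Fin t =>
    i.val < s ∧ (h i).1 = k ∧ 0 < (h i).2.1 ∧ (h i).2.2 = 0).card

/-- Empirical probability `p̂_k(s)` to collide on arm `k`. -/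
def collFreq {t : ℕ} (h : Fin t → Record K) (k : Fin K) (s : ℕ) : ℝ :=
  (numColl h k s : ℝ) / numObs h k s

/-- Number of pulls of arm `k` during the first `s` rounds. -/
def pulls {t : ℕ} (h : Fin t → Record K) (k : Fin K) (s : ℕ) : ℕ :=
  (Finset.univ.filter fun i : Fin t => i.val < s ∧ (h i).1 = k).card

/-- Empirical mean of the qualities of arm `k` observed during the first `s` rounds. -/
def empMean {t : ℕ} (h : Fin t → Record K) (k : Fin K) (s : ℕ) : ℝ :=
  (∑ i ∈ Finset.univ.filter fun i : Fin t => i.val < s ∧ (h i).1 = k, (h i).2.1) / pulls h k s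

/-! ## The initialization: estimation of the number of players and of a rank -/

def γ₁ : ℝ := 13 / 14

def γ₂ : ℝ := 16 / 15

def β : ℝ := 39

/-- Number `n` of observations required on each arm. -/
def obsTarget (K T : ℕ) : ℝ := β ^ 2 * (K : ℝ) ^ 2 * Real.log T

/-- Each arm has been observed enough after `s` rounds. -/
def EstimDone (T : ℕ) {t : ℕ} (h : Fin t → Record K) (s : ℕ) : Prop :=
  ∀ k : Fin K, obsTarget K T ≤ numObs h k s

/-- Duration `t_m` of the estimation protocol. -/
def estimTime (T : ℕ) {t : ℕ} (h : Fin t → Record K) : ℕ :=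
  sInf {s | EstimDone T h s}

/-- Estimate `M̂` of the number of players. The projection on `{1, …, K}` only makes the
algorithm well defined when the estimate is not a possible number of players. -/
def estimM (T : ℕ) {t : ℕ} (h : Fin t → Record K) : ℕ :=
  max 1 (min K (1 + round
    (Real.log (1 - (∑ k : Fin K, collFreq h k (estimTime T h)) / K)
      / Real.log (1 - 1 / (K : ℝ)))).toNat)

/-- Rounds `i + 1 ∈ {a + 1, …, b}` with positive reward. -/
def positiveRounds {t : ℕ} (h : Fin t → Record K) (a b : ℕ) : Finset (Fin t) :=
  Finset.univ.filter fun i : Fin t => a ≤ i.val ∧ i.val < b ∧ 0 < (h i).2.2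

/-- The rank obtained during the rounds `a + 1, …, b` of the musical chairs: the arm of the first
positive reward, if there is one. -/
def rank {t : ℕ} (h : Fin t → Record K) (a b : ℕ) : Option (Fin K) :=
  if hne : (positiveRounds h a b).Nonempty then some (h ((positiveRounds h a b).min' hne)).1
  else none

/-! ## The exploration-exploitation phase -/

/-- Number of arms empirically better than `k` after `s` rounds (ties broken by the index). -/
def empRank {t : ℕ} (h : Fin t → Record K) (s : ℕ) (k : Fin K) : ℕ :=
  (Finset.univ.filter fun l : Fin K =>
    empMean h k s < empMean h l s ∨ (empMean h l s = empMean h k s ∧ l < k)).card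

/-- The `N` empirically best arms after `s` rounds. -/
def bestArms {t : ℕ} (h : Fin t → Record K) (s N : ℕ) : Finset (Fin K) :=
  Finset.univ.filter fun k => empRank h s k < N

/-- The threshold `f(t) = log t + 4 log log t` (nonnegative for `t ≥ 3`). -/
def explorationThreshold (t : ℕ) : ℝ := Real.log t + 4 * Real.log (Real.log t)

/-- The kl-UCB index of arm `k` at round `b`, from the observations of the rounds before `b`. -/
def klIndex {t : ℕ} (h : Fin t → Record K) (b : ℕ) (k : Fin K) : ℝ :=
  sSup {q : ℝ | 0 ≤ q ∧ q ≤ 1 ∧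
    (pulls h k (b - 1) : ℝ≥0∞) * kl (empMean h k (b - 1)) q
      ≤ ENNReal.ofReal (explorationThreshold b)}

/-- Arm pulled by the exploration-exploitation algorithm with inputs `N` (number of players) and
`j` (rank in `{1, …, N}`, or `-1`) at round `t + 1`. The statistics are those of the last round
`b ≤ t + 1` divisible by `N`, before pulling at round `b`. -/
def explore (N : ℕ) (j : ℤ) (t : ℕ) (h : Fin t → Record K) (u : ℝ) : Fin K :=
  let b : ℕ := N * ((t + 1) / N)
  -- position in the list of best arms, counted from zero
  let p : ℕ := (((t : ℤ) + 1 + j) % (N : ℤ)).toNat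
  let l : Fin K := ((bestArms h (b - 1) N).sort (· ≤ ·)).getD p 0
  -- `l` is the `N`-th best empirical arm iff exactly `N - 1` arms are better
  if empRank h (b - 1) l + 1 ≠ N then l
  else
    let B : Finset (Fin K) := Finset.univ.filter fun k =>
      k ∉ bestArms h (b - 1) N ∧ empMean h l (b - 1) ≤ klIndex h b k
    if B = ∅ then l
    else if u < 1 / 2 then l
    else pick B (2 * u - 1)

/-! ## The whole algorithm -/

/-- Selfish-Robust MMAB with `K` arms and horizon `T`. -/
def selfishRobust (T : ℕ) : Strategy K := fun t h u =>
  if ∃ s ≤ t, EstimDone T h s then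
    let tm : ℕ := estimTime T h
    let N : ℕ := estimM T h
    -- last round of the first waiting room
    let a : ℕ := ⌈γ₂ / γ₁ * tm⌉₊
    -- last round of the attribution of ranks
    let b : ℕ := a + ⌈tm * Real.log T / (γ₁ * obsTarget K T)⌉₊
    -- last round of the second waiting room
    let c : ℕ := ⌈(γ₂ / (γ₁ ^ 2 * β ^ 2 * (K : ℝ) ^ 2) + γ₂ ^ 2 / γ₁ ^ 2) * tm⌉₊
    if t < a then pick Finset.univ u
    else if t < c then
      match rank h a b with
      | some j => j
      | none => pick (Finset.univ.filter fun k : Fin K => k.val < N) u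
    else
      match rank h a b with
      | some j => explore N ((j.val : ℤ) + 1) t h u
      | none => explore N (-1) t h u
  else pick Finset.univ u

end Algorithm

end MMAB

end

/-! The regret has three sources.

Initialization. Let `p` be the least probability that an arm shows a positive quality; `p ≥ μ_(K)`
because qualities are at most one. Collecting `n` positive observations of every arm takes about
`nK/p` rounds. As long as everybody samples uniformly, the records are those of an i.i.d. process,
and Chernoff bounds confine all durations `t_m` to a narrow window and make the collision
frequencies precise enough for the rounding to return `M` exactly (`measure_goodEst_compl_le`,
`round_log_ratio`). The waiting rooms absorb the width of the window: nobody leaves uniform sampling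
before all estimations are over, and nobody starts exploring before all musical chairs are over.
During the chairs a player without rank succeeds with conditional probability at least `p/M`
(`le_measure_success`), so `K log T / p` rounds fail with probability at most `1/T`
(`measure_noRank_le`). A failure costs at most `MT`, hence a constant in expectation, and a success
costs `M` per round during `O(K³ log T / μ_(K))` rounds.

Bad blocks. After initialization, play is cut into blocks of `M` rounds with frozen statistics. In a
block an arm can be pulled at one position only, so its statistics at that round are still those of
the block start. If no arm with a fair chance of being pulled has a deviating mean, and no index
under-estimates its arm, then the list is exactly the set of the `M` best arms and its last arm is
the worst of them (`Exploring.right_block`). Deviations at rounds with a fair chance of a pull have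
a bounded expected number: the product of exponential weights of the observed qualities shrinks in
mean at each pull, so the sum over pulls of its expectation telescopes (`pot_step`,
`sum_measure_hit_le`). Under-estimation at block start `b` has probability at most a constant times
`exp(-f(b))` (`measure_underEst_le`), which sums to an arbitrarily small multiple of `log T`.

Good blocks. The distinct ranks rotate over the same list, so there is no collision, and the only
loss comes from a player who replaces the worst good arm by a suboptimal arm `k`
(`round_regret_eq`). Up to finitely many deviations in expectation, the index test forces `k` to
have been pulled at most `f(T) / kl(μ_k + δ, μ_w - δ)` times (`Exploring.suboptimal_pull`).

For a fixed small `δ`, the inverse of the perturbed divergence exceeds the true one by at most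
`1/2`. The resulting excess is at most `MK log T` and is absorbed by the second term of the bound,
so the first term keeps its exact constant. -/

noncomputable section

namespace MMAB

/-! ## The Bernoulli relative entropy -/

/-- Real-valued Bernoulli relative entropy. -/
def klr (p q : ℝ) : ℝ :=
  p * Real.log (p / q) + (1 - p) * Real.log ((1 - p) / (1 - q))

/-- Derivative of the negative binary entropy. Differences of it are both the cross term of the
three-point identity and the optimal exponential tilts. -/
def logit (p : ℝ) : ℝ := Real.log p - Real.log (1 - p)

theorem mul_log_div (x : ℝ) {q : ℝ} (hq : q ≠ 0) :
    x * Real.log (x / q) = x * Real.log x - x * Real.log q := by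
  by_cases hx : x = 0
  · simp [hx]
  · rw [Real.log_div hx hq]; ring

/-- Thanks to the convention `log 0 = 0`, this expanded form needs no restriction on `x`; continuity
and algebraic identities in `x` can be read off it, endpoints included. -/
theorem klr_eq (x : ℝ) {q : ℝ} (h0 : 0 < q) (h1 : q < 1) :
    klr x q = x * Real.log x + (1 - x) * Real.log (1 - x) - x * Real.log q
      - (1 - x) * Real.log (1 - q) := by
  unfold klr
  rw [mul_log_div x h0.ne', mul_log_div (1 - x) (by linarith : (1 : ℝ) - q ≠ 0)]
  ring

theorem sub_le_mul_log_div {x q : ℝ} (hx : 0 ≤ x) (hq : 0 < q) :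
    x - q ≤ x * Real.log (x / q) := by
  rcases hx.eq_or_lt with rfl | hx
  · simp [hq.le]
  have h := Real.one_sub_inv_le_log_of_pos (div_pos hx hq)
  have := mul_le_mul_of_nonneg_left h hx.le
  rw [inv_div, mul_sub, mul_one, mul_div_cancel₀ _ hx.ne'] at this
  exact this

theorem sub_lt_mul_log_div {x q : ℝ} (hx : 0 ≤ x) (hq : 0 < q) (hne : x ≠ q) :
    x - q < x * Real.log (x / q) := by
  rcases hx.eq_or_lt with rfl | hx
  · simpa using hq
  have h : 1 - (x / q)⁻¹ < Real.log (x / q) := by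
    have h2 := Real.log_lt_sub_one_of_pos (inv_pos.2 (div_pos hx hq))
      (by rw [inv_div, Ne, div_eq_one_iff_eq hx.ne']; exact fun h => hne h.symm)
    rw [Real.log_inv] at h2
    linarith
  have := mul_lt_mul_of_pos_left h hx
  rw [inv_div, mul_sub, mul_one, mul_div_cancel₀ _ hx.ne'] at this
  exact this

theorem klr_nonneg {x q : ℝ} (hx0 : 0 ≤ x) (hx1 : x ≤ 1) (h0 : 0 < q) (h1 : q < 1) :
    0 ≤ klr x q := by
  have h := sub_le_mul_log_div hx0 h0
  have h' := sub_le_mul_log_div (sub_nonneg.2 hx1) (sub_pos.2 h1)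
  unfold klr; linarith

theorem klr_pos {x q : ℝ} (hx0 : 0 ≤ x) (hx1 : x ≤ 1) (h0 : 0 < q) (h1 : q < 1) (hne : x ≠ q) :
    0 < klr x q := by
  have h := sub_lt_mul_log_div hx0 h0 hne
  have h' := sub_le_mul_log_div (sub_nonneg.2 hx1) (sub_pos.2 h1)
  unfold klr; linarith

theorem klr_self {q : ℝ} : klr q q = 0 := by
  unfold klr
  by_cases h0 : q = 0
  · simp [h0]
  by_cases h1 : 1 - q = 0
  · simp [h1, h0]
  simp [div_self h0, div_self h1]

/-- The relative entropy is the Bregman divergence of the negative binary entropy, whose gradient is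
`logit`. When the middle point lies between the two others the cross term is nonnegative, which
yields all the monotonicity properties below. -/
theorem klr_three_point (x : ℝ) {q p : ℝ} (hq0 : 0 < q) (hq1 : q < 1) (hp0 : 0 < p)
    (hp1 : p < 1) :
    klr x p = klr x q + klr q p + (x - q) * (logit q - logit p) := by
  rw [klr_eq x hp0 hp1, klr_eq x hq0 hq1, klr_eq q hp0 hp1]
  unfold logit; ring

theorem logit_le {p q : ℝ} (hp : 0 < p) (hpq : p ≤ q) (hq : q < 1) : logit p ≤ logit q := by
  unfold logit
  have h1 := Real.log_le_log hp hpq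
  have h2 := Real.log_le_log (by linarith : 0 < 1 - q) (by linarith : 1 - q ≤ 1 - p)
  linarith

theorem klr_anti_left {x y q : ℝ} (hx0 : 0 ≤ x) (hxy : x ≤ y) (hyq : y ≤ q) (hq1 : q < 1)
    (hq0 : 0 < q) : klr y q ≤ klr x q := by
  rcases hxy.eq_or_lt with rfl | hlt
  · exact le_rfl
  have hy0 : 0 < y := hx0.trans_lt hlt
  have hy1 : y < 1 := hyq.trans_lt hq1
  rw [klr_three_point x hy0 hy1 hq0 hq1]
  have h1 := klr_nonneg hx0 (hxy.trans hy1.le) hy0 hy1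
  have h2 : 0 ≤ (x - y) * (logit y - logit q) :=
    mul_nonneg_of_nonpos_of_nonpos (by linarith) (by linarith [logit_le hy0 hyq hq1])
  linarith

/-- Super-additivity along an ordered triple. It supplies the extra factor `exp(-N * klr c p)` that
makes the union bound over the number of pulls a geometric series in `measure_underEst_le`. -/
theorem klr_add_le {x q p : ℝ} (hxq : x ≤ q) (hqp : q ≤ p) (hq0 : 0 < q)
    (hp1 : p < 1) : klr x q + klr q p ≤ klr x p := by
  have hq1 : q < 1 := hqp.trans_lt hp1
  have hp0 : 0 < p := hq0.trans_le hqp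
  rw [klr_three_point x hq0 hq1 hp0 hp1]
  have h2 : 0 ≤ (x - q) * (logit q - logit p) :=
    mul_nonneg_of_nonpos_of_nonpos (by linarith) (by linarith [logit_le hq0 hqp hp1])
  linarith

theorem klr_mono_right {x q p : ℝ} (hxq : x ≤ q) (hqp : q ≤ p) (hq0 : 0 < q)
    (hp1 : p < 1) : klr x q ≤ klr x p := by
  have := klr_add_le hxq hqp hq0 hp1
  have h := klr_nonneg hq0.le (hqp.trans hp1.le) (hq0.trans_le hqp) hp1
  linarith

/-- The optimal exponential tilt achieves the relative entropy. -/
theorem klr_legendre {x p : ℝ} (hx0 : 0 < x) (hx1 : x < 1) (hp0 : 0 < p) (hp1 : p < 1) :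
    (logit x - logit p) * x - Real.log (1 - p + p * Real.exp (logit x - logit p)) = klr x p := by
  have h1x : 0 < 1 - x := by linarith
  have h1p : 0 < 1 - p := by linarith
  have he : Real.exp (logit x - logit p) = x * (1 - p) / (p * (1 - x)) := by
    unfold logit
    rw [show Real.log x - Real.log (1 - x) - (Real.log p - Real.log (1 - p))
      = (Real.log x + Real.log (1 - p)) - (Real.log p + Real.log (1 - x)) by ring,
      ← Real.log_mul hx0.ne' h1p.ne', ← Real.log_mul hp0.ne' h1x.ne', Real.exp_sub,
      Real.exp_log (by positivity), Real.exp_log (by positivity)]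
  have hs : 1 - p + p * (x * (1 - p) / (p * (1 - x))) = (1 - p) / (1 - x) := by
    field_simp; ring
  rw [he, hs, Real.log_div h1p.ne' h1x.ne', klr_eq x hp0 hp1]
  unfold logit; ring

theorem continuous_klr_left {q : ℝ} (h0 : 0 < q) (h1 : q < 1) : Continuous fun x => klr x q := by
  have : (fun x => klr x q) = fun x => x * Real.log x + (1 - x) * Real.log (1 - x)
      - x * Real.log q - (1 - x) * Real.log (1 - q) := by
    funext x; exact klr_eq x h0 h1
  rw [this]
  have h := Real.continuous_mul_log
  have h' : Continuous fun x : ℝ => (1 - x) * Real.log (1 - x) :=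
    h.comp (continuous_const.sub continuous_id)
  fun_prop

/-- Points below `q` of relative entropy larger than `f` lie below a point of entropy `f`. -/
theorem exists_klr_eq {q y f : ℝ} (hq0 : 0 < q) (hq1 : q < 1) (hf : 0 < f) (hy0 : 0 ≤ y)
    (hyq : y < q) (hy : f < klr y q) :
    ∃ x, 0 < x ∧ x < q ∧ klr x q = f ∧ ∀ z, z ≤ q → f < klr z q → z < x := by
  have hc := continuous_klr_left hq0 hq1
  have h0 : f < klr 0 q := hy.trans_le (klr_anti_left le_rfl hy0 hyq.le hq1 hq0)
  obtain ⟨x, ⟨hx0, hxq⟩, hx⟩ := intermediate_value_Icc' hq0.le hc.continuousOn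
    (show f ∈ Set.Icc (klr q q) (klr 0 q) from ⟨by rw [klr_self]; exact hf.le, h0.le⟩)
  refine ⟨x, lt_of_le_of_ne hx0 ?_, lt_of_le_of_ne hxq ?_, hx, ?_⟩
  · rintro rfl; simp only at hx; linarith
  · rintro rfl; simp only [klr_self] at hx; linarith
  · intro z hz hfz
    by_contra! hxz
    have := klr_anti_left hx0 hxz hz hq1 hq0
    simp only at hx; linarith

theorem kl_eq_ofReal {p q : ℝ} (h0 : 0 < q) (h1 : q < 1) : kl p q = ENNReal.ofReal (klr p q) := by
  unfold kl klr
  rw [if_neg]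
  rintro (h | h) <;> linarith [h.1]

theorem kl_self {q : ℝ} : kl q q = 0 := by
  unfold kl
  rw [if_neg (by tauto)]
  have := klr_self (q := q)
  unfold klr at this
  rw [this, ENNReal.ofReal_zero]

/-! ## The kl-UCB index -/

/-- The index of an arm pulled `n` times with empirical mean `x`, at threshold `f`. -/
def klUCB (n : ℕ) (f x : ℝ) : ℝ :=
  sSup {q : ℝ | 0 ≤ q ∧ q ≤ 1 ∧ (n : ℝ≥0∞) * kl x q ≤ ENNReal.ofReal f}

theorem klIndex_eq {K t : ℕ} (h : Fin t → Record K) (b : ℕ) (k : Fin K) :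
    klIndex h b k = klUCB (pulls h k (b - 1)) (explorationThreshold b) (empMean h k (b - 1)) := rfl

theorem bddAbove_klSet (n : ℕ) (f x : ℝ) :
    BddAbove {q : ℝ | 0 ≤ q ∧ q ≤ 1 ∧ (n : ℝ≥0∞) * kl x q ≤ ENNReal.ofReal f} :=
  ⟨1, fun _ h => h.2.1⟩

theorem le_klUCB {n : ℕ} {f x q : ℝ} (h0 : 0 ≤ q) (h1 : q ≤ 1)
    (h : (n : ℝ≥0∞) * kl x q ≤ ENNReal.ofReal f) : q ≤ klUCB n f x :=
  le_csSup (bddAbove_klSet n f x) ⟨h0, h1, h⟩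

theorem self_le_klUCB {n : ℕ} {f x : ℝ} (h0 : 0 ≤ x) (h1 : x ≤ 1) : x ≤ klUCB n f x :=
  le_klUCB h0 h1 (by simp [kl_self])

/-- Otherwise `c` itself would be admissible in the supremum. This turns a low index into the event
`UnderEst`. -/
theorem of_klUCB_lt {n : ℕ} {f x c : ℝ} (hx0 : 0 ≤ x) (hx1 : x ≤ 1) (hc0 : 0 < c) (hc1 : c < 1)
    (h : klUCB n f x < c) : x < c ∧ f < n * klr x c := by
  have hxc : x < c := (self_le_klUCB hx0 hx1).trans_lt h
  refine ⟨hxc, ?_⟩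
  by_contra! hle
  refine absurd h (not_lt.2 (le_klUCB hc0.le hc1.le ?_))
  rw [kl_eq_ofReal hc0 hc1, ← ENNReal.ofReal_natCast, ← ENNReal.ofReal_mul (Nat.cast_nonneg n)]
  exact ENNReal.ofReal_le_ofReal hle

/-- Some admissible point lies beyond `c`, and the divergence from `x` increases to the right of
`x`. That point may be `1`, but only without pulls: its divergence is infinite. -/
theorem of_lt_klUCB {n : ℕ} {f x c : ℝ} (hf : 0 ≤ f) (hx0 : 0 ≤ x) (hxc : x < c) (hc1 : c < 1)
    (h : c < klUCB n f x) : n * klr x c ≤ f := by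
  have hc0 : 0 < c := hx0.trans_lt hxc
  have hne : {q : ℝ | 0 ≤ q ∧ q ≤ 1 ∧ (n : ℝ≥0∞) * kl x q ≤ ENNReal.ofReal f}.Nonempty :=
    ⟨x, hx0, hxc.le.trans hc1.le, by simp [kl_self]⟩
  obtain ⟨q, ⟨hq0, hq1, hq⟩, hcq⟩ := exists_lt_of_lt_csSup hne h
  rcases Nat.eq_zero_or_pos n with rfl | hn
  · simpa using hf
  rcases hq1.eq_or_lt with rfl | hq1
  · have : kl x 1 = ⊤ := by
      unfold kl; rw [if_pos (Or.inr ⟨rfl, (hxc.trans hc1).ne⟩)]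
    rw [this, ENNReal.mul_top (by exact_mod_cast hn.ne')] at hq
    exact absurd hq (by simp)
  · rw [kl_eq_ofReal (hc0.trans hcq) hq1, ← ENNReal.ofReal_natCast,
      ← ENNReal.ofReal_mul (Nat.cast_nonneg n), ENNReal.ofReal_le_ofReal_iff hf] at hq
    refine le_trans (mul_le_mul_of_nonneg_left ?_ (Nat.cast_nonneg n)) hq
    exact klr_mono_right hxc.le hcq.le hc0 hq1

/-- An admissible `q` for `x` is either at most `y`, which is admissible for itself, or above `y`,
and then moving from `x` to `y` decreases the divergence to `q`. Monotonicity is what gives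
measurability of the index. -/
theorem klUCB_mono {n : ℕ} {f x y : ℝ} (hx0 : 0 ≤ x) (hxy : x ≤ y) (hy1 : y ≤ 1) :
    klUCB n f x ≤ klUCB n f y := by
  refine csSup_le ⟨x, hx0, hxy.trans hy1, by simp [kl_self]⟩ ?_
  rintro q ⟨hq0, hq1, hq⟩
  rcases le_or_gt q y with hqy | hyq
  · exact hqy.trans (self_le_klUCB (hx0.trans hxy) hy1)
  refine le_klUCB hq0 hq1 (le_trans (mul_le_mul_right ?_ _) hq)
  rcases hq1.eq_or_lt with rfl | hq1
  · have : kl x 1 = ⊤ := by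
      unfold kl; rw [if_pos (Or.inr ⟨rfl, (hxy.trans_lt hyq).ne⟩)]
    simp [this]
  · have hq0 : 0 < q := (hx0.trans hxy).trans_lt hyq
    rw [kl_eq_ofReal hq0 hq1, kl_eq_ofReal hq0 hq1]
    exact ENNReal.ofReal_le_ofReal (klr_anti_left hx0 hxy hyq.le hq1 hq0)

/-- Monotonicity is available only for means in `[0,1]`; clamping the argument extends it to the
whole line without changing the values that occur. -/
theorem measurable_klUCB_projIcc (n : ℕ) (f : ℝ) :
    Measurable fun x : ℝ => klUCB n f (Set.projIcc (0 : ℝ) 1 zero_le_one x) := by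
  refine Monotone.measurable fun x y hxy => ?_
  have h : (Set.projIcc (0 : ℝ) 1 zero_le_one x : ℝ) ≤ Set.projIcc (0 : ℝ) 1 zero_le_one y :=
    Set.monotone_projIcc zero_le_one hxy
  exact klUCB_mono (Set.projIcc (0 : ℝ) 1 zero_le_one x).2.1 h
    (Set.projIcc (0 : ℝ) 1 zero_le_one y).2.2

end MMAB

end

noncomputable section

set_option linter.unusedSectionVars false

namespace MMAB

open MeasureTheory

/-! ## Resampling one round -/

section Resample

variable {α : Type*} [MeasurableSpace α]

theorem measurable_update_pair (t : ℕ) :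
    Measurable fun p : (ℕ → α) × α => Function.update p.1 t p.2 := by
  refine measurable_pi_lambda _ fun i => ?_
  by_cases h : i = t
  · subst h; simpa using measurable_snd
  · simp only [Function.update_of_ne h]
    exact (measurable_pi_apply i).comp measurable_fst

/-- Redrawing one coordinate preserves the product law. The inner integral over the redrawn
coordinate plays the part of a conditional expectation given the past, since histories up to round
`t` ignore entry `t`; no filtration is needed. -/
theorem infinitePi_map_update (P : Measure α) [IsProbabilityMeasure P] (t : ℕ) :
    ((Measure.infinitePi fun _ : ℕ => P).prod P).map
      (fun p : (ℕ → α) × α => Function.update p.1 t p.2) = Measure.infinitePi fun _ : ℕ => P := by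
  refine Measure.eq_infinitePi (fun _ : ℕ => P) fun s A hA => ?_
  rw [Measure.map_apply (measurable_update_pair t)
    (MeasurableSet.pi s.countable_toSet fun i _ => hA i)]
  by_cases ht : t ∈ s
  · have : (fun p : (ℕ → α) × α => Function.update p.1 t p.2) ⁻¹' ((s : Set ℕ).pi A)
        = (((s.erase t : Finset ℕ) : Set ℕ).pi A) ×ˢ A t := by
      ext ⟨ω, y⟩
      simp only [Set.mem_preimage, Set.mem_pi, Finset.mem_coe, Set.mem_prod, Finset.mem_erase]
      constructor
      · intro h
        refine ⟨fun i hi => ?_, ?_⟩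
        · have := h i hi.2
          rwa [Function.update_of_ne hi.1] at this
        · simpa using h t ht
      · rintro ⟨h1, h2⟩ i hi
        by_cases hit : i = t
        · subst hit; simpa using h2
        · rw [Function.update_of_ne hit]; exact h1 i ⟨hit, hi⟩
    rw [this, Measure.prod_prod, Measure.infinitePi_pi _ (fun i _ => hA i),
      Finset.prod_erase_mul _ _ ht]
  · have : (fun p : (ℕ → α) × α => Function.update p.1 t p.2) ⁻¹' ((s : Set ℕ).pi A)
        = ((s : Set ℕ).pi A) ×ˢ Set.univ := by
      ext ⟨ω, y⟩
      simp only [Set.mem_preimage, Set.mem_pi, Finset.mem_coe, Set.mem_prod, Set.mem_univ, and_true]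
      refine forall₂_congr fun i hi => ?_
      rw [Function.update_of_ne (fun h : i = t => ht (h ▸ Finset.mem_coe.1 hi))]
    rw [this, Measure.prod_prod, Measure.infinitePi_pi _ (fun i _ => hA i), measure_univ, mul_one]

theorem lintegral_resample (P : Measure α) [IsProbabilityMeasure P] (t : ℕ)
    {F : (ℕ → α) → ℝ≥0∞} (hF : Measurable F) :
    ∫⁻ ω, F ω ∂(Measure.infinitePi fun _ : ℕ => P)
      = ∫⁻ ω, ∫⁻ y, F (Function.update ω t y) ∂P ∂(Measure.infinitePi fun _ : ℕ => P) := by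
  conv_lhs => rw [← infinitePi_map_update P t]
  rw [lintegral_map hF (measurable_update_pair t),
    lintegral_prod (fun p : (ℕ → α) × α => F (Function.update p.1 t p.2))
      (hF.comp (measurable_update_pair t)).aemeasurable]

end Resample

/-- Law of one round. -/
def roundLaw {K : ℕ} (M : ℕ) (ν : Fin K → Measure I) : Measure ((Fin K → I) × (Fin M → I)) :=
  (Measure.pi ν).prod (Measure.pi fun _ : Fin M => (volume : Measure I))

instance {K M : ℕ} (ν : Fin K → Measure I) [∀ k, IsProbabilityMeasure (ν k)] :
    IsProbabilityMeasure (roundLaw M ν) := by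
  unfold roundLaw; infer_instance

instance {K M : ℕ} (ν : Fin K → Measure I) [∀ k, IsProbabilityMeasure (ν k)] :
    IsProbabilityMeasure (law M ν) := by
  unfold law; infer_instance

theorem lintegral_law_resample {K M : ℕ} (ν : Fin K → Measure I)
    [∀ k, IsProbabilityMeasure (ν k)] (t : ℕ) {F : Outcome K M → ℝ≥0∞} (hF : Measurable F) :
    ∫⁻ ω, F ω ∂(law M ν)
      = ∫⁻ ω, ∫⁻ y, F (Function.update ω t y) ∂(roundLaw M ν) ∂(law M ν) :=
  lintegral_resample (roundLaw M ν) t hF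

/-! ## Records along the game -/

section Records

variable {K M : ℕ}

/-- The record of round `i + 1` of player `j`. -/
def record (s : Fin M → Strategy K) (ω : Outcome K M) (j : Fin M) (i : ℕ) : Record K :=
  (action s ω i j, (ω i).1 (action s ω i j),
    (ω i).1 (action s ω i j) * (1 - collision (action s ω i) (action s ω i j)))

theorem history_eq (s : Fin M → Strategy K) (ω : Outcome K M) (t : ℕ) (j : Fin M) :
    history s ω t j = fun i : Fin t => record s ω j i := by
  induction t with
  | zero => funext i; exact i.elim0
  | succ t ih =>
    funext i
    refine Fin.lastCases ?_ (fun i => ?_) i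
    · simp only [history, Fin.snoc_last, Fin.val_last]; rfl
    · simp only [history, Fin.snoc_castSucc, Fin.val_castSucc, ih]

theorem history_congr (s : Fin M → Strategy K) {ω ω' : Outcome K M} (t : ℕ)
    (h : ∀ i < t, ω i = ω' i) : history s ω t = history s ω' t := by
  induction t with
  | zero => funext j i; exact i.elim0
  | succ t ih =>
    have ih := ih fun i hi => h i (by omega)
    funext j
    simp only [history, ih, h t (by omega)]

theorem history_update (s : Fin M → Strategy K) (ω : Outcome K M) {t n : ℕ} (hn : n ≤ t)
    (y : (Fin K → I) × (Fin M → I)) : history s (Function.update ω t y) n = history s ω n :=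
  history_congr s n fun i hi => Function.update_of_ne (by omega) _ _

theorem action_update_of_lt (s : Fin M → Strategy K) (ω : Outcome K M) {t n : ℕ} (hn : n < t)
    (y : (Fin K → I) × (Fin M → I)) : action s (Function.update ω t y) n = action s ω n := by
  funext j
  unfold action
  rw [history_update s ω hn.le, Function.update_of_ne (by omega)]

theorem action_update_self (s : Fin M → Strategy K) (ω : Outcome K M) (t : ℕ)
    (y : (Fin K → I) × (Fin M → I)) (j : Fin M) :
    action s (Function.update ω t y) t j = s j t (history s ω t j) (y.2 j) := by
  unfold action
  rw [history_update s ω le_rfl, Function.update_self]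

theorem record_update_of_lt (s : Fin M → Strategy K) (ω : Outcome K M) {t n : ℕ} (hn : n < t)
    (y : (Fin K → I) × (Fin M → I)) (j : Fin M) :
    record s (Function.update ω t y) j n = record s ω j n := by
  unfold record
  rw [action_update_of_lt s ω hn, Function.update_of_ne (by omega)]

variable (g : ℕ → Record K)

theorem card_filter_fin {t s : ℕ} (hs : s ≤ t) (p : ℕ → Prop) :
    (Finset.univ.filter fun i : Fin t => i.val < s ∧ p i).card
      = ((Finset.range s).filter p).card := by
  refine Finset.card_bij (fun i _ => i.val) ?_ ?_ ?_
  · intro i hi; simpa using hi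
  · intro i _ j _ h; exact Fin.ext h
  · intro i hi
    simp only [Finset.mem_filter, Finset.mem_range] at hi
    exact ⟨⟨i, by omega⟩, by simpa using hi, rfl⟩

theorem numObs_seq {t s : ℕ} (hs : s ≤ t) (k : Fin K) :
    numObs (fun i : Fin t => g i) k s
      = ((Finset.range s).filter fun i => (g i).1 = k ∧ 0 < (g i).2.1).card := by
  unfold numObs
  convert card_filter_fin hs (fun i => (g i).1 = k ∧ 0 < (g i).2.1)

theorem numColl_seq {t s : ℕ} (hs : s ≤ t) (k : Fin K) :
    numColl (fun i : Fin t => g i) k s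
      = ((Finset.range s).filter fun i => (g i).1 = k ∧ 0 < (g i).2.1 ∧ (g i).2.2 = 0).card := by
  unfold numColl
  convert card_filter_fin hs (fun i => (g i).1 = k ∧ 0 < (g i).2.1 ∧ (g i).2.2 = 0)

theorem pulls_seq {t s : ℕ} (hs : s ≤ t) (k : Fin K) :
    pulls (fun i : Fin t => g i) k s = ((Finset.range s).filter fun i => (g i).1 = k).card := by
  unfold pulls
  convert card_filter_fin hs (fun i => (g i).1 = k)

theorem empMean_seq {t s : ℕ} (hs : s ≤ t) (k : Fin K) :
    empMean (fun i : Fin t => g i) k s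
      = (∑ i ∈ (Finset.range s).filter fun i => (g i).1 = k, (g i).2.1)
        / ((Finset.range s).filter fun i => (g i).1 = k).card := by
  unfold empMean
  rw [pulls_seq g hs]
  congr 1
  refine Finset.sum_bij (fun i _ => i.val) ?_ ?_ ?_ ?_
  · intro i hi; simpa using hi
  · intro i _ j _ h; exact Fin.ext h
  · intro i hi
    simp only [Finset.mem_filter, Finset.mem_range] at hi
    exact ⟨⟨i, by omega⟩, by simpa using hi, rfl⟩
  · intro i _; rfl

end Records

/-! ## Measurability of the play -/

section Measurability

variable {K : ℕ}

/-- Finite summary of a history that determines the behaviour of the algorithm. -/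
abbrev Summary (K t : ℕ) :=
  (Fin t → Fin K × Prop × Prop × Prop) ×
    (Fin (t + 2) → Fin K → Fin K → Prop × Prop × Prop)

/-- The real-valued statistics enter the algorithm only through these comparisons, so an action is a
function of finitely many measurable predicates and of the seed. The times `b` go up to `t + 1`, the
latest possible start of the current block. -/
def summary {t : ℕ} (h : Fin t → Record K) : Summary K t :=
  (fun i => ((h i).1, 0 < (h i).2.1, 0 < (h i).2.2, (h i).2.2 = 0),
    fun b k l => (empMean h k (b - 1) < empMean h l (b - 1),
      empMean h k (b - 1) = empMean h l (b - 1), empMean h k (b - 1) ≤ klIndex h b l))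

variable {t : ℕ} {h h' : Fin t → Record K}

theorem summary_arm (H : summary h = summary h') (i : Fin t) : (h i).1 = (h' i).1 :=
  congrArg (fun d => (d.1 i).1) H

theorem summary_pos (H : summary h = summary h') (i : Fin t) :
    0 < (h i).2.1 ↔ 0 < (h' i).2.1 :=
  (congrArg (fun d => (d.1 i).2.1) H).to_iff

theorem summary_reward (H : summary h = summary h') (i : Fin t) :
    0 < (h i).2.2 ↔ 0 < (h' i).2.2 :=
  (congrArg (fun d => (d.1 i).2.2.1) H).to_iff

theorem summary_null (H : summary h = summary h') (i : Fin t) :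
    (h i).2.2 = 0 ↔ (h' i).2.2 = 0 :=
  (congrArg (fun d => (d.1 i).2.2.2) H).to_iff

theorem summary_lt (H : summary h = summary h') {b : ℕ} (hb : b ≤ t + 1) (k l : Fin K) :
    empMean h k (b - 1) < empMean h l (b - 1) ↔ empMean h' k (b - 1) < empMean h' l (b - 1) :=
  (congrArg (fun d => (d.2 ⟨b, by omega⟩ k l).1) H).to_iff

theorem summary_eq (H : summary h = summary h') {b : ℕ} (hb : b ≤ t + 1) (k l : Fin K) :
    empMean h k (b - 1) = empMean h l (b - 1) ↔ empMean h' k (b - 1) = empMean h' l (b - 1) :=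
  (congrArg (fun d => (d.2 ⟨b, by omega⟩ k l).2.1) H).to_iff

theorem summary_index (H : summary h = summary h') {b : ℕ} (hb : b ≤ t + 1) (k l : Fin K) :
    empMean h k (b - 1) ≤ klIndex h b l ↔ empMean h' k (b - 1) ≤ klIndex h' b l :=
  (congrArg (fun d => (d.2 ⟨b, by omega⟩ k l).2.2) H).to_iff

theorem numObs_summary (H : summary h = summary h') : numObs h = numObs h' := by
  funext k s
  unfold numObs
  simp only [summary_arm H, summary_pos H]

theorem numColl_summary (H : summary h = summary h') : numColl h = numColl h' := by
  funext k s
  unfold numColl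
  simp only [summary_arm H, summary_pos H, summary_null H]

theorem estimDone_summary (H : summary h = summary h') (T s : ℕ) :
    EstimDone T h s ↔ EstimDone T h' s := by
  unfold EstimDone
  rw [numObs_summary H]

theorem estimTime_summary (H : summary h = summary h') (T : ℕ) :
    estimTime T h = estimTime T h' := by
  unfold estimTime
  simp only [estimDone_summary H]

theorem estimM_summary (H : summary h = summary h') (T : ℕ) : estimM T h = estimM T h' := by
  unfold estimM collFreq
  simp only [estimTime_summary H, numObs_summary H, numColl_summary H]

theorem rank_summary (H : summary h = summary h') (a b : ℕ) : rank h a b = rank h' a b := by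
  have : positiveRounds h a b = positiveRounds h' a b := by
    unfold positiveRounds
    simp only [summary_reward H]
  unfold rank
  simp only [this, summary_arm H]

theorem empRank_summary (H : summary h = summary h') {b : ℕ} (hb : b ≤ t + 1) :
    empRank h (b - 1) = empRank h' (b - 1) := by
  funext k
  unfold empRank
  simp only [summary_lt H hb, summary_eq H hb]

theorem bestArms_summary (H : summary h = summary h') {b : ℕ} (hb : b ≤ t + 1) (N : ℕ) :
    bestArms h (b - 1) N = bestArms h' (b - 1) N := by
  unfold bestArms
  simp only [empRank_summary H hb]

variable [NeZero K]

theorem explore_summary (H : summary h = summary h') (N : ℕ) (j : ℤ) (u : ℝ) :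
    explore N j t h u = explore N j t h' u := by
  have hb : N * ((t + 1) / N) ≤ t + 1 := Nat.mul_div_le _ _
  unfold explore
  simp only [bestArms_summary H hb, empRank_summary H hb, summary_index H hb]

theorem selfishRobust_summary (H : summary h = summary h') (T : ℕ) (u : ℝ) :
    selfishRobust T t h u = selfishRobust T t h' u := by
  unfold selfishRobust
  simp only [estimDone_summary H, estimTime_summary H, estimM_summary H, rank_summary H,
    explore_summary H]

theorem measurable_pick (s : Finset (Fin K)) : Measurable (pick s) := by
  unfold pick
  exact (measurable_of_countable fun n : ℕ => (s.sort (· ≤ ·)).getD n 0).comp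
    (Nat.measurable_floor.comp (measurable_id.mul_const _))

theorem measurable_explore (N : ℕ) (j : ℤ) (h : Fin t → Record K) :
    Measurable (explore N j t h) := by
  unfold explore
  dsimp only
  split_ifs
  · exact measurable_const
  · exact measurable_const
  · exact Measurable.ite measurableSet_Iio measurable_const
      ((measurable_pick _).comp ((measurable_const.mul measurable_id).sub_const _))

theorem measurable_selfishRobust (T : ℕ) (h : Fin t → Record K) :
    Measurable (selfishRobust T t h) := by
  unfold selfishRobust
  dsimp only
  split_ifs
  · exact measurable_pick _
  · split
    · exact measurable_const
    · exact measurable_pick _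
  · split
    · exact measurable_explore _ _ _
    · exact measurable_explore _ _ _
  · exact measurable_pick _

/-- Functions of the summary and of the private randomness are jointly measurable. -/
theorem measurable_of_summary {Ω : Type*} [MeasurableSpace Ω] {γ : Type*} [MeasurableSpace γ]
    {H : Ω → Fin t → Record K} (hH : Measurable fun ω => summary (H ω)) {U : Ω → ℝ}
    (hU : Measurable U) (F : (Fin t → Record K) → ℝ → γ) (hF : ∀ h, Measurable (F h))
    (hs : ∀ h h' u, summary h = summary h' → F h u = F h' u) :
    Measurable fun ω => F (H ω) (U ω) := by
  -- The function factors through a countable type times the seed, so measurability can be checked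
  -- for each fixed summary. The value at summaries of no history is arbitrary, provided it is
  -- measurable in the seed.
  let E : Summary K t × ℝ → γ := fun p =>
    if hp : ∃ h, summary h = p.1 then F hp.choose p.2 else F (fun _ => (0, 0, 0)) p.2
  have hE : Measurable E := by
    refine measurable_from_prod_countable_right fun d => ?_
    by_cases hp : ∃ h : Fin t → Record K, summary h = d
    · simpa only [E, dif_pos hp] using hF _
    · simpa only [E, dif_neg hp] using hF _
  have : (fun ω => F (H ω) (U ω)) = fun ω => E (summary (H ω), U ω) := by
    funext ω
    have hp : ∃ h, summary h = summary (H ω) := ⟨_, rfl⟩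
    simp only [E, dif_pos hp]
    exact hs _ _ _ hp.choose_spec.symm
  rw [this]
  exact hE.comp (hH.prodMk hU)

variable {M : ℕ}

theorem record_quality_mem (s : Fin M → Strategy K) (ω : Outcome K M) (j : Fin M) (i : ℕ) :
    (record s ω j i).2.1 ∈ Set.Icc (0 : ℝ) 1 := ((ω i).1 _).2

theorem empMean_mem {h : Fin t → Record K} (hh : ∀ i, (h i).2.1 ∈ Set.Icc (0 : ℝ) 1)
    (k : Fin K) (s : ℕ) : empMean h k s ∈ Set.Icc (0 : ℝ) 1 := by
  unfold empMean pulls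
  constructor
  · exact div_nonneg (Finset.sum_nonneg fun i _ => (hh i).1) (Nat.cast_nonneg _)
  · refine div_le_one_of_le₀ ?_ (Nat.cast_nonneg _)
    refine (Finset.sum_le_card_nsmul _ _ 1 fun i _ => (hh i).2).trans ?_
    simp

theorem measurable_pulls (k : Fin K) (s : ℕ) : Measurable fun h : Fin t → Record K => pulls h k s := by
  unfold pulls
  simp only [Finset.card_filter]
  refine Finset.measurable_sum _ fun i _ => Measurable.ite ?_ measurable_const measurable_const
  by_cases hi : i.val < s
  · simp only [hi, true_and]
    exact measurableSet_eq_fun (measurable_fst.comp (measurable_pi_apply i)) measurable_const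
  · simp [hi]

theorem measurable_empMean (k : Fin K) (s : ℕ) :
    Measurable fun h : Fin t → Record K => empMean h k s := by
  unfold empMean
  simp only [Finset.sum_filter]
  refine Measurable.div ?_ (measurable_from_nat.comp (measurable_pulls k s))
  refine Finset.measurable_sum _ fun i _ => Measurable.ite ?_ ?_ measurable_const
  · by_cases hi : i.val < s
    · simp only [hi, true_and]
      exact measurableSet_eq_fun (measurable_fst.comp (measurable_pi_apply i)) measurable_const
    · simp [hi]
  · exact measurable_fst.comp (measurable_snd.comp (measurable_pi_apply i))

theorem measurable_klUCB_comp {Ω : Type*} [MeasurableSpace Ω] (f : ℝ) {n : Ω → ℕ} {x : Ω → ℝ}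
    (hn : Measurable n) (hx : Measurable x) :
    Measurable fun ω => klUCB (n ω) f (Set.projIcc (0 : ℝ) 1 zero_le_one (x ω)) := by
  have hE : Measurable fun p : ℕ × ℝ => klUCB p.1 f (Set.projIcc (0 : ℝ) 1 zero_le_one p.2) :=
    measurable_from_prod_countable_right fun n => measurable_klUCB_projIcc n f
  have h := hE.comp (hn.prodMk hx)
  simpa only [Function.comp_def] using h

theorem measurable_summary {Ω : Type*} [MeasurableSpace Ω] {H : Ω → Fin t → Record K}
    (hH : Measurable H) (hh : ∀ ω i, (H ω i).2.1 ∈ Set.Icc (0 : ℝ) 1) :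
    Measurable fun ω => summary (H ω) := by
  have hmean : ∀ k s, Measurable fun ω => empMean (H ω) k s := fun k s =>
    (measurable_empMean k s).comp hH
  have hcoord : ∀ i, Measurable fun ω => H ω i := fun i => (measurable_pi_apply i).comp hH
  have hprop : ∀ {p : Ω → Prop}, MeasurableSet {ω | p ω} → Measurable p := fun h =>
    measurableSet_setOfPred.1 h
  refine Measurable.prodMk ?_ ?_
  · refine measurable_pi_lambda _ fun i => ?_
    have h2 := (measurable_fst.comp (measurable_snd.comp (hcoord i)))
    have h3 := (measurable_snd.comp (measurable_snd.comp (hcoord i)))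
    refine (measurable_fst.comp (hcoord i)).prodMk ((hprop ?_).prodMk ((hprop ?_).prodMk (hprop ?_)))
    · exact measurableSet_lt measurable_const h2
    · exact measurableSet_lt measurable_const h3
    · exact measurableSet_eq_fun h3 measurable_const
  · refine measurable_pi_lambda _ fun b => measurable_pi_lambda _ fun k =>
      measurable_pi_lambda _ fun l => (hprop ?_).prodMk ((hprop ?_).prodMk (hprop ?_))
    · exact measurableSet_lt (hmean _ _) (hmean _ _)
    · exact measurableSet_eq_fun (hmean _ _) (hmean _ _)
    · refine measurableSet_le (hmean _ _) ?_
      have : (fun ω => klIndex (H ω) b l) = fun ω => klUCB (pulls (H ω) l (b - 1))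
          (explorationThreshold b)
          (Set.projIcc (0 : ℝ) 1 zero_le_one (empMean (H ω) l (b - 1))) := by
        funext ω
        rw [klIndex_eq, Set.projIcc_of_mem zero_le_one (empMean_mem (hh ω) l (b - 1))]
      rw [this]
      exact measurable_klUCB_comp _ ((measurable_pulls l _).comp hH) (hmean _ _)

/-- The profile where all players run the algorithm. -/
abbrev play (K M T : ℕ) [NeZero K] : Fin M → Strategy K := fun _ => selfishRobust T

theorem measurable_coord (t : ℕ) (k : Fin K) :
    Measurable fun ω : Outcome K M => ((ω t).1 k : ℝ) :=
  measurable_subtype_coe.comp ((measurable_pi_apply k).comp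
    (measurable_fst.comp (measurable_pi_apply t)))

theorem measurable_seed (t : ℕ) (j : Fin M) :
    Measurable fun ω : Outcome K M => ((ω t).2 j : ℝ) :=
  measurable_subtype_coe.comp ((measurable_pi_apply j).comp
    (measurable_snd.comp (measurable_pi_apply t)))

theorem measurable_record_of_action {s : Fin M → Strategy K} {t : ℕ}
    (h : ∀ j, Measurable fun ω => action s ω t j) (j : Fin M) :
    Measurable fun ω => record s ω j t := by
  have hx : Measurable fun ω : Outcome K M => ((ω t).1 (action s ω t j) : ℝ) := by
    have : Measurable fun p : Fin K × (Fin K → ℝ) => p.2 p.1 :=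
      measurable_from_prod_countable_right fun k => measurable_pi_apply k
    exact this.comp ((h j).prodMk (measurable_pi_lambda _ fun k => measurable_coord t k))
  refine (h j).prodMk (hx.prodMk (hx.mul (measurable_const.sub ?_)))
  have ha : Measurable fun ω => action s ω t := measurable_pi_lambda _ h
  exact (measurable_of_countable fun p : (Fin M → Fin K) × Fin K => collision p.1 p.2).comp
    (ha.prodMk (h j))

/-- Histories and actions have to be treated together: earlier actions give the records, the records
give the summary of the history, and the summary with the seed gives the next action. -/
theorem measurable_play (T t : ℕ) :
    (∀ j, Measurable fun ω => history (play K M T) ω t j) ∧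
      ∀ j, Measurable fun ω => action (play K M T) ω t j := by
  induction t using Nat.strong_induction_on with
  | _ t ih =>
    have hh : ∀ j, Measurable fun ω => history (play K M T) ω t j := by
      intro j
      simp only [history_eq]
      exact measurable_pi_lambda _ fun i => measurable_record_of_action (ih i i.2).2 j
    refine ⟨hh, fun j => ?_⟩
    refine measurable_of_summary (H := fun ω => history (play K M T) ω t j)
      (measurable_summary (hh j) fun ω i => ?_) (measurable_seed t j)
      (selfishRobust T t) (measurable_selfishRobust T) fun h h' u H => selfishRobust_summary H T u
    rw [history_eq]
    exact record_quality_mem _ _ _ _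

theorem measurable_history (T t : ℕ) (j : Fin M) :
    Measurable fun ω => history (play K M T) ω t j := (measurable_play T t).1 j

theorem measurable_action (T t : ℕ) (j : Fin M) :
    Measurable fun ω => action (play K M T) ω t j := (measurable_play T t).2 j

theorem measurable_record (T t : ℕ) (j : Fin M) :
    Measurable fun ω => record (play K M T) ω j t :=
  measurable_record_of_action (measurable_action T t) j

theorem measurable_history_summary (T t : ℕ) (j : Fin M) :
    Measurable fun ω => summary (history (play K M T) ω t j) :=
  measurable_summary (measurable_history T t j) fun ω i => by
    rw [history_eq]; exact record_quality_mem _ _ _ _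

end Measurability

end MMAB

end

noncomputable section

namespace MMAB

open MeasureTheory

/-! ## Exponential potentials along the pulls of an arm -/

section Potential

variable {K M : ℕ} (ν : Fin K → Measure I) [∀ k, IsProbabilityMeasure (ν k)]

/-- The supermartingale step in its resampling form: a pointwise bound after redrawing round `t + 1`
plays the role of a conditional inequality. -/
theorem lintegral_le_of_step (t : ℕ) {F V : Outcome K M → ℝ≥0∞} (hF : Measurable F)
    (h : ∀ ω, ∫⁻ y, F (Function.update ω t y) ∂(roundLaw M ν) ≤ V ω) :
    ∫⁻ ω, F ω ∂(law M ν) ≤ ∫⁻ ω, V ω ∂(law M ν) := by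
  rw [lintegral_law_resample ν t hF]
  exact lintegral_mono h

theorem lintegral_roundLaw_le {f : (Fin K → I) × (Fin M → I) → ℝ≥0∞} (hf : Measurable f)
    {c : ℝ≥0∞} (h : ∀ u, ∫⁻ x, f (x, u) ∂(Measure.pi ν) ≤ c) :
    ∫⁻ y, f y ∂(roundLaw M ν) ≤ c := by
  unfold roundLaw
  rw [lintegral_prod_symm' _ hf]
  refine (lintegral_mono h).trans ?_
  simp

theorem lintegral_coord (k : Fin K) {φ : I → ℝ≥0∞} (hφ : Measurable φ) :
    ∫⁻ x, φ (x k) ∂(Measure.pi ν) = ∫⁻ x, φ x ∂(ν k) :=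
  (measurePreserving_eval ν k).lintegral_comp hφ

theorem roundLaw_seed (j : Fin M) {A : Set I} (hA : MeasurableSet A) :
    roundLaw M ν {y | y.2 j ∈ A} = volume A := by
  have h1 : MeasurePreserving (fun y : (Fin K → I) × (Fin M → I) => y.2) (roundLaw M ν)
      (Measure.pi fun _ : Fin M => (volume : Measure I)) := measurePreserving_snd
  have h2 := (measurePreserving_eval (fun _ : Fin M => (volume : Measure I)) j).comp h1
  exact h2.measure_preimage hA.nullMeasurableSet

variable (s : Fin M → Strategy K)

/-- Product of the weights `φ` of the observed qualities of arm `k`. -/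
def pot (φ : I → ℝ≥0∞) (j : Fin M) (k : Fin K) (t : ℕ) (ω : Outcome K M) : ℝ≥0∞ :=
  ∏ i ∈ Finset.range t, if action s ω i j = k then φ ((ω i).1 k) else 1

theorem pot_update (φ : I → ℝ≥0∞) (j : Fin M) (k : Fin K) (t : ℕ) (ω : Outcome K M)
    (y : (Fin K → I) × (Fin M → I)) :
    pot s φ j k t (Function.update ω t y) = pot s φ j k t ω := by
  unfold pot
  refine Finset.prod_congr rfl fun i hi => ?_
  rw [Finset.mem_range] at hi
  rw [action_update_of_lt s ω hi, Function.update_of_ne hi.ne]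

theorem measurable_ite_coord {p : Outcome K M → Prop} [DecidablePred p] (hp : MeasurableSet {ω | p ω})
    {φ : I → ℝ≥0∞} (hφ : Measurable φ) (t : ℕ) (k : Fin K) (c : ℝ≥0∞) :
    Measurable fun ω : Outcome K M => if p ω then φ ((ω t).1 k) else c :=
  Measurable.ite hp (hφ.comp ((measurable_pi_apply k).comp
    (measurable_fst.comp (measurable_pi_apply t)))) measurable_const

variable {s}

theorem measurable_pot (hs : ∀ t j, Measurable fun ω => action s ω t j) {φ : I → ℝ≥0∞}
    (hφ : Measurable φ) (j : Fin M) (k : Fin K) (t : ℕ) : Measurable (pot s φ j k t) :=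
  Finset.measurable_prod _ fun i _ =>
    measurable_ite_coord (p := fun ω => action s ω i j = k) (hs i j (measurableSet_singleton k))
      hφ i k 1

/-- The decision to pull `k` depends on the past and on the private seed, both independent of the
new quality of `k`. A pull therefore multiplies the potential by a factor of conditional mean at
most `1 - r'`, and the loss `r' * pot` is recorded on the left. -/
theorem pot_step (hs : ∀ t j, Measurable fun ω => action s ω t j)
    (hs' : ∀ j t h, Measurable fun u : I => s j t h u) {φ : I → ℝ≥0∞}
    (hφ : Measurable φ) (j : Fin M) (k : Fin K) {r' : ℝ≥0∞} (hr : ∫⁻ x, φ x ∂(ν k) + r' ≤ 1)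
    (t : ℕ) :
    ∫⁻ ω, pot s φ j k (t + 1) ω ∂(law M ν)
        + r' * ∫⁻ ω, (if action s ω t j = k then pot s φ j k t ω else 0) ∂(law M ν)
      ≤ ∫⁻ ω, pot s φ j k t ω ∂(law M ν) := by
  have hm := measurable_pot hs hφ j k
  have hset : MeasurableSet {ω | action s ω t j = k} := hs t j (measurableSet_singleton k)
  rw [← lintegral_const_mul _ (Measurable.ite hset (hm t) measurable_const),
    ← lintegral_add_left (hm (t + 1))]
  refine lintegral_le_of_step ν t ((hm (t + 1)).add
    ((Measurable.ite hset (hm t) measurable_const).const_mul _)) fun ω => ?_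
  let A : I → Fin K := fun u => s j t (history s ω t j) u
  have hA : Measurable A := hs' j t _
  have hy2 : Measurable fun y : (Fin K → I) × (Fin M → I) => y.2 j :=
    (measurable_pi_apply j).comp measurable_snd
  have hyA : MeasurableSet {y : (Fin K → I) × (Fin M → I) | A (y.2 j) = k} :=
    (hA.comp hy2) (measurableSet_singleton k)
  have key : ∀ y : (Fin K → I) × (Fin M → I),
      pot s φ j k (t + 1) (Function.update ω t y)
        + r' * (if action s (Function.update ω t y) t j = k then
            pot s φ j k t (Function.update ω t y) else 0)
      = pot s φ j k t ω * (if A (y.2 j) = k then φ (y.1 k) + r' else 1) := by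
    intro y
    have h1 : pot s φ j k (t + 1) (Function.update ω t y)
        = pot s φ j k t (Function.update ω t y) * (if action s (Function.update ω t y) t j = k then
          φ ((Function.update ω t y t).1 k) else 1) := by
      unfold pot; rw [Finset.prod_range_succ]
    rw [h1, pot_update, action_update_self, Function.update_self]
    by_cases h : s j t (history s ω t j) (y.2 j) = k
    · simp only [A, h, if_true]; ring
    · simp only [A, h, if_false]; ring
  simp only [key]
  have hw : Measurable fun y : (Fin K → I) × (Fin M → I) =>
      if A (y.2 j) = k then φ (y.1 k) + r' else 1 :=
    Measurable.ite hyA ((hφ.comp ((measurable_pi_apply k).comp measurable_fst)).add_const _)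
      measurable_const
  rw [lintegral_const_mul _ hw]
  refine mul_le_of_le_one_right' (lintegral_roundLaw_le ν hw fun u => ?_)
  by_cases h : A (u j) = k
  · simp only [h, if_true]
    rw [lintegral_add_right _ measurable_const, lintegral_coord ν k hφ]
    simpa using hr
  · simp [h]

/-- The losses recorded by `pot_step` telescope, and their total cannot exceed the initial
potential, an empty product. -/
theorem pot_sum (hs : ∀ t j, Measurable fun ω => action s ω t j)
    (hs' : ∀ j t h, Measurable fun u : I => s j t h u) {φ : I → ℝ≥0∞}
    (hφ : Measurable φ) (j : Fin M) (k : Fin K) {r' : ℝ≥0∞} (hr : ∫⁻ x, φ x ∂(ν k) + r' ≤ 1)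
    (n : ℕ) :
    ∫⁻ ω, pot s φ j k n ω ∂(law M ν)
        + r' * ∑ t ∈ Finset.range n,
          ∫⁻ ω, (if action s ω t j = k then pot s φ j k t ω else 0) ∂(law M ν) ≤ 1 := by
  induction n with
  | zero => simp [pot]
  | succ n ih =>
    rw [Finset.sum_range_succ, mul_add]
    refine le_trans ?_ ih
    have := pot_step ν hs hs' hφ j k hr n
    calc _ = (∫⁻ ω, pot s φ j k (n + 1) ω ∂(law M ν)
        + r' * ∫⁻ ω, (if action s ω n j = k then pot s φ j k n ω else 0) ∂(law M ν))
        + r' * ∑ t ∈ Finset.range n,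
          ∫⁻ ω, (if action s ω t j = k then pot s φ j k t ω else 0) ∂(law M ν) := by ring
      _ ≤ _ := by gcongr

theorem lintegral_pot_le_one (hs : ∀ t j, Measurable fun ω => action s ω t j)
    (hs' : ∀ j t h, Measurable fun u : I => s j t h u) {φ : I → ℝ≥0∞}
    (hφ : Measurable φ) (j : Fin M) (k : Fin K) (hr : ∫⁻ x, φ x ∂(ν k) ≤ 1) (n : ℕ) :
    ∫⁻ ω, pot s φ j k n ω ∂(law M ν) ≤ 1 := by
  simpa using pot_sum ν hs hs' hφ j k (r' := 0) (by simpa using hr) n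

/-- Pulls of an arm while its potential is at least one are rare. -/
theorem sum_measure_pull_le (hs : ∀ t j, Measurable fun ω => action s ω t j)
    (hs' : ∀ j t h, Measurable fun u : I => s j t h u) {φ : I → ℝ≥0∞}
    (hφ : Measurable φ) (j : Fin M) (k : Fin K) {r' : ℝ≥0∞} (hr : ∫⁻ x, φ x ∂(ν k) + r' ≤ 1)
    (n : ℕ) :
    r' * ∑ t ∈ Finset.range n, law M ν {ω | action s ω t j = k ∧ 1 ≤ pot s φ j k t ω} ≤ 1 := by
  refine le_trans ?_ ((le_add_left le_rfl).trans (pot_sum ν hs hs' hφ j k hr n))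
  gcongr with t
  have hset : MeasurableSet {ω | action s ω t j = k ∧ 1 ≤ pot s φ j k t ω} :=
    (hs t j (measurableSet_singleton k)).inter
      (measurableSet_le measurable_const (measurable_pot hs hφ j k t))
  rw [← lintegral_indicator_one hset]
  refine lintegral_mono fun ω => ?_
  by_cases h : action s ω t j = k ∧ 1 ≤ pot s φ j k t ω
  · simp [Set.indicator, h]
  · simp [Set.indicator, h]

variable (s) in
/-- Conditional probability that player `j` pulls arm `k` at round `t + 1`. -/
def pullProb (j : Fin M) (k : Fin K) (t : ℕ) (ω : Outcome K M) : ℝ≥0∞ :=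
  volume {u : I | s j t (history s ω t j) u = k}

/-- Here the arm need not be pulled; a conditional chance `ρ` suffices. The potential depends on the
past only, so redrawing the seed of the round replaces the indicator of a pull by `pullProb`, and
the price is a factor `1 / ρ`. -/
theorem sum_measure_hit_le (hs : ∀ t j, Measurable fun ω => action s ω t j)
    (hs' : ∀ j t h, Measurable fun u : I => s j t h u) {φ : I → ℝ≥0∞}
    (hφ : Measurable φ) (j : Fin M) (k : Fin K) {r' : ℝ≥0∞} (hr : ∫⁻ x, φ x ∂(ν k) + r' ≤ 1)
    (hp : ∀ t, Measurable (pullProb s j k t)) (ρ : ℝ≥0∞) (n : ℕ) :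
    r' * ρ * ∑ t ∈ Finset.range n, law M ν {ω | ρ ≤ pullProb s j k t ω ∧ 1 ≤ pot s φ j k t ω}
      ≤ 1 := by
  refine le_trans ?_ ((le_add_left le_rfl).trans (pot_sum ν hs hs' hφ j k hr n))
  rw [mul_assoc, Finset.mul_sum]
  gcongr with t
  have hm := measurable_pot hs hφ j k t
  have hset : MeasurableSet {ω | ρ ≤ pullProb s j k t ω ∧ 1 ≤ pot s φ j k t ω} :=
    (measurableSet_le measurable_const (hp t)).inter (measurableSet_le measurable_const hm)
  have hite : Measurable fun ω => if action s ω t j = k then pot s φ j k t ω else 0 :=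
    Measurable.ite (hs t j (measurableSet_singleton k)) hm measurable_const
  rw [lintegral_law_resample ν t hite, ← lintegral_indicator_const hset]
  refine lintegral_mono fun ω => ?_
  have : ∫⁻ y, (if action s (Function.update ω t y) t j = k then
      pot s φ j k t (Function.update ω t y) else 0) ∂(roundLaw M ν)
      = pot s φ j k t ω * pullProb s j k t ω := by
    have hA : MeasurableSet {u : I | s j t (history s ω t j) u = k} :=
      hs' j t _ (measurableSet_singleton k)
    have hB : MeasurableSet {y : (Fin K → I) × (Fin M → I) |
        y.2 j ∈ {u : I | s j t (history s ω t j) u = k}} :=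
      ((measurable_pi_apply j).comp measurable_snd) hA
    unfold pullProb
    rw [← roundLaw_seed ν j hA, ← lintegral_indicator_const hB]
    refine lintegral_congr fun y => ?_
    rw [pot_update, action_update_self]
    simp only [Set.indicator, Set.mem_ofPred_eq]
  rw [this]
  by_cases h : ρ ≤ pullProb s j k t ω ∧ 1 ≤ pot s φ j k t ω
  · rw [Set.indicator_of_mem (by exact h)]
    calc ρ = 1 * ρ := (one_mul _).symm
      _ ≤ _ := mul_le_mul' h.2 h.1
  · rw [Set.indicator_of_notMem (by exact h)]; exact zero_le

end Potential

theorem measurable_play_seed {K M : ℕ} [NeZero K] (T : ℕ) (j : Fin M) (t : ℕ)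
    (h : Fin t → Record K) : Measurable fun u : I => play K M T j t h u :=
  (measurable_selfishRobust T h).comp measurable_subtype_coe

theorem measurable_pullProb {K M : ℕ} [NeZero K] (T : ℕ) (j : Fin M) (k : Fin K) (t : ℕ) :
    Measurable (pullProb (play K M T) j k t) := by
  refine measurable_of_summary (H := fun ω => history (play K M T) ω t j) (U := fun _ => 0)
    (measurable_history_summary T t j) measurable_const
    (fun h _ => (volume {u : I | selfishRobust T t h u = k} : ℝ≥0∞)) (fun h => measurable_const) ?_
  intro h h' _ H
  simp only [selfishRobust_summary H]

/-! ## Exponential moments of qualities -/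

section Moments

variable {K : ℕ} (ν : Fin K → Measure I) [∀ k, IsProbabilityMeasure (ν k)]

theorem integrable_quality (k : Fin K) : Integrable (fun x : I => (x : ℝ)) (ν k) :=
  Integrable.of_bound measurable_subtype_coe.aestronglyMeasurable 1
    (Filter.Eventually.of_forall fun x => by
      rw [Real.norm_eq_abs, abs_of_nonneg x.2.1]; exact x.2.2)

theorem mean_mem (k : Fin K) : mean ν k ∈ Set.Icc (0 : ℝ) 1 := by
  refine ⟨integral_nonneg fun x => x.2.1, ?_⟩
  refine (integral_mono (integrable_quality ν k) (integrable_const 1) fun x => x.2.2).trans ?_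
  simp

theorem lintegral_affine_le (k : Fin K) {a b : ℝ} (h : ∀ x : I, 0 ≤ a + b * x)
    {φ : I → ℝ} (hφ : ∀ x, φ x ≤ a + b * x) :
    ∫⁻ x, ENNReal.ofReal (φ x) ∂(ν k) ≤ ENNReal.ofReal (a + b * mean ν k) := by
  refine (lintegral_mono fun x => ENNReal.ofReal_le_ofReal (hφ x)).trans ?_
  have hi : Integrable (fun x : I => a + b * (x : ℝ)) (ν k) :=
    (integrable_const a).add ((integrable_quality ν k).const_mul b)
  rw [← ofReal_integral_eq_lintegral_ofReal hi (Filter.Eventually.of_forall h), integral_add (integrable_const a)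
      ((integrable_quality ν k).const_mul b), integral_const_mul]
  simp [mean]

/-- Apply `exp z ≤ 1 + z + z²` for `|z| ≤ 1`, where the linear term is centered, then `1 + θ² ≤ exp
(θ²)`. -/
theorem lintegral_exp_centered_le (k : Fin K) {θ c : ℝ} (hθ : |θ| ≤ 1) :
    ∫⁻ x, ENNReal.ofReal (Real.exp (θ * ((x : ℝ) - mean ν k) - c)) ∂(ν k)
      ≤ ENNReal.ofReal (Real.exp (θ ^ 2 - c)) := by
  set m := mean ν k with hm
  have hm01 := mean_mem ν k
  have hz : ∀ x : I, |θ * ((x : ℝ) - m)| ≤ 1 := fun x => by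
    rw [abs_mul]
    refine mul_le_one₀ hθ (abs_nonneg _) (abs_le.2 ⟨?_, ?_⟩) <;>
      linarith [x.2.1, x.2.2, hm01.1, hm01.2]
  have hsq : ∀ x : I, (θ * ((x : ℝ) - m)) ^ 2 ≤ θ ^ 2 := fun x => by
    rw [mul_pow]
    refine mul_le_of_le_one_right (sq_nonneg _) ?_
    rw [sq_le_one_iff_abs_le_one, abs_le]
    constructor <;> linarith [x.2.1, x.2.2, hm01.1, hm01.2]
  have hb : ∀ x : I, Real.exp (θ * ((x : ℝ) - m)) ≤ 1 + θ * (x - m) + θ ^ 2 := fun x => by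
    have := (abs_le.1 (Real.abs_exp_sub_one_sub_id_le (hz x))).2
    linarith [hsq x]
  have h := lintegral_affine_le ν k (a := (1 + θ ^ 2 - θ * m) * Real.exp (-c))
    (b := θ * Real.exp (-c)) (φ := fun x : I => Real.exp (θ * ((x : ℝ) - m) - c)) ?_ ?_
  · refine h.trans (ENNReal.ofReal_le_ofReal ?_)
    rw [← hm, Real.exp_sub, Real.exp_neg]
    have := Real.add_one_le_exp (θ ^ 2)
    calc _ = (1 + θ ^ 2) * (Real.exp c)⁻¹ := by ring
      _ ≤ Real.exp (θ ^ 2) * (Real.exp c)⁻¹ := by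
        refine mul_le_mul_of_nonneg_right (by linarith) (by positivity)
      _ = _ := by rw [div_eq_mul_inv]
  · intro x
    have := (Real.exp_pos (θ * ((x : ℝ) - m))).le.trans (hb x)
    calc 0 ≤ (1 + θ * (x - m) + θ ^ 2) * Real.exp (-c) := by positivity
      _ = _ := by ring
  · intro x
    calc _ = Real.exp (θ * ((x : ℝ) - m)) * Real.exp (-c) := by rw [← Real.exp_add]; ring_nf
      _ ≤ (1 + θ * (x - m) + θ ^ 2) * Real.exp (-c) := by
        exact mul_le_mul_of_nonneg_right (hb x) (Real.exp_pos _).le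
      _ = _ := by ring

theorem exp_mul_le_affine (l : ℝ) {x : ℝ} (h0 : 0 ≤ x) (h1 : x ≤ 1) :
    Real.exp (l * x) ≤ 1 + (Real.exp l - 1) * x := by
  have := convexOn_exp.2 (Set.mem_univ 0) (Set.mem_univ l) (sub_nonneg.2 h1) h0 (by ring)
  simp only [smul_eq_mul, mul_zero, zero_add, Real.exp_zero, mul_one] at this
  rw [mul_comm l x]
  linarith

/-- By convexity of the exponential, Bernoulli laws maximize the exponential moments among laws on
`[0,1]` with a given mean. The tilt is nonpositive, so normalizing with a parameter `p` below the
true mean only helps. -/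
theorem lintegral_exp_tilt_le (k : Fin K) {l p : ℝ} (hl : l ≤ 0) (hp1 : p < 1) (hp0 : 0 ≤ p)
    (hp : p ≤ mean ν k) :
    ∫⁻ x, ENNReal.ofReal (Real.exp (l * (x : ℝ) - Real.log (1 - p + p * Real.exp l))) ∂(ν k)
      ≤ 1 := by
  set D := 1 - p + p * Real.exp l with hD
  have hDpos : 0 < D := by
    have := mul_nonneg hp0 (Real.exp_pos l).le
    linarith
  have hl1 : Real.exp l ≤ 1 := Real.exp_le_one_iff.2 hl
  have h := lintegral_affine_le ν k (a := D⁻¹) (b := (Real.exp l - 1) * D⁻¹)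
    (φ := fun x : I => Real.exp (l * (x : ℝ) - Real.log D)) ?_ ?_
  · refine h.trans ?_
    rw [← ENNReal.ofReal_one]
    refine ENNReal.ofReal_le_ofReal ?_
    have : 1 + (Real.exp l - 1) * mean ν k ≤ D := by
      rw [hD]; nlinarith
    calc _ = (1 + (Real.exp l - 1) * mean ν k) * D⁻¹ := by ring
      _ ≤ D * D⁻¹ := mul_le_mul_of_nonneg_right this (by positivity)
      _ = 1 := mul_inv_cancel₀ hDpos.ne'
  · intro x
    have := (Real.exp_pos (l * x)).le.trans (exp_mul_le_affine l x.2.1 x.2.2)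
    calc 0 ≤ (1 + (Real.exp l - 1) * x) * D⁻¹ := by positivity
      _ = _ := by ring
  · intro x
    rw [Real.exp_sub, Real.exp_log hDpos, div_eq_mul_inv]
    calc _ ≤ (1 + (Real.exp l - 1) * x) * D⁻¹ :=
        mul_le_mul_of_nonneg_right (exp_mul_le_affine l x.2.1 x.2.2) (by positivity)
      _ = _ := by ring

end Moments

/-! ## Deviations and under-estimation of the index -/

section Deviations

variable {K M : ℕ} (s : Fin M → Strategy K)

/-- Number of pulls of arm `k` by player `j` in the first `t` rounds. -/
def cnt (ω : Outcome K M) (j : Fin M) (k : Fin K) (t : ℕ) : ℕ :=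
  ((Finset.range t).filter fun i => action s ω i j = k).card

/-- Sum of the qualities of arm `k` observed by player `j` in the first `t` rounds. -/
def qsum (ω : Outcome K M) (j : Fin M) (k : Fin K) (t : ℕ) : ℝ :=
  ∑ i ∈ (Finset.range t).filter fun i => action s ω i j = k, ((ω i).1 k : ℝ)

theorem pulls_history (ω : Outcome K M) (j : Fin M) (k : Fin K) {n t : ℕ} (hn : n ≤ t) :
    pulls (history s ω t j) k n = cnt s ω j k n := by
  rw [history_eq, pulls_seq (record s ω j) hn]; rfl

theorem empMean_history (ω : Outcome K M) (j : Fin M) (k : Fin K) {n t : ℕ} (hn : n ≤ t) :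
    empMean (history s ω t j) k n = qsum s ω j k n / cnt s ω j k n := by
  rw [history_eq, empMean_seq (record s ω j) hn]
  unfold qsum cnt
  congr 1
  refine Finset.sum_congr rfl fun i hi => ?_
  have : action s ω i j = k := (Finset.mem_filter.1 hi).2
  simp [record, this]

theorem pot_exp (l c : ℝ) (j : Fin M) (k : Fin K) (t : ℕ) (ω : Outcome K M) :
    pot s (fun x => ENNReal.ofReal (Real.exp (l * (x : ℝ) - c))) j k t ω
      = ENNReal.ofReal (Real.exp (l * qsum s ω j k t - c * cnt s ω j k t)) := by
  unfold pot qsum cnt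
  rw [← Finset.prod_filter, ← ENNReal.ofReal_prod_of_nonneg fun i _ => (Real.exp_pos _).le,
    ← Real.exp_sum, Finset.sum_sub_distrib, Finset.mul_sum, Finset.sum_const, nsmul_eq_mul,
    mul_comm c]

/-- Weight detecting deviations of the empirical mean by `δ` in the direction `ε = ± 1`. -/
def devWeight (m δ ε : ℝ) (x : I) : ℝ≥0∞ :=
  ENNReal.ofReal (Real.exp (ε * δ / 2 * ((x : ℝ) - m) - δ ^ 2 / 2))

theorem measurable_devWeight (m δ ε : ℝ) : Measurable (devWeight m δ ε) := by
  unfold devWeight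
  exact (Real.measurable_exp.comp (((measurable_subtype_coe.sub_const m).const_mul _).sub_const
    _)).ennreal_ofReal

theorem one_le_pot_devWeight (m : ℝ) {δ : ℝ} (hδ : 0 < δ) (ε : ℝ) (j : Fin M) (k : Fin K) (t : ℕ)
    (ω : Outcome K M) :
    1 ≤ pot s (devWeight m δ ε) j k t ω ↔
      δ * cnt s ω j k t ≤ ε * (qsum s ω j k t - m * cnt s ω j k t) := by
  have : devWeight m δ ε = fun x : I => ENNReal.ofReal (Real.exp (ε * δ / 2 * (x : ℝ) -
      (ε * δ / 2 * m + δ ^ 2 / 2))) := by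
    funext x; unfold devWeight; ring_nf
  rw [this, pot_exp, ← ENNReal.ofReal_one, ENNReal.ofReal_le_ofReal_iff (Real.exp_pos _).le,
    Real.one_le_exp_iff]
  constructor
  · intro h
    have h2 : 0 ≤ δ / 2 * (ε * (qsum s ω j k t - m * cnt s ω j k t) - δ * cnt s ω j k t) := by
      linarith
    have := nonneg_of_mul_nonneg_right h2 (by linarith)
    linarith
  · intro h
    have := mul_nonneg (by linarith : 0 ≤ δ / 2) (sub_nonneg.2 h)
    linarith

/-- Without deviations at either side, the arm was pulled and its empirical mean is accurate. -/
theorem abs_empMean_sub_lt (m : ℝ) {δ : ℝ} (hδ : 0 < δ) (j : Fin M) (k : Fin K) (t : ℕ)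
    (ω : Outcome K M) (h1 : ¬ 1 ≤ pot s (devWeight m δ 1) j k t ω)
    (h2 : ¬ 1 ≤ pot s (devWeight m δ (-1)) j k t ω) :
    |qsum s ω j k t / cnt s ω j k t - m| < δ := by
  rw [one_le_pot_devWeight s m hδ] at h1 h2
  push Not at h1 h2
  -- For an arm never pulled the potential is the empty product `1`, which counts as a deviation;
  -- hence the absence of deviations forces at least one pull.
  have hc : (0 : ℝ) < cnt s ω j k t := by
    by_contra! hc
    have h0 : (cnt s ω j k t : ℝ) = 0 := le_antisymm hc (Nat.cast_nonneg _)
    rw [h0] at h1 h2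
    simp only [mul_zero, sub_zero] at h1 h2
    linarith
  rw [abs_lt]
  constructor
  · have : m - δ < qsum s ω j k t / cnt s ω j k t := by rw [lt_div_iff₀ hc]; linarith
    linarith
  · have : qsum s ω j k t / cnt s ω j k t < m + δ := by rw [div_lt_iff₀ hc]; linarith
    linarith

theorem one_le_pot_of_dev (m : ℝ) {δ ε : ℝ} (hδ : 0 < δ) (j : Fin M) (k : Fin K)
    (t : ℕ) (ω : Outcome K M) (h : δ ≤ ε * (qsum s ω j k t / cnt s ω j k t - m)) :
    1 ≤ pot s (devWeight m δ ε) j k t ω := by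
  rw [one_le_pot_devWeight s m hδ]
  rcases Nat.eq_zero_or_pos (cnt s ω j k t) with h0 | h0
  · have : qsum s ω j k t = 0 := by
      unfold qsum; unfold cnt at h0
      rw [Finset.card_eq_zero.1 h0, Finset.sum_empty]
    simp [h0, this]
  · have hc : (0 : ℝ) < cnt s ω j k t := by exact_mod_cast h0
    calc _ ≤ ε * (qsum s ω j k t / cnt s ω j k t - m) * cnt s ω j k t :=
        mul_le_mul_of_nonneg_right h hc.le
      _ = _ := by field_simp

variable (ν : Fin K → Measure I) [∀ k, IsProbabilityMeasure (ν k)]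

/-- The tilt `δ/2` has exponential moment at most `exp(δ²/4)` while the weight subtracts `δ²/2`. The
net decay `exp(-δ²/4)` is the strict loss per pull required by `pot_step`. -/
theorem lintegral_devWeight (k : Fin K) {δ ε : ℝ} (hδ0 : 0 < δ) (hδ : δ ≤ 1) (hε : ε = 1 ∨ ε = -1) :
    ∫⁻ x, devWeight (mean ν k) δ ε x ∂(ν k) + ENNReal.ofReal (1 - Real.exp (-(δ ^ 2 / 4))) ≤ 1 := by
  have h := lintegral_exp_centered_le ν k (θ := ε * δ / 2) (c := δ ^ 2 / 2) (by
    rcases hε with rfl | rfl <;> rw [abs_le] <;> constructor <;> linarith)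
  have he : (ε * δ / 2) ^ 2 - δ ^ 2 / 2 = -(δ ^ 2 / 4) := by
    rcases hε with rfl | rfl <;> ring
  rw [he] at h
  calc _ ≤ ENNReal.ofReal (Real.exp (-(δ ^ 2 / 4)))
      + ENNReal.ofReal (1 - Real.exp (-(δ ^ 2 / 4))) := by gcongr; exact h
    _ = 1 := by
      rw [← ENNReal.ofReal_add (Real.exp_pos _).le (by
        rw [sub_nonneg, Real.exp_le_one_iff]; nlinarith)]
      simp

end Deviations

end MMAB

end

noncomputable section

set_option linter.unusedSectionVars false

namespace MMAB

open MeasureTheory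

/-! ### Under-estimation of an arm by its kl-UCB index -/

section UnderEstimation

variable {K M : ℕ} (s : Fin M → Strategy K) (ν : Fin K → Measure I)
  [∀ k, IsProbabilityMeasure (ν k)]

/-- The observations of arm `k` in the first `n` rounds under-estimate `c` by a divergence larger
than the threshold `f`. -/
def UnderEst (ω : Outcome K M) (j : Fin M) (k : Fin K) (n : ℕ) (f c : ℝ) : Prop :=
  qsum s ω j k n / cnt s ω j k n < c ∧
    f < cnt s ω j k n * klr (qsum s ω j k n / cnt s ω j k n) c

theorem qsum_nonneg (ω : Outcome K M) (j : Fin M) (k : Fin K) (n : ℕ) :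
    0 ≤ qsum s ω j k n := Finset.sum_nonneg fun i _ => ((ω i).1 k).2.1

variable {s}

/-- Chernoff bound with the tilt of `klr_legendre`. The potential has mean at most one whatever the
adaptive number of pulls, so fixing this number to `N` requires no independence between it and the
qualities. -/
theorem measure_cnt_qsum_le (hs : ∀ t j, Measurable fun ω => action s ω t j)
    (hs' : ∀ j t h, Measurable fun u : I => s j t h u) (j : Fin M) (k : Fin K) {x p : ℝ}
    (hx0 : 0 < x) (hxp : x ≤ p) (hp1 : p < 1) (hp : p ≤ mean ν k) (n N : ℕ) :
    law M ν {ω | cnt s ω j k n = N ∧ qsum s ω j k n ≤ N * x}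
      ≤ ENNReal.ofReal (Real.exp (-(N * klr x p))) := by
  have hp0 : 0 < p := hx0.trans_le hxp
  have hx1 : x < 1 := hxp.trans_lt hp1
  set l := logit x - logit p with hl
  have hl0 : l ≤ 0 := by linarith [logit_le hx0 hxp hp1]
  set c := Real.log (1 - p + p * Real.exp l) with hc
  have hleg : l * x - c = klr x p := klr_legendre hx0 hx1 hp0 hp1
  let φ : I → ℝ≥0∞ := fun x => ENNReal.ofReal (Real.exp (l * (x : ℝ) - c))
  have hφ : Measurable φ := (Real.measurable_exp.comp
    ((measurable_subtype_coe.const_mul _).sub_const _)).ennreal_ofReal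
  have h1 := lintegral_pot_le_one ν hs hs' hφ j k (lintegral_exp_tilt_le ν k hl0 hp1 hp0.le hp) n
  have hsub : {ω | cnt s ω j k n = N ∧ qsum s ω j k n ≤ N * x}
      ⊆ {ω | ENNReal.ofReal (Real.exp (N * klr x p)) ≤ pot s φ j k n ω} := by
    rintro ω ⟨h2, h3⟩
    simp only [Set.mem_ofPred_eq, φ]
    rw [pot_exp, h2, ← hleg]
    refine ENNReal.ofReal_le_ofReal (Real.exp_le_exp.2 ?_)
    have := mul_le_mul_of_nonpos_left h3 hl0
    linarith
  have h2 := mul_meas_ge_le_lintegral (μ := law M ν) (measurable_pot hs hφ j k n)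
    (ENNReal.ofReal (Real.exp (N * klr x p)))
  have h3 := (mul_le_mul_right (measure_mono (μ := law M ν) hsub) _).trans (h2.trans h1)
  rw [Real.exp_neg, ENNReal.ofReal_inv_of_pos (Real.exp_pos _),
    ENNReal.le_inv_iff_mul_le, mul_comm]
  exact h3

/-- For each number of pulls `N`, the event says that the mean lies below the point `x < c` with `N
* klr x c = f`. Since the true mean is at least `p > c`, the Chernoff exponent is at least `f + N *
klr c p`, and the sum over `N` is geometric. The gap between `c` and `p` thus replaces a finer
peeling argument. -/
theorem measure_underEst_le (hs : ∀ t j, Measurable fun ω => action s ω t j)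
    (hs' : ∀ j t h, Measurable fun u : I => s j t h u) (j : Fin M) (k : Fin K) {c p f : ℝ}
    (hc0 : 0 < c) (hcp : c < p) (hp1 : p < 1) (hp : p ≤ mean ν k) (hf : 0 < f) (n : ℕ) :
    law M ν {ω | UnderEst s ω j k n f c}
      ≤ ENNReal.ofReal (Real.exp (-f) * (1 - Real.exp (-klr c p))⁻¹) := by
  have hκ : 0 < klr c p := klr_pos hc0.le (hcp.trans hp1).le (hc0.trans hcp) hp1 hcp.ne
  have hsub : {ω | UnderEst s ω j k n f c}
      ⊆ ⋃ N ∈ Finset.range (n + 1), {ω | cnt s ω j k n = N ∧ UnderEst s ω j k n f c} := by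
    intro ω hω
    refine Set.mem_biUnion (x := cnt s ω j k n) ?_ ⟨rfl, hω⟩
    have : cnt s ω j k n ≤ n := by
      unfold cnt
      exact (Finset.card_filter_le _ _).trans_eq (Finset.card_range n)
    simp only [Finset.coe_range, Set.mem_Iio]
    omega
  have hN : ∀ N : ℕ, law M ν {ω | cnt s ω j k n = N ∧ UnderEst s ω j k n f c}
      ≤ ENNReal.ofReal (Real.exp (-f) * Real.exp (-klr c p) ^ N) := by
    intro N
    rcases Set.eq_empty_or_nonempty {ω | cnt s ω j k n = N ∧ UnderEst s ω j k n f c} with he | hne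
    · rw [he, measure_empty]; exact zero_le
    -- An outcome in the event exhibits a value of the divergence above `f / N`, which the
    -- intermediate value argument needs in order to reach the level `f / N`.
    obtain ⟨ω₀, h0, h1, h2⟩ := hne
    rw [h0] at h1 h2
    have hNpos : (0 : ℝ) < N := by
      by_contra! h
      have : (N : ℝ) = 0 := le_antisymm h (Nat.cast_nonneg _)
      rw [this, zero_mul] at h2
      linarith
    obtain ⟨x, hx0, hxc, hxf, hx⟩ := exists_klr_eq (f := f / N) hc0 (hcp.trans hp1)
      (div_pos hf hNpos) (div_nonneg (qsum_nonneg s ω₀ j k n) hNpos.le) h1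
      (by rw [div_lt_iff₀ hNpos]; linarith)
    refine (measure_mono ?_).trans ((measure_cnt_qsum_le ν hs hs' j k hx0 (hxc.trans hcp).le hp1 hp
      n N).trans (ENNReal.ofReal_le_ofReal ?_))
    · rintro ω ⟨h3, h4, h5⟩
      rw [h3] at h4 h5
      refine ⟨h3, ?_⟩
      have := hx _ h4.le (by rw [div_lt_iff₀ hNpos]; linarith)
      rw [div_lt_iff₀ hNpos] at this
      linarith
    · rw [← Real.exp_nat_mul, ← Real.exp_add, Real.exp_le_exp]
      have h6 := klr_add_le hxc.le hcp.le hc0 hp1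
      rw [hxf] at h6
      have h7 := mul_le_mul_of_nonneg_left h6 hNpos.le
      rw [mul_add, mul_div_cancel₀ _ hNpos.ne'] at h7
      linarith
  refine (measure_mono hsub).trans ((measure_biUnion_finset_le _ _).trans
    ((Finset.sum_le_sum fun N _ => hN N).trans ?_))
  rw [← ENNReal.ofReal_sum_of_nonneg fun N _ => by positivity, ← Finset.mul_sum]
  refine ENNReal.ofReal_le_ofReal (mul_le_mul_of_nonneg_left ?_ (Real.exp_pos _).le)
  have h1 : Real.exp (-klr c p) < 1 := by rw [Real.exp_lt_one_iff]; linarith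
  rw [← tsum_geometric_of_lt_one (Real.exp_pos _).le h1]
  exact (summable_geometric_of_lt_one (Real.exp_pos _).le h1).sum_le_tsum _
    fun i _ => by positivity

end UnderEstimation

/-! ## Uniform sampling -/

section Sampling

variable {K : ℕ} [NeZero K]

theorem sort_getD_eq_iff (S : Finset (Fin K)) {n : ℕ} (hn : n < S.card) {k : Fin K} (hk : k ∈ S) :
    (S.sort (· ≤ ·)).getD n 0 = k ↔ n = (S.sort (· ≤ ·)).idxOf k := by
  have hlen : n < (S.sort (· ≤ ·)).length := by simpa using hn
  rw [List.getD_eq_getElem _ _ hlen]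
  have hk' : k ∈ S.sort (· ≤ ·) := by simpa using hk
  have hidx := List.idxOf_lt_length_of_mem hk'
  constructor
  · rintro rfl
    exact ((S.sort_nodup (· ≤ ·)).idxOf_getElem n hlen).symm
  · rintro rfl
    exact List.getElem_idxOf hidx

theorem floor_lt_card {n : ℕ} {u : ℝ} (h1 : u < 1) (hn : 0 < n) :
    ⌊u * n⌋₊ < n := by
  rw [Nat.floor_lt' hn.ne']
  have : (0 : ℝ) < n := by exact_mod_cast hn
  nlinarith

theorem getD_sort_mem (S : Finset (Fin K)) {n : ℕ} (hn : n < S.card) :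
    (S.sort (· ≤ ·)).getD n 0 ∈ S := by
  have hlen : n < (S.sort (· ≤ ·)).length := by simpa using hn
  rw [List.getD_eq_getElem _ _ hlen]
  exact (Finset.mem_sort _).1 (List.getElem_mem hlen)

theorem pick_mem {S : Finset (Fin K)} (hS : S.Nonempty) {u : ℝ} (h1 : u < 1) :
    pick S u ∈ S :=
  getD_sort_mem S (floor_lt_card h1 hS.card_pos)

theorem pick_eq_iff {S : Finset (Fin K)} {k : Fin K} (hk : k ∈ S) {u : ℝ} (h0 : 0 ≤ u)
    (h1 : u < 1) :
    pick S u = k ↔ ((S.sort (· ≤ ·)).idxOf k : ℝ) / S.card ≤ u ∧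
      u < ((S.sort (· ≤ ·)).idxOf k + 1) / S.card := by
  have hc : 0 < S.card := Finset.card_pos.2 ⟨k, hk⟩
  have hc' : (0 : ℝ) < S.card := by exact_mod_cast hc
  unfold pick
  rw [sort_getD_eq_iff S (floor_lt_card h1 hc) hk, Nat.floor_eq_iff (by positivity),
    div_le_iff₀ hc', lt_div_iff₀ hc']

theorem volume_unitInterval_Ico {a b : ℝ} (ha : 0 ≤ a) (hb : b ≤ 1) :
    (volume : Measure I) {u : I | a ≤ u ∧ (u : ℝ) < b} = ENNReal.ofReal (b - a) := by
  have h : {u : I | a ≤ u ∧ (u : ℝ) < b} = Subtype.val ⁻¹' Set.Ico a b := rfl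
  rw [h, volume_preimage_coe measurableSet_Icc.nullMeasurableSet measurableSet_Ico,
    Set.inter_eq_left.2, Real.volume_Ico]
  exact fun x hx => ⟨ha.trans hx.1, hx.2.le.trans hb⟩

theorem ae_seed_lt_one : ∀ᵐ u : I ∂volume, (u : ℝ) < 1 := by
  have : (volume : Measure I) {1} = 0 := measure_singleton _
  filter_upwards [compl_mem_ae_iff.2 this] with u hu
  exact lt_of_le_of_ne u.2.2 fun h => hu (Subtype.ext h)

theorem idxOf_sort_lt {S : Finset (Fin K)} {k : Fin K} (hk : k ∈ S) :
    (S.sort (· ≤ ·)).idxOf k < S.card := by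
  have := List.idxOf_lt_length_of_mem ((Finset.mem_sort (r := (· ≤ ·))).2 hk)
  simpa using this

theorem volume_pick {S : Finset (Fin K)} {k : Fin K} (hk : k ∈ S) :
    (volume : Measure I) {u : I | pick S u = k} = ENNReal.ofReal (1 / S.card) := by
  have hc : 0 < S.card := Finset.card_pos.2 ⟨k, hk⟩
  have hc' : (0 : ℝ) < S.card := by exact_mod_cast hc
  have hi := idxOf_sort_lt hk
  have hi' : ((S.sort (· ≤ ·)).idxOf k : ℝ) + 1 ≤ S.card := by exact_mod_cast hi
  have : (volume : Measure I) {u : I | pick S u = k} = (volume : Measure I)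
      {u : I | ((S.sort (· ≤ ·)).idxOf k : ℝ) / S.card ≤ u ∧
        (u : ℝ) < ((S.sort (· ≤ ·)).idxOf k + 1) / S.card} := by
    refine measure_congr ?_
    filter_upwards [ae_seed_lt_one] with u hu
    exact propext (pick_eq_iff hk u.2.1 hu)
  rw [this, volume_unitInterval_Ico (by positivity) ((div_le_one hc').2 hi')]
  congr 1
  field_simp
  ring

theorem volume_pick_le {S : Finset (Fin K)} (hS : S.Nonempty) (k : Fin K) :
    (volume : Measure I) {u : I | pick S u = k} ≤ ENNReal.ofReal (1 / S.card) := by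
  by_cases hk : k ∈ S
  · exact (volume_pick hk).le
  · have : (volume : Measure I) {u : I | pick S u = k} = 0 := by
      refine measure_mono_null (fun u hu => ?_) (ae_iff.1 ae_seed_lt_one)
      intro h1
      exact hk (hu ▸ pick_mem hS h1)
    rw [this]; exact zero_le

theorem volume_half_pick {S : Finset (Fin K)} {k : Fin K} (hk : k ∈ S) :
    ENNReal.ofReal (1 / (2 * S.card)) ≤
      (volume : Measure I) {u : I | 1 / 2 ≤ (u : ℝ) ∧ pick S (2 * u - 1) = k} := by
  have hc : 0 < S.card := Finset.card_pos.2 ⟨k, hk⟩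
  have hc' : (0 : ℝ) < S.card := by exact_mod_cast hc
  have hi := idxOf_sort_lt hk
  have hi' : ((S.sort (· ≤ ·)).idxOf k : ℝ) + 1 ≤ S.card := by exact_mod_cast hi
  set i : ℝ := ((S.sort (· ≤ ·)).idxOf k : ℝ) with hidef
  have hi0 : 0 ≤ i := Nat.cast_nonneg _
  have h1 : (i + 1) / S.card ≤ 1 := (div_le_one hc').2 hi'
  have h0 : 0 ≤ i / S.card := by positivity
  have : ENNReal.ofReal (1 / (2 * S.card)) = (volume : Measure I)
      {u : I | (i / S.card + 1) / 2 ≤ u ∧ (u : ℝ) < ((i + 1) / S.card + 1) / 2} := by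
    rw [volume_unitInterval_Ico (by positivity) (by linarith)]
    congr 1
    field_simp
    ring
  rw [this]
  refine measure_mono fun u hu => ?_
  obtain ⟨hu1, hu2⟩ := hu
  refine ⟨by linarith, (pick_eq_iff hk (by linarith) (by linarith)).2 ⟨?_, ?_⟩⟩ <;>
    rw [← hidef] <;> linarith

end Sampling

end MMAB

end

noncomputable section

set_option linter.unusedSectionVars false

namespace MMAB

open MeasureTheory

/-! ## Concentration during uniform sampling -/

section Estimation

variable {K M : ℕ} (ν : Fin K → Measure I) [∀ k, IsProbabilityMeasure (ν k)]

/-- Probability that the quality of arm `k` is positive. -/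
def obsProb (k : Fin K) : ℝ := (ν k).real {x : I | 0 < (x : ℝ)}

theorem measurableSet_pos : MeasurableSet {x : I | 0 < (x : ℝ)} :=
  measurableSet_lt measurable_const measurable_subtype_coe

/-- A quality in `[0,1]` is at most the indicator that it is positive. This is how `1/p` becomes
`1/μ_(K)` in the final bound. -/
theorem mean_le_obsProb (k : Fin K) : mean ν k ≤ obsProb ν k := by
  unfold mean obsProb
  rw [← integral_indicator_one measurableSet_pos]
  refine integral_mono (integrable_quality ν k)
    ((integrable_const (1 : ℝ)).indicator measurableSet_pos) fun x => ?_
  by_cases h : 0 < (x : ℝ)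
  · rw [Set.indicator_of_mem (by exact h)]; exact x.2.2
  · rw [Set.indicator_of_notMem (by exact h)]; exact not_lt.1 h

theorem obsProb_le_one (k : Fin K) : obsProb ν k ≤ 1 := measureReal_le_one

theorem measure_pos_eq (k : Fin K) :
    ν k {x : I | 0 < (x : ℝ)} = ENNReal.ofReal (obsProb ν k) := by
  unfold obsProb; rw [ofReal_measureReal]

theorem obsProb_nonneg (k : Fin K) : 0 ≤ obsProb ν k := measureReal_nonneg

/-- Probability of pulling `k` alone with a positive quality. -/
theorem roundLaw_alone (A : Fin M → I → Fin K) (j : Fin M)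
    (k : Fin K) :
    roundLaw M ν {y | A j (y.2 j) = k ∧ 0 < ((y.1 k : I) : ℝ) ∧ ∀ i, i ≠ j → A i (y.2 i) ≠ k}
      = ν k {x : I | 0 < (x : ℝ)} * (volume {u | A j u = k} *
          ∏ i ∈ Finset.univ.erase j, volume {u | A i u ≠ k}) := by
  have hset : {y : (Fin K → I) × (Fin M → I) | A j (y.2 j) = k ∧ 0 < ((y.1 k : I) : ℝ) ∧
      ∀ i, i ≠ j → A i (y.2 i) ≠ k}
      = {x : Fin K → I | x k ∈ {x : I | 0 < (x : ℝ)}} ×ˢ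
        (Set.univ.pi fun i => if i = j then {u | A j u = k} else {u | A i u ≠ k}) := by
    ext ⟨x, u⟩
    simp only [Set.mem_ofPred_eq, Set.mem_prod, Set.mem_pi, Set.mem_univ, true_imp_iff]
    constructor
    · rintro ⟨h1, h2, h3⟩
      refine ⟨h2, fun i => ?_⟩
      by_cases hi : i = j
      · subst hi; simpa using h1
      · simpa [hi] using h3 i hi
    · rintro ⟨h2, h3⟩
      refine ⟨by simpa using h3 j, h2, fun i hi => by simpa [hi] using h3 i⟩
  unfold roundLaw
  rw [hset, Measure.prod_prod, Measure.pi_pi]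
  congr 1
  · exact (measurePreserving_eval ν k).measure_preimage measurableSet_pos.nullMeasurableSet
  · rw [← Finset.mul_prod_erase _ _ (Finset.mem_univ j), if_pos rfl]
    congr 1
    refine Finset.prod_congr rfl fun i hi => ?_
    rw [if_neg (Finset.ne_of_mem_erase hi)]

theorem roundLaw_obs (A : I → Fin K) (j : Fin M) (k : Fin K) :
    roundLaw M ν {y | A (y.2 j) = k ∧ 0 < ((y.1 k : I) : ℝ)}
      = ν k {x : I | 0 < (x : ℝ)} * volume {u | A u = k} := by
  have hset : {y : (Fin K → I) × (Fin M → I) | A (y.2 j) = k ∧ 0 < ((y.1 k : I) : ℝ)}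
      = {x : Fin K → I | x k ∈ {x : I | 0 < (x : ℝ)}} ×ˢ
        (Set.univ.pi fun i => if i = j then {u | A u = k} else Set.univ) := by
    ext ⟨x, u⟩
    simp only [Set.mem_ofPred_eq, Set.mem_prod, Set.mem_pi, Set.mem_univ, true_imp_iff]
    constructor
    · rintro ⟨h1, h2⟩
      refine ⟨h2, fun i => ?_⟩
      by_cases hi : i = j
      · subst hi; simpa using h1
      · simp [hi]
    · rintro ⟨h2, h3⟩
      exact ⟨by simpa using h3 j, h2⟩
  unfold roundLaw
  rw [hset, Measure.prod_prod, Measure.pi_pi]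
  congr 1
  · exact (measurePreserving_eval ν k).measure_preimage measurableSet_pos.nullMeasurableSet
  · rw [← Finset.mul_prod_erase _ _ (Finset.mem_univ j), if_pos rfl, Finset.prod_eq_one, mul_one]
    intro i hi
    rw [if_neg (Finset.ne_of_mem_erase hi), measure_univ]

/-- Weights that read the outcome of each round directly, rather than through the play, are i.i.d.
Uniform sampling is analysed in this form and transferred to the play later. -/
theorem lintegral_prod_rounds_le {ψ : (Fin K → I) × (Fin M → I) → ℝ≥0∞} (hψ : Measurable ψ)
    {r : ℝ≥0∞} (hr : ∫⁻ y, ψ y ∂(roundLaw M ν) ≤ r) (n : ℕ) :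
    ∫⁻ ω, ∏ i ∈ Finset.range n, ψ (ω i) ∂(law M ν) ≤ r ^ n := by
  induction n with
  | zero => simp
  | succ n ih =>
    have hm : ∀ n, Measurable fun ω : Outcome K M => ∏ i ∈ Finset.range n, ψ (ω i) := fun n =>
      Finset.measurable_prod _ fun i _ => hψ.comp (measurable_pi_apply i)
    have h := lintegral_le_of_step ν n (hm (n + 1))
      (V := fun ω => (∏ i ∈ Finset.range n, ψ (ω i)) * r) fun ω => ?_
    · refine h.trans ?_
      rw [lintegral_mul_const _ (hm n), pow_succ]
      gcongr
    · have : ∀ y, ∏ i ∈ Finset.range (n + 1), ψ (Function.update ω n y i)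
          = (∏ i ∈ Finset.range n, ψ (ω i)) * ψ y := fun y => by
        rw [Finset.prod_range_succ, Function.update_self]
        congr 1
        refine Finset.prod_congr rfl fun i hi => ?_
        rw [Function.update_of_ne (Finset.mem_range.1 hi).ne]
      simp only [this]
      rw [lintegral_const_mul _ hψ]
      gcongr

variable [NeZero K]

/-- One-round event: `j` observes a positive quality on arm `k` when sampling uniformly. -/
def obsSet (j : Fin M) (k : Fin K) : Set ((Fin K → I) × (Fin M → I)) :=
  {y | pick Finset.univ (y.2 j) = k ∧ 0 < ((y.1 k : I) : ℝ)}

/-- One-round event: moreover nobody else pulls `k`. -/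
def aloneSet (j : Fin M) (k : Fin K) : Set ((Fin K → I) × (Fin M → I)) :=
  {y | pick Finset.univ (y.2 j) = k ∧ 0 < ((y.1 k : I) : ℝ) ∧
    ∀ i, i ≠ j → pick Finset.univ (y.2 i : ℝ) ≠ k}

/-- Probability that no other player pulls the same arm, under uniform sampling. -/
def aloneProb (K M : ℕ) : ℝ := (1 - 1 / (K : ℝ)) ^ (M - 1)

theorem measurable_pick_seed : Measurable fun u : I => pick (Finset.univ : Finset (Fin K)) u :=
  (measurable_pick _).comp measurable_subtype_coe

theorem measurableSet_obsSet (j : Fin M) (k : Fin K) : MeasurableSet (obsSet j k) := by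
  have h1 : Measurable fun y : (Fin K → I) × (Fin M → I) => pick (Finset.univ : Finset (Fin K))
      (y.2 j) := measurable_pick_seed.comp ((measurable_pi_apply j).comp measurable_snd)
  have h2 : Measurable fun y : (Fin K → I) × (Fin M → I) => ((y.1 k : I) : ℝ) :=
    measurable_subtype_coe.comp ((measurable_pi_apply k).comp measurable_fst)
  exact (h1 (measurableSet_singleton k)).inter (measurableSet_lt measurable_const h2)

theorem measurableSet_aloneSet (j : Fin M) (k : Fin K) : MeasurableSet (aloneSet j k) := by
  have h1 : ∀ i, Measurable fun y : (Fin K → I) × (Fin M → I) =>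
      pick (Finset.univ : Finset (Fin K)) (y.2 i) := fun i =>
    measurable_pick_seed.comp ((measurable_pi_apply i).comp measurable_snd)
  have : aloneSet j k = obsSet j k ∩ ⋂ i, {y | i ≠ j → pick Finset.univ (y.2 i : ℝ) ≠ k} := by
    ext y
    simp only [aloneSet, obsSet, Set.mem_ofPred_eq, Set.mem_inter_iff, Set.mem_iInter, and_assoc]
  rw [this]
  refine (measurableSet_obsSet j k).inter (MeasurableSet.iInter fun i => ?_)
  by_cases h : i = j
  · simp [h]
  · simp only [ne_eq, h, not_false_eq_true, true_imp_iff]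
    exact (h1 i (measurableSet_singleton k)).compl

theorem roundLaw_obsSet (j : Fin M) (k : Fin K) :
    roundLaw M ν (obsSet j k) = ENNReal.ofReal (obsProb ν k / K) := by
  have := roundLaw_obs ν (fun u : I => pick (Finset.univ : Finset (Fin K)) u) j k
  rw [volume_pick (Finset.mem_univ k), Finset.card_univ, Fintype.card_fin,
    measure_pos_eq, ← ENNReal.ofReal_mul (obsProb_nonneg ν k)] at this
  rw [obsSet, this, mul_one_div]

theorem volume_ne (A : I → Fin K) (hA : Measurable A) (k : Fin K) :
    (volume : Measure I) {u | A u ≠ k} = 1 - volume {u | A u = k} := by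
  have h : {u | A u ≠ k} = {u | A u = k}ᶜ := rfl
  have hm : MeasurableSet {u | A u = k} := hA (measurableSet_singleton k)
  rw [h, prob_compl_eq_one_sub hm]

theorem roundLaw_aloneSet (j : Fin M) (k : Fin K) :
    roundLaw M ν (aloneSet j k) = ENNReal.ofReal (obsProb ν k / K * aloneProb K M) := by
  have h := roundLaw_alone ν (fun (_ : Fin M) (u : I) => pick (Finset.univ : Finset (Fin K)) u)
    j k
  have hK : (1 : ℝ) ≤ K := by exact_mod_cast NeZero.one_le
  have hK1 : 0 ≤ 1 - 1 / (K : ℝ) := by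
    rw [sub_nonneg, div_le_one (by linarith)]; exact hK
  rw [volume_ne _ measurable_pick_seed, volume_pick (Finset.mem_univ k), Finset.card_univ,
    Fintype.card_fin, Finset.prod_const, Finset.card_erase_of_mem (Finset.mem_univ j),
    Finset.card_univ, Fintype.card_fin, ← ENNReal.ofReal_one,
    ← ENNReal.ofReal_sub _ (by positivity), ← ENNReal.ofReal_pow hK1,
    ← ENNReal.ofReal_mul (by positivity), measure_pos_eq,
    ← ENNReal.ofReal_mul (obsProb_nonneg ν k)] at h
  rw [aloneSet, h, aloneProb]
  congr 1
  ring

/-- Number of rounds among the first `n` in the one-round event `S`. -/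
def hits (S : Set ((Fin K → I) × (Fin M → I))) (ω : Outcome K M) (n : ℕ) : ℕ :=
  ((Finset.range n).filter fun i => ω i ∈ S).card

theorem measurable_hits {S : Set ((Fin K → I) × (Fin M → I))} (hS : MeasurableSet S) (n : ℕ) :
    Measurable fun ω : Outcome K M => (hits S ω n : ℝ) := by
  unfold hits
  simp only [Finset.card_filter, Nat.cast_sum, Nat.cast_ite, Nat.cast_one, Nat.cast_zero]
  exact Finset.measurable_sum _ fun i _ =>
    Measurable.ite (measurable_pi_apply i hS) measurable_const measurable_const

/-- Chernoff bound for the number of observations. -/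
theorem measure_hits_le {S : Set ((Fin K → I) × (Fin M → I))} (hS : MeasurableSet S) {q : ℝ}
    (hq0 : 0 ≤ q) (hq1 : q ≤ 1) (hq : roundLaw M ν S = ENNReal.ofReal q) (l x : ℝ) (n : ℕ) :
    law M ν {ω | l * x ≤ l * hits S ω n}
      ≤ ENNReal.ofReal (Real.exp (n * (q * (Real.exp l - 1)) - l * x)) := by
  let ψ : (Fin K → I) × (Fin M → I) → ℝ≥0∞ := fun y =>
    if y ∈ S then ENNReal.ofReal (Real.exp l) else 1
  have hψ : Measurable ψ := Measurable.ite hS measurable_const measurable_const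
  have hint : ∫⁻ y, ψ y ∂(roundLaw M ν) ≤ ENNReal.ofReal (Real.exp (q * (Real.exp l - 1))) := by
    have h1 : ∀ y, ψ y = S.indicator (fun _ => ENNReal.ofReal (Real.exp l)) y
        + Sᶜ.indicator (fun _ => 1) y := fun y => by
      by_cases h : y ∈ S <;> simp [ψ, h]
    simp only [h1]
    rw [lintegral_add_left (measurable_const.indicator hS), lintegral_indicator_const hS,
      lintegral_indicator_const hS.compl, prob_compl_eq_one_sub hS, hq, ← ENNReal.ofReal_one,
      ← ENNReal.ofReal_sub _ hq0, ← ENNReal.ofReal_mul (Real.exp_pos _).le,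
      ← ENNReal.ofReal_mul zero_le_one, ← ENNReal.ofReal_add (by positivity) (by linarith)]
    refine ENNReal.ofReal_le_ofReal ?_
    have := Real.add_one_le_exp (q * (Real.exp l - 1))
    linarith
  have h1 := lintegral_prod_rounds_le ν hψ hint n
  have hprod : ∀ ω : Outcome K M, ∏ i ∈ Finset.range n, ψ (ω i)
      = ENNReal.ofReal (Real.exp (l * hits S ω n)) := fun ω => by
    simp only [ψ, hits]
    rw [← Finset.prod_filter, Finset.prod_const, ← ENNReal.ofReal_pow (Real.exp_pos _).le,
      ← Real.exp_nat_mul, mul_comm l]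
  have hm : Measurable fun ω : Outcome K M => ∏ i ∈ Finset.range n, ψ (ω i) :=
    Finset.measurable_prod _ fun i _ => hψ.comp (measurable_pi_apply i)
  have h2 := (mul_meas_ge_le_lintegral (μ := law M ν) hm (ENNReal.ofReal (Real.exp (l * x)))).trans
    h1
  have hsub : {ω : Outcome K M | l * x ≤ l * hits S ω n}
      ⊆ {ω | ENNReal.ofReal (Real.exp (l * x)) ≤ ∏ i ∈ Finset.range n, ψ (ω i)} := by
    intro ω hω
    simp only [Set.mem_ofPred_eq, hprod] at hω ⊢
    exact ENNReal.ofReal_le_ofReal (Real.exp_le_exp.2 hω)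
  have h3 := (mul_le_mul_right (measure_mono (μ := law M ν) hsub) _).trans h2
  rw [← ENNReal.ofReal_pow (Real.exp_pos _).le, ← Real.exp_nat_mul] at h3
  rw [Real.exp_sub, ENNReal.ofReal_div_of_pos (Real.exp_pos _),
    ENNReal.le_div_iff_mul_le (Or.inl (by simp [Real.exp_pos])) (Or.inl ENNReal.ofReal_ne_top),
    mul_comm]
  exact h3

/-- Again `exp z ≤ 1 + z + z²` for `|z| ≤ 1`: the linear terms cancel in the mean and the quadratic
ones add up to `θ² p (1 - p) ≤ θ²`, which the normalization pays for. -/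
theorem exp_bernoulli_le {p θ : ℝ} (hp0 : 0 ≤ p) (hp1 : p ≤ 1) (hθ : |θ| ≤ 1) :
    p * Real.exp (θ * (1 - p) - θ ^ 2) + (1 - p) * Real.exp (-(θ * p) - θ ^ 2) ≤ 1 := by
  have hz1 : |θ * (1 - p)| ≤ 1 := by
    rw [abs_mul]
    exact mul_le_one₀ hθ (abs_nonneg _) (abs_le.2 ⟨by linarith, by linarith⟩)
  have hz2 : |-(θ * p)| ≤ 1 := by
    rw [abs_neg, abs_mul]
    exact mul_le_one₀ hθ (abs_nonneg _) (abs_le.2 ⟨by linarith, by linarith⟩)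
  have h1 := (abs_le.1 (Real.abs_exp_sub_one_sub_id_le hz1)).2
  have h2 := (abs_le.1 (Real.abs_exp_sub_one_sub_id_le hz2)).2
  have h3 := Real.add_one_le_exp (θ ^ 2)
  rw [Real.exp_sub, Real.exp_sub, ← mul_div_assoc, ← mul_div_assoc, ← add_div,
    div_le_one (Real.exp_pos _)]
  have h4 := mul_le_mul_of_nonneg_left h1 hp0
  have h5 := mul_le_mul_of_nonneg_left h2 (sub_nonneg.2 hp1)
  have h6 : θ ^ 2 * (p * (1 - p)) ≤ θ ^ 2 * 1 :=
    mul_le_mul_of_nonneg_left (by nlinarith) (sq_nonneg θ)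
  nlinarith

/-- Conditionally on being observed, a proportion `a` of the rounds of `S` lies in `S'`. -/
theorem measure_hits_dev_le {S S' : Set ((Fin K → I) × (Fin M → I))} (hS : MeasurableSet S)
    (hS' : MeasurableSet S') (hsub : S' ⊆ S) {q a : ℝ} (hq0 : 0 ≤ q) (hq1 : q ≤ 1)
    (ha0 : 0 ≤ a) (ha1 : a ≤ 1) (hq : roundLaw M ν S = ENNReal.ofReal q)
    (hq' : roundLaw M ν S' = ENNReal.ofReal (q * a)) {e ε : ℝ} (he0 : 0 ≤ e) (he1 : e ≤ 1)
    (hε : ε = 1 ∨ ε = -1) (x : ℝ) (n : ℕ) :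
    law M ν {ω | x ≤ hits S ω n ∧ e * hits S ω n ≤ ε * (hits S' ω n - a * hits S ω n)}
      ≤ ENNReal.ofReal (Real.exp (-(e ^ 2 / 4 * x))) := by
  set θ := ε * e / 2 with hθdef
  have hθ : |θ| ≤ 1 := by
    rw [abs_le]; rcases hε with rfl | rfl <;> constructor <;> simp only [hθdef] <;> linarith
  have hθ2 : θ ^ 2 = e ^ 2 / 4 := by rcases hε with rfl | rfl <;> simp only [hθdef] <;> ring
  -- Every round of `S` pays `θ²`, and rounds outside `S` have weight one. The product thus has mean
  -- at most one even though the number of rounds in `S` is random; on the event considered it is at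
  -- least `exp(e² x / 4)`.
  let ψ : (Fin K → I) × (Fin M → I) → ℝ≥0∞ := fun y =>
    ENNReal.ofReal (Real.exp (θ * (S'.indicator 1 y - a * S.indicator 1 y)
      - θ ^ 2 * S.indicator 1 y))
  have hmS : Measurable (S.indicator (1 : (Fin K → I) × (Fin M → I) → ℝ)) :=
    measurable_one.indicator hS
  have hmS' : Measurable (S'.indicator (1 : (Fin K → I) × (Fin M → I) → ℝ)) :=
    measurable_one.indicator hS'
  have hψ : Measurable ψ := (Real.measurable_exp.comp
    (((hmS'.sub (hmS.const_mul a)).const_mul θ).sub (hmS.const_mul _))).ennreal_ofReal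
  have hint : ∫⁻ y, ψ y ∂(roundLaw M ν) ≤ 1 := by
    have h1 : ∀ y, ψ y = S'.indicator (fun _ => ENNReal.ofReal (Real.exp (θ * (1 - a) - θ ^ 2))) y
        + ((S \ S').indicator (fun _ => ENNReal.ofReal (Real.exp (-(θ * a) - θ ^ 2))) y
          + Sᶜ.indicator (fun _ => 1) y) := fun y => by
      by_cases h : y ∈ S
      · by_cases h' : y ∈ S' <;> simp [ψ, h, h']
      · have h' : y ∉ S' := fun h' => h (hsub h')
        simp [ψ, h, h']
    have hdiff : roundLaw M ν (S \ S') = ENNReal.ofReal (q * (1 - a)) := by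
      rw [measure_sdiff hsub hS'.nullMeasurableSet (measure_ne_top _ _), hq, hq',
        ← ENNReal.ofReal_sub _ (by positivity)]
      congr 1; ring
    simp only [h1]
    rw [lintegral_add_left (measurable_const.indicator hS'),
      lintegral_add_left (measurable_const.indicator (hS.diff hS')),
      lintegral_indicator_const hS', lintegral_indicator_const (hS.diff hS'),
      lintegral_indicator_const hS.compl, prob_compl_eq_one_sub hS, hdiff, hq, hq',
      ← ENNReal.ofReal_one, ← ENNReal.ofReal_sub _ hq0, ← ENNReal.ofReal_mul (Real.exp_pos _).le,
      ← ENNReal.ofReal_mul (Real.exp_pos _).le, ← ENNReal.ofReal_mul zero_le_one,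
      ← ENNReal.ofReal_add, ← ENNReal.ofReal_add]
    · refine ENNReal.ofReal_le_ofReal ?_
      have := mul_le_mul_of_nonneg_left (exp_bernoulli_le ha0 ha1 hθ) hq0
      nlinarith
    · have := mul_nonneg hq0 ha0; positivity
    · have := mul_nonneg hq0 (sub_nonneg.2 ha1)
      have := mul_nonneg (Real.exp_pos (-(θ * a) - θ ^ 2)).le this
      linarith
    · have := mul_nonneg hq0 (sub_nonneg.2 ha1); positivity
    · linarith
  have h1 := lintegral_prod_rounds_le ν hψ hint n
  rw [one_pow] at h1
  have hind : ∀ (S : Set ((Fin K → I) × (Fin M → I))) (ω : Outcome K M),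
      ∑ i ∈ Finset.range n, S.indicator (1 : (Fin K → I) × (Fin M → I) → ℝ) (ω i) = hits S ω n :=
    fun S ω => by
      unfold hits
      rw [Finset.card_filter]
      push_cast
      refine Finset.sum_congr rfl fun i _ => ?_
      by_cases h : ω i ∈ S <;> simp [h]
  have hprod : ∀ ω : Outcome K M, ∏ i ∈ Finset.range n, ψ (ω i)
      = ENNReal.ofReal (Real.exp (θ * (hits S' ω n - a * hits S ω n) - θ ^ 2 * hits S ω n)) :=
    fun ω => by
      simp only [ψ]
      rw [← ENNReal.ofReal_prod_of_nonneg fun i _ => (Real.exp_pos _).le, ← Real.exp_sum,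
        Finset.sum_sub_distrib, ← Finset.mul_sum, ← Finset.mul_sum, Finset.sum_sub_distrib,
        ← Finset.mul_sum, hind, hind]
  have hm : Measurable fun ω : Outcome K M => ∏ i ∈ Finset.range n, ψ (ω i) :=
    Finset.measurable_prod _ fun i _ => hψ.comp (measurable_pi_apply i)
  have h2 := (mul_meas_ge_le_lintegral (μ := law M ν) hm
    (ENNReal.ofReal (Real.exp (e ^ 2 / 4 * x)))).trans h1
  have hsub : {ω : Outcome K M | x ≤ hits S ω n ∧
      e * hits S ω n ≤ ε * (hits S' ω n - a * hits S ω n)}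
      ⊆ {ω | ENNReal.ofReal (Real.exp (e ^ 2 / 4 * x)) ≤ ∏ i ∈ Finset.range n, ψ (ω i)} := by
    rintro ω ⟨hx, hω⟩
    simp only [Set.mem_ofPred_eq, hprod]
    refine ENNReal.ofReal_le_ofReal (Real.exp_le_exp.2 ?_)
    rw [hθ2]
    have h3 := mul_le_mul_of_nonneg_left hω (by linarith : 0 ≤ e / 2)
    have h4 := mul_le_mul_of_nonneg_left hx (by positivity : 0 ≤ e ^ 2 / 4)
    simp only [hθdef]
    nlinarith
  have h3 := (mul_le_mul_right (measure_mono (μ := law M ν) hsub) _).trans h2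
  rw [Real.exp_neg, ENNReal.ofReal_inv_of_pos (Real.exp_pos _), ENNReal.le_inv_iff_mul_le, mul_comm]
  exact h3

end Estimation

end MMAB

end

noncomputable section

set_option linter.unusedSectionVars false

namespace MMAB

open MeasureTheory

/-! ## Recovering the number of players from the collision frequency -/

/-- The worst case is `M = K`, where the inverse is `(1 + 1/(K-1))^(K-1) ≤ e < 3`. -/
theorem third_le_aloneProb {K M : ℕ} (hK : 2 ≤ K) (hMK : M ≤ K) : 1 / 3 ≤ aloneProb K M := by
  unfold aloneProb
  have hK' : (2 : ℝ) ≤ K := by exact_mod_cast hK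
  have hr0 : 0 < 1 - 1 / (K : ℝ) := by
    rw [sub_pos, div_lt_one (by linarith)]; linarith
  have hr1 : 1 - 1 / (K : ℝ) ≤ 1 := by
    have : 0 ≤ 1 / (K : ℝ) := by positivity
    linarith
  refine le_trans ?_ (pow_le_pow_of_le_one hr0.le hr1 (by omega : M - 1 ≤ K - 1))
  have hx : (1 - 1 / (K : ℝ))⁻¹ = 1 + 1 / ((K : ℝ) - 1) := by
    have : (K : ℝ) - 1 ≠ 0 := by linarith
    have h0 : (K : ℝ) ≠ 0 := by linarith
    have h1 : 1 - 1 / (K : ℝ) = (K - 1) / K := by field_simp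
    rw [h1, inv_div]; field_simp; ring
  have h1 : ((1 - 1 / (K : ℝ))⁻¹) ^ (K - 1) ≤ 3 := by
    rw [hx]
    have h2 : 1 + 1 / ((K : ℝ) - 1) ≤ Real.exp (1 / ((K : ℝ) - 1)) := by
      linarith [Real.add_one_le_exp (1 / ((K : ℝ) - 1))]
    have hK1 : (0 : ℝ) < K - 1 := by linarith
    refine (pow_le_pow_left₀ (by positivity) h2 _).trans ?_
    rw [← Real.exp_nat_mul, Nat.cast_sub (by omega), Nat.cast_one, mul_one_div_cancel hK1.ne']
    linarith [Real.exp_one_lt_d9]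
  rw [inv_pow] at h1
  rw [one_div]
  exact inv_le_of_inv_le₀ (by positivity) h1

theorem aloneProb_le_one {K M : ℕ} (hK : 2 ≤ K) : aloneProb K M ≤ 1 := by
  unfold aloneProb
  have hK' : (2 : ℝ) ≤ K := by exact_mod_cast hK
  have : 0 ≤ 1 / (K : ℝ) := by positivity
  have : 1 / (K : ℝ) ≤ 1 := by rw [div_le_one (by linarith)]; linarith
  exact pow_le_one₀ (by linarith) (by linarith)

/-- As `aloneProb` is at least `1/3`, the relative error of `y` is at most `1/(2K)`. The logarithm
then moves by less than half of `-log(1 - 1/K)`, because this quantity exceeds `1/K` and `(1 -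
1/(2K))² > 1 - 1/K`; rounding recovers the exact exponent `M - 1`. -/
theorem round_log_ratio {K M : ℕ} (hK : 2 ≤ K) (hM : 1 ≤ M) (hMK : M ≤ K) {y : ℝ}
    (hy : |y - aloneProb K M| ≤ 1 / (6 * K)) :
    round (Real.log y / Real.log (1 - 1 / (K : ℝ))) = (M : ℤ) - 1 := by
  have hK' : (2 : ℝ) ≤ K := by exact_mod_cast hK
  set r : ℝ := 1 - 1 / (K : ℝ) with hr
  have hi0 : 0 < 1 / (K : ℝ) := by positivity
  have hi1 : 1 / (K : ℝ) ≤ 1 / 2 := by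
    rw [div_le_div_iff₀ (by linarith) (by norm_num)]; linarith
  have hr0 : 0 < r := by linarith
  have hlogr : Real.log r < -(1 / K) := by
    have := Real.log_lt_sub_one_of_pos hr0 (by linarith)
    linarith
  have ha := third_le_aloneProb hK hMK
  set a := aloneProb K M with hadef
  have h6 : 1 / (6 * (K : ℝ)) = (1 / K) / 6 := by field_simp
  rw [h6, abs_le] at hy
  have hy0 : 0 < y := by linarith
  have hloga : Real.log a = ((M : ℝ) - 1) * Real.log r := by
    rw [hadef, aloneProb, Real.log_pow, Nat.cast_sub hM, Nat.cast_one]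
  have hz : Real.log y = ((M : ℝ) - 1) * Real.log r + Real.log (y / a) := by
    rw [Real.log_div hy0.ne' (by linarith), hloga]; ring
  have hq1 : y / a ≤ 1 + (1 / K) / 2 := by
    rw [div_le_iff₀ (by linarith)]
    nlinarith
  have hq2 : 1 - (1 / K) / 2 ≤ y / a := by
    rw [le_div_iff₀ (by linarith)]
    nlinarith
  have hq0 : 0 < y / a := div_pos hy0 (by linarith)
  have hup : Real.log (y / a) < -(Real.log r) / 2 := by
    have := Real.log_le_sub_one_of_pos hq0
    linarith
  have hlo : Real.log r / 2 < Real.log (y / a) := by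
    have h1 : Real.log r < Real.log ((1 - (1 / K) / 2) ^ 2) := by
      refine Real.log_lt_log hr0 ?_
      rw [hr]; nlinarith
    rw [Real.log_pow] at h1
    have h2 := Real.log_le_log (by linarith) hq2
    push_cast at h1
    linarith
  have hneg : Real.log r < 0 := by linarith
  rw [round_eq, Int.floor_eq_iff]
  have hdiv : Real.log y / Real.log r = (M : ℝ) - 1 + Real.log (y / a) / Real.log r := by
    rw [hz, add_div, mul_div_cancel_right₀ _ hneg.ne]
  rw [hdiv]
  push_cast
  constructor
  · have : -(1 / 2) ≤ Real.log (y / a) / Real.log r := by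
      rw [le_div_iff_of_neg hneg]; linarith
    linarith
  · have : Real.log (y / a) / Real.log r < 1 / 2 := by
      rw [div_lt_iff_of_neg hneg]; linarith
    linarith

/-! ## Time scales of the initialization -/

/-- First round (from `0`) of the musical chairs, after an estimation of duration `m`. -/
def chairStart (m : ℕ) : ℕ := ⌈γ₂ / γ₁ * m⌉₊

/-- End of the musical chairs. -/
def chairEnd (K T m : ℕ) : ℕ := chairStart m + ⌈m * Real.log T / (γ₁ * obsTarget K T)⌉₊

/-- End of the initialization. -/
def initEnd (K m : ℕ) : ℕ :=
  ⌈(γ₂ / (γ₁ ^ 2 * β ^ 2 * (K : ℝ) ^ 2) + γ₂ ^ 2 / γ₁ ^ 2) * m⌉₊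

/-- Typical duration of the estimation protocol, when `p` is the least probability of a positive
quality. -/
def scale (p : ℝ) (K T : ℕ) : ℝ := obsTarget K T * K / p

/-- With high probability the estimation lasts longer than this: the rarest arm has then been seen
`γ₁ n` times on average at most. -/
def lowerTime (p : ℝ) (K T : ℕ) : ℕ := ⌊γ₁ * scale p K T⌋₊

/-- The constant `53/50` is slightly below `γ₂ = 16/15`; the difference absorbs all the roundings to
integers once `scale` is at least `1000`. -/
def upperTime (p : ℝ) (K T : ℕ) : ℕ := ⌈53 / 50 * scale p K T⌉₊

section Timing

variable {p : ℝ} {K T m m' : ℕ}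

/-- The first waiting room of even the fastest player lasts until `γ₂ * scale`, past the slowest
estimation, so estimations always see uniform sampling by all players. -/
theorem le_chairStart (hL : 1000 ≤ scale p K T) (hm : γ₁ * scale p K T < m) :
    upperTime p K T ≤ chairStart m := by
  unfold upperTime chairStart
  have h1 : (53 / 50 * scale p K T) ≤ γ₂ / γ₁ * m := by
    unfold γ₁ γ₂ at *; linarith
  exact Nat.ceil_mono h1

/-- The role of the second waiting room, for two players with different estimation times: the
slowest one ends her chairs before the fastest one starts exploring. -/
theorem chairEnd_le (hK : 2 ≤ K) (hT : 0 < Real.log T) (hL : 1000 ≤ scale p K T)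
    (hm' : γ₁ * scale p K T < m') (hm : m ≤ upperTime p K T) :
    chairEnd K T m ≤ initEnd K m' := by
  have hm2 : (m : ℝ) < 53 / 50 * scale p K T + 1 :=
    lt_of_le_of_lt (by exact_mod_cast hm) (Nat.ceil_lt_add_one (by linarith))
  have hK' : (2 : ℝ) ≤ K := by exact_mod_cast hK
  have hKinv : 0 < 1 / (K : ℝ) ^ 2 := by positivity
  have hlen : (m : ℝ) * Real.log T / (γ₁ * obsTarget K T) = m * (14 / (13 * 1521) * (1 / K ^ 2)) := by
    unfold obsTarget γ₁ β; field_simp; norm_num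
  have hinit : (γ₂ / (γ₁ ^ 2 * β ^ 2 * (K : ℝ) ^ 2) + γ₂ ^ 2 / γ₁ ^ 2) * m'
      = (224 / 195) * (14 / (13 * 1521) * (1 / K ^ 2) + 224 / 195) * m' := by
    unfold γ₁ γ₂ β; field_simp; norm_num; ring
  have hstart : γ₂ / γ₁ * (m : ℝ) = 224 / 195 * m := by
    unfold γ₁ γ₂; norm_num
  unfold chairEnd chairStart initEnd
  rw [hlen, hinit, hstart]
  set x : ℝ := 14 / (13 * 1521) * (1 / K ^ 2) with hx
  have hx0 : 0 < x := by positivity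
  have h1 : ((⌈224 / 195 * (m : ℝ)⌉₊ + ⌈(m : ℝ) * x⌉₊ : ℕ) : ℝ) < (224 / 195 + x) * m + 2 := by
    push_cast
    have h2 := Nat.ceil_lt_add_one (by positivity : 0 ≤ 224 / 195 * (m : ℝ))
    have h3 := Nat.ceil_lt_add_one (by positivity : 0 ≤ (m : ℝ) * x)
    linarith
  have h2 : (224 / 195 + x) * (m : ℝ) + 2 ≤ 224 / 195 * (x + 224 / 195) * m' := by
    have hm3 : γ₁ = 13 / 14 := rfl
    rw [hm3] at hm'
    -- Here `224/195 = γ₂/γ₁`, so the right side exceeds `16/15 * scale` while `m < 53/50 * scale +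
    -- 1`. The margin `scale/150` covers the remaining three units; two of them pay for the two
    -- ceilings.
    have h5 : (m : ℝ) + 2 ≤ 224 / 195 * m' := by linarith
    nlinarith
  exact_mod_cast (h1.le.trans h2).trans (Nat.le_ceil _)

theorem initEnd_le (hK : 2 ≤ K) (hL : 1000 ≤ scale p K T) (hm : m ≤ upperTime p K T) :
    (initEnd K m : ℝ) ≤ 3 / 2 * scale p K T := by
  have hm2 : (m : ℝ) < 53 / 50 * scale p K T + 1 :=
    lt_of_le_of_lt (by exact_mod_cast hm) (Nat.ceil_lt_add_one (by linarith))
  have hK' : (2 : ℝ) ≤ K := by exact_mod_cast hK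
  have hc : γ₂ / (γ₁ ^ 2 * β ^ 2 * (K : ℝ) ^ 2) + γ₂ ^ 2 / γ₁ ^ 2 ≤ 133 / 100 := by
    have h1 : γ₂ / (γ₁ ^ 2 * β ^ 2 * (K : ℝ) ^ 2) ≤ γ₂ / (γ₁ ^ 2 * β ^ 2 * (2 : ℝ) ^ 2) := by
      have : (0 : ℝ) ≤ γ₂ := by unfold γ₂; norm_num
      have : (0 : ℝ) < γ₁ := by unfold γ₁; norm_num
      have : (0 : ℝ) < β := by unfold β; norm_num
      gcongr
    refine (add_le_add_left h1 _).trans ?_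
    unfold γ₁ γ₂ β; norm_num
  have hc0 : 0 ≤ γ₂ / (γ₁ ^ 2 * β ^ 2 * (K : ℝ) ^ 2) + γ₂ ^ 2 / γ₁ ^ 2 := by
    unfold γ₁ γ₂ β; positivity
  unfold initEnd
  have h3 := Nat.ceil_lt_add_one (mul_nonneg hc0 (Nat.cast_nonneg m))
  have h4 := mul_le_mul_of_nonneg_right hc (Nat.cast_nonneg (α := ℝ) m)
  linarith

/-- At success probability `p/M ≥ p/K` per round, this length brings the probability of never
succeeding down to `1/T`. -/
theorem le_chairLen (hK : 2 ≤ K) (hT : 0 < Real.log T)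
    (hm : γ₁ * scale p K T < m) :
    K * Real.log T / p ≤ ((chairEnd K T m - chairStart m : ℕ) : ℝ) := by
  unfold chairEnd
  rw [Nat.add_sub_cancel_left]
  refine le_trans ?_ (Nat.le_ceil _)
  have hK' : (2 : ℝ) ≤ K := by exact_mod_cast hK
  have hn : 0 < γ₁ * obsTarget K T := by
    unfold obsTarget γ₁ β; positivity
  rw [le_div_iff₀ hn]
  unfold scale at hm
  calc _ = γ₁ * (obsTarget K T * K / p) * Real.log T := by ring
    _ ≤ _ := mul_le_mul_of_nonneg_right hm.le hT.le

end Timing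

/-! ## The estimation protocol along a sequence of records -/

section Sequence

variable {K : ℕ} (T : ℕ) (g : ℕ → Record K)

def obsCount (k : Fin K) (n : ℕ) : ℕ :=
  ((Finset.range n).filter fun i => (g i).1 = k ∧ 0 < (g i).2.1).card

def collCount (k : Fin K) (n : ℕ) : ℕ :=
  ((Finset.range n).filter fun i => (g i).1 = k ∧ 0 < (g i).2.1 ∧ (g i).2.2 = 0).card

def SeqDone (n : ℕ) : Prop := ∀ k : Fin K, obsTarget K T ≤ obsCount g k n

def seqTime : ℕ := sInf {n | SeqDone T g n}

theorem obsCount_mono (k : Fin K) {m n : ℕ} (h : m ≤ n) : obsCount g k m ≤ obsCount g k n :=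
  Finset.card_le_card (Finset.filter_subset_filter _ (Finset.range_subset_range.2 h))

theorem seqDone_mono {m n : ℕ} (h : m ≤ n) (hm : SeqDone T g m) : SeqDone T g n := fun k =>
  (hm k).trans (by exact_mod_cast obsCount_mono g k h)

variable {T g}

theorem estimDone_iff {n t : ℕ} (hn : n ≤ t) :
    EstimDone T (fun i : Fin t => g i) n ↔ SeqDone T g n := by
  unfold EstimDone SeqDone
  refine forall_congr' fun k => ?_
  rw [numObs_seq g hn]; rfl

theorem exists_estimDone_iff {t : ℕ} :
    (∃ n ≤ t, EstimDone T (fun i : Fin t => g i) n) ↔ SeqDone T g t := by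
  constructor
  · rintro ⟨n, hn, h⟩
    exact seqDone_mono T g hn ((estimDone_iff hn).1 h)
  · intro h
    exact ⟨t, le_rfl, (estimDone_iff le_rfl).2 h⟩

theorem seqTime_le {t : ℕ} (h : SeqDone T g t) : seqTime T g ≤ t := Nat.sInf_le h

theorem seqDone_seqTime {t : ℕ} (h : SeqDone T g t) : SeqDone T g (seqTime T g) :=
  Nat.sInf_mem (s := {n | SeqDone T g n}) ⟨t, h⟩

theorem estimTime_eq {t : ℕ} (h : SeqDone T g t) :
    estimTime T (fun i : Fin t => g i) = seqTime T g := by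
  unfold estimTime
  have h1 : seqTime T g ∈ {n | EstimDone T (fun i : Fin t => g i) n} :=
    (estimDone_iff (seqTime_le h)).2 (seqDone_seqTime h)
  refine le_antisymm (Nat.sInf_le h1) ?_
  have h2 := Nat.sInf_le h1
  exact Nat.sInf_le ((estimDone_iff (h2.trans (seqTime_le h))).1 (Nat.sInf_mem ⟨_, h1⟩))

theorem seqTime_congr {g' : ℕ → Record K} {n : ℕ} (h : ∀ i < n, g i = g' i) (hn : SeqDone T g n) :
    SeqDone T g' n ∧ seqTime T g = seqTime T g' := by
  have hcount : ∀ m ≤ n, ∀ k, obsCount g k m = obsCount g' k m := fun m hm k => by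
    unfold obsCount
    congr 1
    refine Finset.filter_congr fun i hi => ?_
    rw [h i ((Finset.mem_range.1 hi).trans_le hm)]
  have hdone : ∀ m ≤ n, SeqDone T g m ↔ SeqDone T g' m := fun m hm => by
    unfold SeqDone
    exact forall_congr' fun k => by rw [hcount m hm k]
  have hn' := (hdone n le_rfl).1 hn
  refine ⟨hn', le_antisymm ?_ ?_⟩
  · exact Nat.sInf_le ((hdone _ (seqTime_le hn')).2 (seqDone_seqTime hn'))
  · exact Nat.sInf_le ((hdone _ (seqTime_le hn)).1 (seqDone_seqTime hn))

/-- Averaging over the arms preserves the common error bound, so `round_log_ratio` applies and the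
projection on `{1, …, K}` is inactive. -/
theorem estimM_eq {M t : ℕ} (hK : 2 ≤ K) (hM : 1 ≤ M) (hMK : M ≤ K) (h : SeqDone T g t)
    (hfreq : ∀ k, |(1 - (collCount g k (seqTime T g) : ℝ) / obsCount g k (seqTime T g))
      - aloneProb K M| ≤ 1 / (6 * K)) :
    estimM T (fun i : Fin t => g i) = M := by
  have hK' : (2 : ℝ) ≤ K := by exact_mod_cast hK
  unfold estimM collFreq
  rw [estimTime_eq h]
  simp only [numObs_seq g (seqTime_le h), numColl_seq g (seqTime_le h)]
  have hy : |(1 - (∑ k : Fin K, (collCount g k (seqTime T g) : ℝ) / obsCount g k (seqTime T g)) / K)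
      - aloneProb K M| ≤ 1 / (6 * K) := by
    have h1 : (1 - (∑ k : Fin K, (collCount g k (seqTime T g) : ℝ) / obsCount g k (seqTime T g)) / K)
        - aloneProb K M = (∑ k : Fin K, ((1 - (collCount g k (seqTime T g) : ℝ) /
          obsCount g k (seqTime T g)) - aloneProb K M)) / K := by
      rw [Finset.sum_sub_distrib, Finset.sum_sub_distrib]
      simp only [Finset.sum_const, Finset.card_univ, Fintype.card_fin, nsmul_eq_mul]
      field_simp
    rw [h1, abs_div, abs_of_pos (by linarith : (0 : ℝ) < K), div_le_iff₀ (by linarith)]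
    refine (Finset.abs_sum_le_sum_abs _ _).trans ((Finset.sum_le_sum fun k _ => hfreq k).trans ?_)
    simp [mul_comm]
  have := round_log_ratio hK hM hMK hy
  unfold collCount obsCount at this
  rw [this]
  omega

theorem rank_eq_some_iff {t a b : ℕ} {k : Fin K} :
    rank (fun i : Fin t => g i) a b = some k ↔
      ∃ i < t, a ≤ i ∧ i < b ∧ 0 < (g i).2.2 ∧ (∀ i' < i, a ≤ i' → ¬ 0 < (g i').2.2) ∧
        (g i).1 = k := by
  unfold rank
  have hmem : ∀ i : Fin t, i ∈ positiveRounds (fun i : Fin t => g i) a b ↔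
      a ≤ i.val ∧ i.val < b ∧ 0 < (g i).2.2 := fun i => by simp [positiveRounds]
  constructor
  · intro h
    split_ifs at h with hne
    have h1 := (hmem _).1 (Finset.min'_mem _ hne)
    refine ⟨((positiveRounds (fun i : Fin t => g i) a b).min' hne).val, Fin.is_lt _, h1.1, h1.2.1,
      h1.2.2, ?_, by simpa using h⟩
    intro i' hi' ha hpos
    have h2 := Finset.min'_le (positiveRounds (fun i : Fin t => g i) a b)
      ⟨i', hi'.trans (Fin.is_lt _)⟩ ((hmem _).2 ⟨ha, hi'.trans h1.2.1, hpos⟩)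
    exact absurd hi' (not_lt.2 h2)
  · rintro ⟨i, hit, ha, hb, hpos, hmin, hk⟩
    have hi : (⟨i, hit⟩ : Fin t) ∈ positiveRounds (fun i : Fin t => g i) a b :=
      (hmem _).2 ⟨ha, hb, hpos⟩
    have hne : (positiveRounds (fun i : Fin t => g i) a b).Nonempty := ⟨_, hi⟩
    have : (positiveRounds (fun i : Fin t => g i) a b).min' hne = ⟨i, hit⟩ := by
      refine le_antisymm (Finset.min'_le _ _ hi) ?_
      by_contra! hlt
      have h1 := (hmem _).1 (Finset.min'_mem _ hne)
      exact hmin _ hlt h1.1 h1.2.2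
    rw [dif_pos hne, this, hk]

theorem rank_eq_none_iff {t a b : ℕ} :
    rank (fun i : Fin t => g i) a b = none ↔ ∀ i < t, a ≤ i → i < b → ¬ 0 < (g i).2.2 := by
  unfold rank
  constructor
  · intro h i hit ha hb hpos
    rw [dif_pos ⟨⟨i, hit⟩, by simpa [positiveRounds] using ⟨ha, hb, hpos⟩⟩] at h
    exact absurd h (by simp)
  · intro h
    rw [dif_neg]
    rintro ⟨i, hi⟩
    simp only [positiveRounds, Finset.mem_filter, Finset.mem_univ, true_and] at hi
    exact h i i.2 hi.1 hi.2.1 hi.2.2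

end Sequence

/-! ### Collisions seen by one player -/

theorem collision_eq_zero_iff {K M : ℕ} (a : Fin M → Fin K) (j : Fin M) :
    collision a (a j) = 0 ↔ ∀ i, i ≠ j → a i ≠ a j := by
  unfold collision
  have : (1 < (Finset.univ.filter fun i => a i = a j).card) ↔ ∃ i, i ≠ j ∧ a i = a j := by
    rw [Finset.one_lt_card_iff]
    constructor
    · rintro ⟨x, y, hx, hy, hxy⟩
      simp only [Finset.mem_filter, Finset.mem_univ, true_and] at hx hy
      by_cases h : x = j
      · exact ⟨y, fun h' => hxy (h.trans h'.symm), hy⟩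
      · exact ⟨x, h, hx⟩
    · rintro ⟨i, hi, h⟩
      exact ⟨i, j, by simpa using h, by simp, hi⟩
  split_ifs with h
  · simp only [one_ne_zero, false_iff]
    rw [this] at h
    push Not
    exact h
  · simp only [true_iff]
    rw [this] at h
    push Not at h
    exact h

theorem collision_mem {K M : ℕ} (a : Fin M → Fin K) (k : Fin K) :
    collision a k = 0 ∨ collision a k = 1 := by
  unfold collision; split_ifs <;> simp

theorem collision_eq_one_iff {K M : ℕ} (a : Fin M → Fin K) (j : Fin M) :
    collision a (a j) = 1 ↔ ¬ ∀ i, i ≠ j → a i ≠ a j := by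
  rw [← collision_eq_zero_iff]
  rcases collision_mem a (a j) with h | h <;> simp [h]

end MMAB

end

noncomputable section

set_option linter.unusedSectionVars false

namespace MMAB

open MeasureTheory

/-! ### Probability that the estimation protocol succeeds -/

section GoodEstimation

variable {K M : ℕ} [NeZero K] (T : ℕ) (p : ℝ) (l : Fin K)

/-- Good event of the estimation protocol, in terms of uniform sampling; `l` is the arm with the
least probability `p` of a positive quality. -/
def GoodEst : Set (Outcome K M) :=
  {ω | ∀ j, (hits (obsSet j l) ω (lowerTime p K T) : ℝ) < obsTarget K T ∧
    ∀ k, obsTarget K T ≤ hits (obsSet j k) ω (upperTime p K T) ∧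
      ∀ n ∈ Finset.range (upperTime p K T + 1), obsTarget K T ≤ hits (obsSet j k) ω n →
        |(hits (aloneSet j k) ω n : ℝ) - aloneProb K M * hits (obsSet j k) ω n|
          ≤ 1 / (6 * K) * hits (obsSet j k) ω n}

theorem measurableSet_goodEst : MeasurableSet (GoodEst (M := M) T p l) := by
  have h1 : ∀ j k n, Measurable fun ω : Outcome K M => (hits (obsSet j k) ω n : ℝ) :=
    fun j k n => measurable_hits (measurableSet_obsSet j k) n
  have h2 : ∀ j k n, Measurable fun ω : Outcome K M => (hits (aloneSet j k) ω n : ℝ) :=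
    fun j k n => measurable_hits (measurableSet_aloneSet j k) n
  have : GoodEst (M := M) T p l = ⋂ j : Fin M,
      ({ω | (hits (obsSet j l) ω (lowerTime p K T) : ℝ) < obsTarget K T} ∩ ⋂ k,
        ({ω | obsTarget K T ≤ hits (obsSet j k) ω (upperTime p K T)} ∩
          ⋂ n ∈ Finset.range (upperTime p K T + 1),
            ({ω | obsTarget K T ≤ hits (obsSet j k) ω n}ᶜ ∪
              {ω | |(hits (aloneSet j k) ω n : ℝ) - aloneProb K M * hits (obsSet j k) ω n|
                ≤ 1 / (6 * K) * hits (obsSet j k) ω n}))) := by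
    ext ω
    simp only [GoodEst, Set.mem_ofPred_eq, Set.mem_iInter, Set.mem_inter_iff, Set.mem_union,
      Set.mem_compl_iff, imp_iff_not_or]
  rw [this]
  refine MeasurableSet.iInter fun j => (measurableSet_lt (h1 _ _ _) measurable_const).inter
    (MeasurableSet.iInter fun k => (measurableSet_le measurable_const (h1 _ _ _)).inter
      (Finset.measurableSet_biInter _ fun n _ =>
        (measurableSet_le measurable_const (h1 _ _ _)).compl.union (measurableSet_le ?_ ?_)))
  · exact ((h2 _ _ _).sub ((h1 _ _ _).const_mul _)).abs
  · exact (h1 _ _ _).const_mul _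

variable {T p l} (ν : Fin K → Measure I) [∀ k, IsProbabilityMeasure (ν k)]

theorem exp_neg_le_inv_pow {x : ℝ} (hT : 1 ≤ T) (n : ℕ) (hx : n * Real.log T ≤ x) :
    Real.exp (-x) ≤ 1 / (T : ℝ) ^ n := by
  have hT0 : (0 : ℝ) < T := by exact_mod_cast hT
  calc Real.exp (-x) ≤ Real.exp (-(n * Real.log T)) := Real.exp_le_exp.2 (by linarith)
    _ = 1 / (T : ℝ) ^ n := by
      rw [Real.exp_neg, Real.exp_nat_mul, Real.exp_log hT0, one_div]

theorem obsTarget_ge (hK : 2 ≤ K) (hT : 0 ≤ Real.log T) :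
    6084 * Real.log T ≤ obsTarget K T := by
  have hK' : (2 : ℝ) ≤ K := by exact_mod_cast hK
  have : (4 : ℝ) ≤ K ^ 2 := by nlinarith
  unfold obsTarget β
  nlinarith [mul_le_mul_of_nonneg_right this hT]

/-- Chernoff with the optimal tilt `log(14/13)` for exceeding a mean of at most `13n/14`. The
exponent is at most `n/14 - 2n/27 = -n/378`, and `n ≥ 6084 log T`. -/
theorem measure_lower_fail (hK : 2 ≤ K) (hT : 1 ≤ T) (hp : 0 < p) (hl : obsProb ν l = p)
    (j : Fin M) :
    law M ν {ω | obsTarget K T ≤ hits (obsSet j l) ω (lowerTime p K T)}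
      ≤ ENNReal.ofReal (1 / (T : ℝ) ^ 2) := by
  have hK' : (2 : ℝ) ≤ K := by exact_mod_cast hK
  have hlog : 0 ≤ Real.log T := Real.log_nonneg (by exact_mod_cast hT)
  have hn := obsTarget_ge hK hlog
  have hp1 : p ≤ 1 := hl ▸ obsProb_le_one ν l
  set n := obsTarget K T
  have hn0 : 0 ≤ n := le_trans (by positivity) hn
  set lam := Real.log (14 / 13) with hlam
  have hlam1 : 2 / 27 ≤ lam := by
    have := Real.le_log_one_add_of_nonneg (show (0 : ℝ) ≤ 1 / 13 by norm_num)
    norm_num at this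
    exact this
  have hexp : Real.exp lam - 1 = 1 / 13 := by
    rw [hlam, Real.exp_log (by norm_num)]; norm_num
  have h1 := measure_hits_le ν (measurableSet_obsSet j l) (q := p / K) (by positivity)
    (by rw [div_le_one (by linarith)]; linarith) (by rw [roundLaw_obsSet, hl]) lam n
    (lowerTime p K T)
  have hs : (lowerTime p K T : ℝ) * (p / K) ≤ 13 / 14 * n := by
    have h2 : (lowerTime p K T : ℝ) ≤ γ₁ * scale p K T := Nat.floor_le (by
      unfold scale γ₁; positivity)
    calc _ ≤ γ₁ * scale p K T * (p / K) := by gcongr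
      _ = 13 / 14 * n := by
        unfold scale γ₁
        have : (K : ℝ) ≠ 0 := by linarith
        field_simp; rfl
  refine (measure_mono fun ω hω => ?_).trans (h1.trans (ENNReal.ofReal_le_ofReal ?_))
  · have hω' : n ≤ (hits (obsSet j l) ω (lowerTime p K T) : ℝ) := hω
    exact mul_le_mul_of_nonneg_left hω' (by linarith)
  · rw [hexp]
    have h3 : (lowerTime p K T : ℝ) * (p / K * (1 / 13)) - lam * n ≤ -(n / 378) := by
      have := mul_le_mul_of_nonneg_right hlam1 hn0
      linarith
    refine (Real.exp_le_exp.2 h3).trans (exp_neg_le_inv_pow hT 2 ?_)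
    push_cast
    linarith

/-- The mean is at least `53n/50`, and the tilt `-3/50` is close to the optimal `-log(53/50)`. The
exponent is at most `-n/1000`, enough since `n ≥ 6084 log T`. -/
theorem measure_upper_fail (hK : 2 ≤ K) (hT : 1 ≤ T) (hp : 0 < p) (hmin : ∀ k, p ≤ obsProb ν k)
    (j : Fin M) (k : Fin K) :
    law M ν {ω | (hits (obsSet j k) ω (upperTime p K T) : ℝ) < obsTarget K T}
      ≤ ENNReal.ofReal (1 / (T : ℝ) ^ 2) := by
  have hK' : (2 : ℝ) ≤ K := by exact_mod_cast hK
  have hlog : 0 ≤ Real.log T := Real.log_nonneg (by exact_mod_cast hT)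
  have hn := obsTarget_ge hK hlog
  set n := obsTarget K T
  have hn0 : 0 ≤ n := le_trans (by positivity) hn
  have hexp : Real.exp (-(3 / 50)) - 1 ≤ -(582 / 10000) := by
    have h1 := Real.quadratic_le_exp_of_nonneg (show (0 : ℝ) ≤ 3 / 50 by norm_num)
    rw [Real.exp_neg]
    have h2 : (Real.exp (3 / 50))⁻¹ ≤ (1 + 3 / 50 + (3 / 50) ^ 2 / 2)⁻¹ :=
      inv_anti₀ (by norm_num) h1
    norm_num at h2
    linarith
  have hq := hmin k
  have h1 := measure_hits_le ν (measurableSet_obsSet j k) (q := obsProb ν k / K)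
    (div_nonneg (obsProb_nonneg ν k) (by linarith))
    (by rw [div_le_one (by linarith)]; linarith [obsProb_le_one ν k]) (roundLaw_obsSet ν j k)
    (-(3 / 50)) n (upperTime p K T)
  have hs : 53 / 50 * n ≤ (upperTime p K T : ℝ) * (obsProb ν k / K) := by
    have h2 : 53 / 50 * scale p K T ≤ (upperTime p K T : ℝ) := Nat.le_ceil _
    calc 53 / 50 * n = 53 / 50 * scale p K T * (p / K) := by
          unfold scale
          have : (K : ℝ) ≠ 0 := by linarith
          field_simp; rfl
      _ ≤ _ := by gcongr
  refine (measure_mono fun ω hω => ?_).trans (h1.trans (ENNReal.ofReal_le_ofReal ?_))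
  · have hω' : (hits (obsSet j k) ω (upperTime p K T) : ℝ) < n := hω
    simp only [Set.mem_ofPred_eq]
    linarith
  · have h3 : (upperTime p K T : ℝ) * (obsProb ν k / K * (Real.exp (-(3 / 50)) - 1))
        - -(3 / 50) * n ≤ -(1 / 1000 * n) := by
      have h4 : (upperTime p K T : ℝ) * (obsProb ν k / K) * (Real.exp (-(3 / 50)) - 1)
          ≤ 53 / 50 * n * (-(582 / 10000)) := by
        have h5 : 0 ≤ (upperTime p K T : ℝ) * (obsProb ν k / K) := le_trans (by positivity) hs
        nlinarith
      linarith
    refine (Real.exp_le_exp.2 h3).trans (exp_neg_le_inv_pow hT 2 ?_)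
    push_cast
    linarith

/-- With `n ≥ β² K² log T` observations and accuracy `1/(6K)`, the exponent is `β²/144 * log T`,
above `3 log T`; this is where the value of `β` and the factor `K²` are used. The cube leaves room
for a union over up to `T` stopping times. -/
theorem measure_freq_fail (hK : 2 ≤ K) (hT : 1 ≤ T) (j : Fin M) (k : Fin K) (n : ℕ) :
    law M ν {ω | obsTarget K T ≤ hits (obsSet j k) ω n ∧
      ¬ |(hits (aloneSet j k) ω n : ℝ) - aloneProb K M * hits (obsSet j k) ω n|
          ≤ 1 / (6 * K) * hits (obsSet j k) ω n}
      ≤ ENNReal.ofReal (2 / (T : ℝ) ^ 3) := by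
  have hK' : (2 : ℝ) ≤ K := by exact_mod_cast hK
  have hlog : 0 ≤ Real.log T := Real.log_nonneg (by exact_mod_cast hT)
  have ha := third_le_aloneProb (K := K) (M := 1) hK (by omega)
  have ha0 : 0 ≤ aloneProb K M := by
    unfold aloneProb
    have : 1 / (K : ℝ) ≤ 1 := by rw [div_le_one (by linarith)]; linarith
    exact pow_nonneg (by linarith) _
  have hsub : aloneSet j k ⊆ obsSet j k := fun y hy => ⟨hy.1, hy.2.1⟩
  have hbound : ∀ ε : ℝ, (ε = 1 ∨ ε = -1) → law M ν {ω | obsTarget K T ≤ hits (obsSet j k) ω n ∧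
      1 / (6 * K) * hits (obsSet j k) ω n
        ≤ ε * ((hits (aloneSet j k) ω n : ℝ) - aloneProb K M * hits (obsSet j k) ω n)}
      ≤ ENNReal.ofReal (1 / (T : ℝ) ^ 3) := by
    intro ε hε
    refine (measure_hits_dev_le ν (measurableSet_obsSet j k) (measurableSet_aloneSet j k) hsub
      (q := obsProb ν k / K) (div_nonneg (obsProb_nonneg ν k) (by linarith))
      (by rw [div_le_one (by linarith)]; linarith [obsProb_le_one ν k]) ha0 (aloneProb_le_one hK)
      (roundLaw_obsSet ν j k) (roundLaw_aloneSet ν j k) (by positivity)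
      (by rw [div_le_one (by linarith)]; linarith) hε (obsTarget K T) n).trans
      (ENNReal.ofReal_le_ofReal (exp_neg_le_inv_pow hT 3 ?_))
    have : (1 / (6 * (K : ℝ))) ^ 2 / 4 * obsTarget K T = 1521 / 144 * Real.log T := by
      unfold obsTarget β
      have : (K : ℝ) ≠ 0 := by linarith
      field_simp; norm_num; ring
    rw [this]; push_cast; linarith
  have h2 : ENNReal.ofReal (2 / (T : ℝ) ^ 3)
      = ENNReal.ofReal (1 / (T : ℝ) ^ 3) + ENNReal.ofReal (1 / (T : ℝ) ^ 3) := by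
    rw [← ENNReal.ofReal_add (by positivity) (by positivity)]
    congr 1; ring
  rw [h2]
  refine (measure_mono fun ω hω => ?_).trans ((measure_union_le _ _).trans
    (add_le_add (hbound 1 (Or.inl rfl)) (hbound (-1) (Or.inr rfl))))
  obtain ⟨h3, h4⟩ := hω
  rw [abs_le, not_and_or, not_le, not_le] at h4
  rcases h4 with h4 | h4
  · exact Or.inr ⟨h3, by linarith⟩
  · exact Or.inl ⟨h3, by linarith⟩

/-- Per player: `1/T²` for the lower time, and for each arm `1/T²` for the upper time plus at most
`T * 2/T³` for the frequencies; `1 + 3K ≤ 4K`. -/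
theorem measure_goodEst_compl_le (hK : 2 ≤ K) (hT : 1 ≤ T) (hp : 0 < p)
    (hmin : ∀ k, p ≤ obsProb ν k) (hl : obsProb ν l = p) (hup : upperTime p K T + 1 ≤ T) :
    law M ν (GoodEst T p l)ᶜ ≤ ENNReal.ofReal (4 * M * K / (T : ℝ) ^ 2) := by
  have hT0 : (0 : ℝ) < T := by exact_mod_cast hT
  have hK' : (2 : ℝ) ≤ K := by exact_mod_cast hK
  have hsub : (GoodEst (M := M) T p l)ᶜ ⊆ ⋃ j : Fin M,
      ({ω | obsTarget K T ≤ hits (obsSet j l) ω (lowerTime p K T)} ∪ ⋃ k,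
        ({ω | (hits (obsSet j k) ω (upperTime p K T) : ℝ) < obsTarget K T} ∪
          ⋃ n ∈ Finset.range (upperTime p K T + 1),
            {ω | obsTarget K T ≤ hits (obsSet j k) ω n ∧
              ¬ |(hits (aloneSet j k) ω n : ℝ) - aloneProb K M * hits (obsSet j k) ω n|
                ≤ 1 / (6 * K) * hits (obsSet j k) ω n})) := by
    intro ω hω
    by_contra hc
    apply hω
    simp only [Set.mem_iUnion, Set.mem_union, Set.mem_ofPred_eq, not_exists, not_or, not_and,
      not_lt, not_le] at hc
    intro j
    refine ⟨(hc j).1, fun k => ⟨((hc j).2 k).1, fun n hn h => ((hc j).2 k).2 n hn h⟩⟩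
  refine (measure_mono hsub).trans ((measure_iUnion_fintype_le _ _).trans ?_)
  have hj : ∀ j : Fin M, law M ν ({ω | obsTarget K T ≤ hits (obsSet j l) ω (lowerTime p K T)} ∪ ⋃ k,
        ({ω | (hits (obsSet j k) ω (upperTime p K T) : ℝ) < obsTarget K T} ∪
          ⋃ n ∈ Finset.range (upperTime p K T + 1),
            {ω | obsTarget K T ≤ hits (obsSet j k) ω n ∧
              ¬ |(hits (aloneSet j k) ω n : ℝ) - aloneProb K M * hits (obsSet j k) ω n|
                ≤ 1 / (6 * K) * hits (obsSet j k) ω n}))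
      ≤ ENNReal.ofReal (4 * K / (T : ℝ) ^ 2) := by
    intro j
    have hk : ∀ k : Fin K, law M ν ({ω | (hits (obsSet j k) ω (upperTime p K T) : ℝ) < obsTarget K T} ∪
          ⋃ n ∈ Finset.range (upperTime p K T + 1),
            {ω | obsTarget K T ≤ hits (obsSet j k) ω n ∧
              ¬ |(hits (aloneSet j k) ω n : ℝ) - aloneProb K M * hits (obsSet j k) ω n|
                ≤ 1 / (6 * K) * hits (obsSet j k) ω n})
        ≤ ENNReal.ofReal (3 / (T : ℝ) ^ 2) := by
      intro k
      refine (measure_union_le _ _).trans ((add_le_add (measure_upper_fail ν hK hT hp hmin j k)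
        ((measure_biUnion_finset_le _ _).trans
          (Finset.sum_le_sum fun n _ => measure_freq_fail ν hK hT j k n))).trans ?_)
      rw [Finset.sum_const, Finset.card_range, nsmul_eq_mul, ← ENNReal.ofReal_natCast,
        ← ENNReal.ofReal_mul (Nat.cast_nonneg _), ← ENNReal.ofReal_add (by positivity)
          (by positivity)]
      refine ENNReal.ofReal_le_ofReal ?_
      have h1 : ((upperTime p K T + 1 : ℕ) : ℝ) ≤ T := by exact_mod_cast hup
      calc _ ≤ 1 / (T : ℝ) ^ 2 + T * (2 / (T : ℝ) ^ 3) := by gcongr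
        _ = _ := by field_simp; norm_num
    refine (measure_union_le _ _).trans ((add_le_add (measure_lower_fail ν hK hT hp hl j)
      ((measure_iUnion_fintype_le _ _).trans (Finset.sum_le_sum fun k _ => hk k))).trans ?_)
    rw [Finset.sum_const, Finset.card_univ, Fintype.card_fin, nsmul_eq_mul,
      ← ENNReal.ofReal_natCast, ← ENNReal.ofReal_mul (Nat.cast_nonneg _),
      ← ENNReal.ofReal_add (by positivity) (by positivity)]
    refine ENNReal.ofReal_le_ofReal ?_
    rw [mul_div_assoc', ← add_div]
    gcongr
    linarith
  refine (Finset.sum_le_sum fun j _ => hj j).trans ?_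
  rw [Finset.sum_const, Finset.card_univ, Fintype.card_fin, nsmul_eq_mul,
    ← ENNReal.ofReal_natCast, ← ENNReal.ofReal_mul (Nat.cast_nonneg _)]
  exact ENNReal.ofReal_le_ofReal (le_of_eq (by ring))

end GoodEstimation

/-! ## The play on the good event of the estimation protocol -/

section OnGoodEst

variable {K M : ℕ} [NeZero K] {T : ℕ} {p : ℝ} {l : Fin K} {ω : Outcome K M}

/-- The record that player `j` would collect at round `i + 1` if everybody sampled uniformly. -/
def uniformRecord (ω : Outcome K M) (j : Fin M) (i : ℕ) : Record K :=
  let a : Fin M → Fin K := fun i' => pick Finset.univ ((ω i).2 i')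
  (a j, (ω i).1 (a j), (ω i).1 (a j) * (1 - collision a (a j)))

theorem obsCount_uniformRecord (j : Fin M) (k : Fin K) (n : ℕ) :
    obsCount (uniformRecord ω j) k n = hits (obsSet j k) ω n := by
  unfold obsCount hits
  congr 1
  refine Finset.filter_congr fun i _ => ?_
  simp only [uniformRecord, obsSet, Set.mem_ofPred_eq]
  constructor
  · rintro ⟨h1, h2⟩; rw [h1] at h2; exact ⟨h1, h2⟩
  · rintro ⟨h1, h2⟩; rw [h1]; exact ⟨rfl, h2⟩

theorem collCount_uniformRecord (j : Fin M) (k : Fin K) (n : ℕ) :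
    collCount (uniformRecord ω j) k n + hits (aloneSet j k) ω n = hits (obsSet j k) ω n := by
  have h1 : collCount (uniformRecord ω j) k n
      = ((Finset.range n).filter fun i => ω i ∈ obsSet j k \ aloneSet j k).card := by
    unfold collCount
    congr 1
    refine Finset.filter_congr fun i _ => ?_
    simp only [uniformRecord, obsSet, aloneSet, Set.mem_sdiff, Set.mem_ofPred_eq]
    constructor
    · rintro ⟨h1, h2, h3⟩
      rw [mul_eq_zero, or_iff_right h2.ne', sub_eq_zero, eq_comm, collision_eq_one_iff] at h3
      rw [h1] at h2 h3
      exact ⟨⟨h1, h2⟩, fun h => h3 h.2.2⟩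
    · rintro ⟨⟨h1, h2⟩, h3⟩
      refine ⟨h1, by rw [h1]; exact h2, ?_⟩
      rw [mul_eq_zero, sub_eq_zero, eq_comm (a := (1 : ℝ)), collision_eq_one_iff, h1]
      exact Or.inr fun h => h3 ⟨h1, h2, h⟩
  rw [h1]
  unfold hits
  rw [← Finset.card_union_of_disjoint]
  · congr 1
    ext i
    simp only [Finset.mem_union, Finset.mem_filter, Set.mem_sdiff]
    have : ω i ∈ aloneSet j k → ω i ∈ obsSet j k := fun h => ⟨h.1, h.2.1⟩
    tauto
  · rw [Finset.disjoint_filter]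
    intro i _ h h'
    exact h.2 h'

theorem seqTime_uniform (hω : ω ∈ GoodEst T p l) (j : Fin M) :
    SeqDone T (uniformRecord ω j) (upperTime p K T) ∧
      lowerTime p K T < seqTime T (uniformRecord ω j) := by
  have hdone : SeqDone T (uniformRecord ω j) (upperTime p K T) := fun k => by
    rw [obsCount_uniformRecord]; exact ((hω j).2 k).1
  refine ⟨hdone, ?_⟩
  by_contra! hle
  have h1 := seqDone_mono T _ hle (seqDone_seqTime hdone) l
  rw [obsCount_uniformRecord] at h1
  exact absurd h1 (not_le.2 (hω j).1)

theorem selfishRobust_eq_pick {t : ℕ} (h : Fin t → Record K) (u : ℝ)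
    (H : ∀ n ≤ t, EstimDone T h n → t < chairStart (estimTime T h)) :
    selfishRobust T t h u = pick Finset.univ u := by
  unfold selfishRobust
  by_cases hd : ∃ n ≤ t, EstimDone T h n
  · obtain ⟨n, hn, hd'⟩ := hd
    rw [if_pos ⟨n, hn, hd'⟩]
    have := H n hn hd'
    unfold chairStart at this
    simp only [this, if_true]
  · rw [if_neg hd]

theorem lt_of_lowerTime_lt {m : ℕ} (h : lowerTime p K T < m) : γ₁ * scale p K T < m :=
  Nat.lt_of_floor_lt h

/-- If all past records are those of uniform sampling, each player has either not finished her
estimation or is in her first waiting room, which by `le_chairStart` extends beyond `upperTime`; so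
everybody samples uniformly once more. -/
theorem record_eq_uniform (hL : 1000 ≤ scale p K T) (hω : ω ∈ GoodEst T p l) (i : ℕ)
    (hi : i < upperTime p K T) (j : Fin M) :
    record (play K M T) ω j i = uniformRecord ω j i := by
  induction i using Nat.strong_induction_on generalizing j with
  | _ i ih =>
    have hact : action (play K M T) ω i = fun j => pick Finset.univ ((ω i).2 j : ℝ) := by
      funext j
      have hh : history (play K M T) ω i j = fun i' : Fin i => uniformRecord ω j i' := by
        rw [history_eq]; funext i'; exact ih i' i'.2 (i'.2.trans hi) j
      unfold action
      rw [hh]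
      refine selfishRobust_eq_pick _ _ fun n hn hd => ?_
      have hdone : SeqDone T (uniformRecord ω j) i :=
        exists_estimDone_iff.1 ⟨n, hn, hd⟩
      rw [estimTime_eq hdone]
      exact hi.trans_le (le_chairStart hL (lt_of_lowerTime_lt (seqTime_uniform hω j).2))
    unfold record uniformRecord
    rw [hact]

/-- Duration of the estimation protocol of player `j`. -/
def tm (T : ℕ) (ω : Outcome K M) (j : Fin M) : ℕ := seqTime T (record (play K M T) ω j)

theorem seqDone_record (hL : 1000 ≤ scale p K T) (hω : ω ∈ GoodEst T p l) (j : Fin M) :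
    SeqDone T (record (play K M T) ω j) (upperTime p K T) ∧
      tm T ω j = seqTime T (uniformRecord ω j) := by
  obtain ⟨h1, h2⟩ := seqTime_congr (fun i hi => (record_eq_uniform hL hω i hi j).symm)
    (seqTime_uniform hω j).1
  exact ⟨h1, h2.symm⟩

theorem tm_bounds (hL : 1000 ≤ scale p K T) (hω : ω ∈ GoodEst T p l) (j : Fin M) :
    γ₁ * scale p K T < tm T ω j ∧ tm T ω j ≤ upperTime p K T := by
  obtain ⟨h1, h2⟩ := seqDone_record hL hω j
  rw [h2]
  exact ⟨lt_of_lowerTime_lt (seqTime_uniform hω j).2, seqTime_le (seqTime_uniform hω j).1⟩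

/-- The good event controls the frequencies at every time up to `upperTime`, hence at the random
time `tm` when they are read. -/
theorem estimM_history (hK : 2 ≤ K) (hM : 1 ≤ M) (hMK : M ≤ K) (hT : 2 ≤ T)
    (hL : 1000 ≤ scale p K T) (hω : ω ∈ GoodEst T p l) (j : Fin M) {t : ℕ}
    (ht : SeqDone T (record (play K M T) ω j) t) :
    estimM T (history (play K M T) ω t j) = M := by
  rw [history_eq]
  refine estimM_eq hK hM hMK ht fun k => ?_
  obtain ⟨h1, h2⟩ := seqDone_record hL hω j
  have hu := seqTime_le (seqTime_uniform hω j).1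
  have ho : obsCount (record (play K M T) ω j) k (tm T ω j)
      = hits (obsSet j k) ω (tm T ω j) := by
    rw [← obsCount_uniformRecord]
    unfold obsCount
    congr 1
    refine Finset.filter_congr fun i hi => ?_
    rw [record_eq_uniform hL hω i
      ((Finset.mem_range.1 hi).trans_le (tm_bounds hL hω j).2)]
  have hc : collCount (record (play K M T) ω j) k (tm T ω j) + hits (aloneSet j k) ω (tm T ω j)
      = hits (obsSet j k) ω (tm T ω j) := by
    rw [← collCount_uniformRecord]
    congr 1
    unfold collCount
    congr 1
    refine Finset.filter_congr fun i hi => ?_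
    rw [record_eq_uniform hL hω i
      ((Finset.mem_range.1 hi).trans_le (tm_bounds hL hω j).2)]
  have hdone := seqDone_seqTime h1 k
  change obsTarget K T ≤ (obsCount _ k (tm T ω j) : ℝ) at hdone
  rw [ho] at hdone
  have hfreq := ((hω j).2 k).2 (tm T ω j)
    (Finset.mem_range.2 (Nat.lt_succ_of_le (tm_bounds hL hω j).2)) hdone
  change |(1 - (collCount _ k (tm T ω j) : ℝ) / obsCount _ k (tm T ω j)) - _| ≤ _
  have hlog : 0 < Real.log T := Real.log_pos (by exact_mod_cast hT)
  have hpos : (0 : ℝ) < hits (obsSet j k) ω (tm T ω j) :=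
    lt_of_lt_of_le (lt_of_lt_of_le (by positivity) (obsTarget_ge hK hlog.le)) hdone
  have hc' : (collCount (record (play K M T) ω j) k (tm T ω j) : ℝ)
      = hits (obsSet j k) ω (tm T ω j) - hits (aloneSet j k) ω (tm T ω j) := by
    rw [eq_sub_iff_add_eq]; exact_mod_cast hc
  rw [ho, hc']
  have : (1 - ((hits (obsSet j k) ω (tm T ω j) : ℝ) - hits (aloneSet j k) ω (tm T ω j))
      / hits (obsSet j k) ω (tm T ω j)) - aloneProb K M
      = (hits (aloneSet j k) ω (tm T ω j) - aloneProb K M * hits (obsSet j k) ω (tm T ω j))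
        / hits (obsSet j k) ω (tm T ω j) := by
    field_simp; ring
  rw [this, abs_div, abs_of_pos hpos, div_le_iff₀ hpos]
  exact hfreq

end OnGoodEst

end MMAB

end

noncomputable section

set_option linter.unusedSectionVars false

namespace MMAB

open MeasureTheory

/-! ## Musical chairs -/

section Success

variable {K M : ℕ} [NeZero K] (ν : Fin K → Measure I) [∀ k, IsProbabilityMeasure (ν k)]

/-- The arms `1, …, N`. -/
def firstArms (K N : ℕ) : Finset (Fin K) := Finset.univ.filter fun k : Fin K => k.val < N

theorem card_firstArms {N : ℕ} (h : N ≤ K) : (firstArms K N).card = N := by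
  have : firstArms K N = (Finset.univ : Finset (Fin N)).map (Fin.castLEEmb h) := by
    ext k
    simp only [firstArms, Finset.mem_filter, Finset.mem_univ, true_and, Finset.mem_map,
      Fin.castLEEmb_apply]
    exact ⟨fun hk => ⟨⟨k, hk⟩, rfl⟩, fun ⟨i, hi⟩ => hi ▸ i.2⟩
  rw [this, Finset.card_map, Finset.card_univ, Fintype.card_fin]

/-- A player who samples uniformly among `M` arms, when the others are either fixed or spread,
collects a positive reward with probability at least `p / M`. -/
theorem le_measure_success (hM : 1 ≤ M) (hMK : M ≤ K) {p : ℝ} (hp : 0 < p)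
    (hmin : ∀ k, p ≤ obsProb ν k) (A : Fin M → I → Fin K) (hA : ∀ i, Measurable (A i)) (j : Fin M)
    (hj : ∀ u, A j u = pick (firstArms K M) u)
    (hi : ∀ i, i ≠ j → (∃ k, ∀ u, A i u = k) ∨
      ∀ k, volume {u | A i u = k} ≤ ENNReal.ofReal (1 / M)) :
    ENNReal.ofReal (p / M) ≤ roundLaw M ν {y | 0 < ((y.1 (A j (y.2 j)) : I) : ℝ) ∧
      ∀ i, i ≠ j → A i (y.2 i) ≠ A j (y.2 j)} := by
  have hM' : (1 : ℝ) ≤ M := by exact_mod_cast hM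
  -- If `F` of the first `M` arms are not occupied by fixed players, at most `F - 1` other players
  -- are spread. By Bernoulli's inequality a free arm is avoided by all of them with probability at
  -- least `1 - (F - 1)/M`.
  let fixed : Finset (Fin M) := (Finset.univ.erase j).filter fun i => ∃ k, ∀ u, A i u = k
  let occ : Finset (Fin K) := fixed.image fun i => A i 0
  let free : Finset (Fin K) := firstArms K M \ occ
  have hfree : M ≤ free.card + fixed.card := by
    have h1 : (firstArms K M).card ≤ free.card + occ.card := Finset.card_le_card_sdiff_add_card
    rw [card_firstArms hMK] at h1
    exact h1.trans (Nat.add_le_add_left Finset.card_image_le _)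
  have hfreeM : free.card ≤ M := by
    rw [← card_firstArms hMK]; exact Finset.card_le_card Finset.sdiff_subset
  have hfixed : fixed.card ≤ M - 1 := by
    refine (Finset.card_filter_le _ _).trans ?_
    rw [Finset.card_erase_of_mem (Finset.mem_univ j), Finset.card_univ, Fintype.card_fin]
  let alone : Fin K → Set ((Fin K → I) × (Fin M → I)) := fun k =>
    {y | A j (y.2 j) = k ∧ 0 < ((y.1 k : I) : ℝ) ∧ ∀ i, i ≠ j → A i (y.2 i) ≠ k}
  have hinv : (1 : ℝ) / M ≤ 1 := by rw [div_le_one (by linarith)]; exact hM'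
  have hk : ∀ k ∈ free, ENNReal.ofReal (p * (1 / M * (1 - (free.card - 1) / M)))
      ≤ roundLaw M ν (alone k) := by
    intro k hkf
    obtain ⟨hkS, hko⟩ := Finset.mem_sdiff.1 hkf
    have hpick : volume {u | A j u = k} = ENNReal.ofReal (1 / M) := by
      have : {u | A j u = k} = {u : I | pick (firstArms K M) u = k} := by
        ext u; simp [hj u]
      rw [this, volume_pick hkS, card_firstArms hMK]
    have hprod : ENNReal.ofReal (1 - (free.card - 1) / M)
        ≤ ∏ i ∈ Finset.univ.erase j, volume {u | A i u ≠ k} := by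
      have h1 : ∀ i ∈ Finset.univ.erase j, (if i ∈ fixed then 1 else ENNReal.ofReal (1 - 1 / M))
          ≤ volume {u | A i u ≠ k} := by
        intro i hij
        split_ifs with hf
        · obtain ⟨k', hk'⟩ := (Finset.mem_filter.1 hf).2
          have hne : k' ≠ k := by
            rintro rfl
            exact hko (Finset.mem_image.2 ⟨i, hf, hk' 0⟩)
          have : {u | A i u ≠ k} = Set.univ := by
            ext u; simp [hk' u, hne]
          rw [this, measure_univ]
        · have h2 := (hi i (Finset.ne_of_mem_erase hij)).resolve_left fun h =>
            hf (Finset.mem_filter.2 ⟨hij, h⟩)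
          rw [volume_ne _ (hA i), ENNReal.ofReal_sub _ (by positivity), ENNReal.ofReal_one]
          exact tsub_le_tsub_left (h2 k) _
      refine le_trans ?_ (Finset.prod_le_prod' h1)
      rw [Finset.prod_ite, Finset.prod_const_one, one_mul, Finset.prod_const,
        ← ENNReal.ofReal_pow (by linarith)]
      refine ENNReal.ofReal_le_ofReal ?_
      set m := ((Finset.univ.erase j).filter fun i => i ∉ fixed).card with hm
      have hm' : m + fixed.card = M - 1 := by
        have h3 : fixed = (Finset.univ.erase j).filter fun i => i ∈ fixed := by
          ext i
          simp only [Finset.mem_filter, fixed]; tauto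
        have h4 := Finset.card_filter_add_card_filter_not (s := Finset.univ.erase j)
          (fun i => i ∈ fixed)
        rw [← h3, Finset.card_erase_of_mem (Finset.mem_univ j), Finset.card_univ,
          Fintype.card_fin] at h4
        omega
      have h5 := one_add_mul_le_pow (a := -(1 / (M : ℝ))) (by linarith) m
      have h6 : (m : ℝ) ≤ free.card - 1 := by
        have : m + 1 ≤ free.card := by omega
        have : ((m + 1 : ℕ) : ℝ) ≤ free.card := by exact_mod_cast this
        push_cast at this; linarith
      have h7 : (m : ℝ) / M ≤ (free.card - 1) / M := by gcongr
      rw [← sub_eq_add_neg] at h5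
      calc _ ≤ 1 + (m : ℝ) * -(1 / M) := by
            have : (m : ℝ) * -(1 / M) = -(m / M) := by ring
            rw [this]; linarith
        _ ≤ _ := h5
    rw [roundLaw_alone, hpick, measure_pos_eq, ENNReal.ofReal_mul hp.le,
      ENNReal.ofReal_mul (by positivity)]
    gcongr
    exact hmin k
  have hsub : (⋃ k ∈ free, alone k) ⊆ {y | 0 < ((y.1 (A j (y.2 j)) : I) : ℝ) ∧
      ∀ i, i ≠ j → A i (y.2 i) ≠ A j (y.2 j)} := by
    intro y hy
    simp only [Set.mem_iUnion] at hy
    obtain ⟨k, _, h1, h2, h3⟩ := hy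
    simp only [Set.mem_ofPred_eq]
    rw [h1]
    exact ⟨h2, h3⟩
  have hmeas : ∀ k, MeasurableSet (alone k) := fun k => by
    have h1 : ∀ i, Measurable fun y : (Fin K → I) × (Fin M → I) => A i (y.2 i) := fun i =>
      (hA i).comp ((measurable_pi_apply i).comp measurable_snd)
    have h2 : Measurable fun y : (Fin K → I) × (Fin M → I) => ((y.1 k : I) : ℝ) :=
      measurable_subtype_coe.comp ((measurable_pi_apply k).comp measurable_fst)
    have : alone k = {y | A j (y.2 j) = k} ∩ ({y | 0 < ((y.1 k : I) : ℝ)} ∩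
        ⋂ i, {y | i ≠ j → A i (y.2 i) ≠ k}) := by
      ext y; simp [alone]
    rw [this]
    refine (h1 j (measurableSet_singleton k)).inter ((measurableSet_lt measurable_const h2).inter
      (MeasurableSet.iInter fun i => ?_))
    by_cases h : i = j
    · simp [h]
    · simp only [ne_eq, h, not_false_eq_true, true_imp_iff]
      exact (h1 i (measurableSet_singleton k)).compl
  refine le_trans ?_ (measure_mono hsub)
  rw [measure_biUnion_finset ?_ fun k _ => hmeas k]
  · refine le_trans ?_ (Finset.sum_le_sum hk)
    rw [Finset.sum_const, nsmul_eq_mul, ← ENNReal.ofReal_natCast,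
      ← ENNReal.ofReal_mul (Nat.cast_nonneg _)]
    refine ENNReal.ofReal_le_ofReal ?_
    have hf1 : (1 : ℝ) ≤ free.card := by
      have : 1 ≤ free.card := by omega
      exact_mod_cast this
    have hf2 : (free.card : ℝ) ≤ M := by exact_mod_cast hfreeM
    have : (free.card : ℝ) * (p * (1 / M * (1 - (free.card - 1) / M)))
        = p / M * ((free.card : ℝ) * (M - free.card + 1) / M) := by
      field_simp; ring
    rw [this]
    -- What remains is `F (M - F + 1) ≥ M`, that is `(F - 1)(M - F) ≥ 0`.
    refine le_mul_of_one_le_right (by positivity) ?_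
    rw [le_div_iff₀ (by linarith)]
    nlinarith
  · intro k _ k' _ hkk'
    refine Set.disjoint_left.2 fun y hy hy' => hkk' (hy.1.symm.trans hy'.1)

end Success

section Chairs

variable {K M : ℕ} [NeZero K] {T : ℕ} {p : ℝ} {l : Fin K} {ω : Outcome K M}

theorem seqDone_of_le (hL : 1000 ≤ scale p K T) (hω : ω ∈ GoodEst T p l) (j : Fin M)
    {t : ℕ} (ht : upperTime p K T ≤ t) : SeqDone T (record (play K M T) ω j) t :=
  seqDone_mono T _ ht (seqDone_record hL hω j).1

/-- The behaviour of a player once the estimation is over, on the good event. -/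
theorem selfishRobust_history (hK : 2 ≤ K) (hM : 1 ≤ M) (hMK : M ≤ K) (hT : 2 ≤ T)
    (hL : 1000 ≤ scale p K T) (hω : ω ∈ GoodEst T p l) (j : Fin M) {t : ℕ}
    (ht : upperTime p K T ≤ t) (u : ℝ) :
    selfishRobust T t (history (play K M T) ω t j) u
      = if t < chairStart (tm T ω j) then pick Finset.univ u
        else if t < initEnd K (tm T ω j) then
          match rank (history (play K M T) ω t j) (chairStart (tm T ω j))
            (chairEnd K T (tm T ω j)) with
          | some j => j
          | none => pick (firstArms K M) u
        else
          match rank (history (play K M T) ω t j) (chairStart (tm T ω j))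
            (chairEnd K T (tm T ω j)) with
          | some r => explore M ((r.val : ℤ) + 1) t (history (play K M T) ω t j) u
          | none => explore M (-1) t (history (play K M T) ω t j) u := by
  have hdone := seqDone_of_le hL hω j ht
  have htm : estimTime T (history (play K M T) ω t j) = tm T ω j := by
    rw [history_eq]; exact estimTime_eq hdone
  have hex : ∃ n ≤ t, EstimDone T (history (play K M T) ω t j) n := by
    rw [history_eq]; exact exists_estimDone_iff.2 hdone
  unfold selfishRobust
  rw [if_pos hex]
  simp only [htm, estimM_history hK hM hMK hT hL hω j hdone]
  rfl

/-- Player `j` collected no positive reward among the first `t` rounds, during her musical chairs;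
`m` is the duration of her estimation protocol. -/
def NoRank (T : ℕ) (ω : Outcome K M) (j : Fin M) (m t : ℕ) : Prop :=
  ∀ i < t, chairStart m ≤ i → i < chairEnd K T m → ¬ 0 < (record (play K M T) ω j i).2.2

theorem rank_history_eq_none_iff (j : Fin M) (m t : ℕ) :
    rank (history (play K M T) ω t j) (chairStart m) (chairEnd K T m) = none
      ↔ NoRank T ω j m t := by
  rw [history_eq]
  exact rank_eq_none_iff

/-- Conditional probability to obtain a rank. -/
theorem le_measure_rank (ν : Fin K → Measure I) [∀ k, IsProbabilityMeasure (ν k)] (hK : 2 ≤ K)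
    (hM : 1 ≤ M) (hMK : M ≤ K) (hT : 2 ≤ T) (hp : 0 < p) (hmin : ∀ k, p ≤ obsProb ν k)
    (hL : 1000 ≤ scale p K T) (hω : ω ∈ GoodEst T p l) (j : Fin M) {t : ℕ}
    (h1 : chairStart (tm T ω j) ≤ t) (h2 : t < chairEnd K T (tm T ω j))
    (h3 : NoRank T ω j (tm T ω j) t) :
    ENNReal.ofReal (p / M) ≤ roundLaw M ν
      {y | 0 < (record (play K M T) (Function.update ω t y) j t).2.2} := by
  have hlog : 0 < Real.log T := Real.log_pos (by exact_mod_cast hT)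
  have hup : upperTime p K T ≤ t := (le_chairStart hL (tm_bounds hL hω j).1).trans h1
  -- While `j` is still in her chairs nobody explores. Every other player is uniform on all arms,
  -- uniform on the first `M` arms, or settled on her rank: the two alternatives of
  -- `le_measure_success`.
  have hlt : ∀ i, t < initEnd K (tm T ω i) := fun i =>
    h2.trans_le (chairEnd_le hK hlog hL (tm_bounds hL hω i).1 (tm_bounds hL hω j).2)
  let A : Fin M → I → Fin K := fun i u => selfishRobust T t (history (play K M T) ω t i) u
  have hA : ∀ i, Measurable (A i) := fun i =>
    (measurable_selfishRobust T _).comp measurable_subtype_coe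
  have hM' : (1 : ℝ) ≤ M := by exact_mod_cast hM
  have hMK' : (M : ℝ) ≤ K := by exact_mod_cast hMK
  refine (le_measure_success ν hM hMK hp hmin A hA j ?_ ?_).trans (measure_mono ?_)
  · intro u
    have := selfishRobust_history hK hM hMK hT hL hω j hup u
    rw [if_neg (not_lt.2 h1), if_pos (hlt j), (rank_history_eq_none_iff j _ t).2 h3] at this
    exact this
  · intro i _
    have hs := fun u => selfishRobust_history hK hM hMK hT hL hω i hup u
    by_cases hc : t < chairStart (tm T ω i)
    · refine Or.inr fun k => ?_
      have : {u | A i u = k} = {u : I | pick Finset.univ (u : ℝ) = k} := by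
        ext u
        simp only [Set.mem_ofPred_eq, A]
        rw [hs, if_pos hc]
      rw [this]
      refine (volume_pick_le Finset.univ_nonempty k).trans (ENNReal.ofReal_le_ofReal ?_)
      rw [Finset.card_univ, Fintype.card_fin]
      exact one_div_le_one_div_of_le (by linarith) hMK'
    · cases hr : rank (history (play K M T) ω t i) (chairStart (tm T ω i))
        (chairEnd K T (tm T ω i)) with
      | some r =>
        refine Or.inl ⟨r, fun u => ?_⟩
        simp only [A]
        rw [hs, if_neg hc, if_pos (hlt i), hr]
      | none =>
        refine Or.inr fun k => ?_
        have : {u | A i u = k} = {u : I | pick (firstArms K M) (u : ℝ) = k} := by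
          ext u
          simp only [Set.mem_ofPred_eq, A]
          rw [hs, if_neg hc, if_pos (hlt i), hr]
        rw [this]
        have hne : (firstArms K M).Nonempty := by
          rw [← Finset.card_pos, card_firstArms hMK]; omega
        refine (volume_pick_le hne k).trans (ENNReal.ofReal_le_ofReal ?_)
        rw [card_firstArms hMK]
  · rintro y ⟨hy1, hy2⟩
    have ha : action (play K M T) (Function.update ω t y) t = fun i => A i (y.2 i) := by
      funext i; exact action_update_self _ _ _ _ _
    simp only [Set.mem_ofPred_eq, record, ha, Function.update_self]
    rw [(collision_eq_zero_iff (fun i => A i (y.2 i)) j).2 hy2]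
    simpa using hy1

theorem hits_update (S : Set ((Fin K → I) × (Fin M → I))) {n t : ℕ} (h : n ≤ t)
    (y : (Fin K → I) × (Fin M → I)) : hits S (Function.update ω t y) n = hits S ω n := by
  unfold hits
  congr 1
  refine Finset.filter_congr fun i hi => ?_
  rw [Function.update_of_ne ((Finset.mem_range.1 hi).trans_le h).ne]

theorem goodEst_update (hL : 1000 ≤ scale p K T) {t : ℕ} (ht : upperTime p K T ≤ t)
    (y : (Fin K → I) × (Fin M → I)) :
    Function.update ω t y ∈ GoodEst T p l ↔ ω ∈ GoodEst T p l := by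
  have hle : lowerTime p K T ≤ t := by
    refine le_trans ?_ ht
    unfold lowerTime upperTime
    refine (Nat.floor_mono ?_).trans (Nat.floor_le_ceil _)
    unfold γ₁; linarith
  simp only [GoodEst, Set.mem_ofPred_eq, hits_update _ hle, hits_update _ ht]
  refine forall_congr' fun j => and_congr_right fun _ => forall_congr' fun k =>
    and_congr_right fun _ => forall₂_congr fun n hn => ?_
  have hn' : n ≤ t := (Nat.lt_succ_iff.1 (Finset.mem_range.1 hn)).trans ht
  rw [hits_update _ hn', hits_update _ hn']

/-- Failure to obtain a rank has probability at most `1 / T` for each player. -/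
theorem measure_noRank_le (ν : Fin K → Measure I) [∀ k, IsProbabilityMeasure (ν k)] (hK : 2 ≤ K)
    (hM : 1 ≤ M) (hMK : M ≤ K) (hT : 2 ≤ T) (hp : 0 < p) (hmin : ∀ k, p ≤ obsProb ν k)
    (hL : 1000 ≤ scale p K T) (j : Fin M) :
    law M ν {ω | ω ∈ GoodEst T p l ∧ ∀ t, NoRank T ω j (tm T ω j) t}
      ≤ ENNReal.ofReal (1 / T) := by
  have hlog : 0 < Real.log T := Real.log_pos (by exact_mod_cast hT)
  have hT0 : (0 : ℝ) < T := by exact_mod_cast (by omega : 0 < T)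
  have hM' : (1 : ℝ) ≤ M := by exact_mod_cast hM
  have hMK' : (M : ℝ) ≤ K := by exact_mod_cast hMK
  have hp1 : p ≤ 1 := (hmin 0).trans (obsProb_le_one ν 0)
  set U := upperTime p K T with hU
  -- A surrogate for `tm` that is measurable and insensitive to resampling any round after `U`; the
  -- two agree on the good event.
  let m : Outcome K M → ℕ := fun ω => estimTime T (history (play K M T) ω U j)
  have hm : Measurable m := measurable_of_summary (H := fun ω => history (play K M T) ω U j)
    (U := fun _ => 0) (measurable_history_summary T U j) measurable_const
    (fun h _ => estimTime T h) (fun h => measurable_const) fun h h' _ H => estimTime_summary H T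
  have hm_good : ∀ ω ∈ GoodEst T p l, m ω = tm T ω j := fun ω hω => by
    simp only [m]; rw [history_eq]; exact estimTime_eq (seqDone_record hL hω j).1
  have hm_update : ∀ ω t y, U ≤ t → m (Function.update ω t y) = m ω := fun ω t y ht => by
    simp only [m]; rw [history_update _ _ ht]
  -- Each chair round without success multiplies the weight by `exp(p/M)`, while such a round has
  -- conditional probability at most `1 - p/M ≤ exp(-p/M)`. The weight restricted to the event of no
  -- success is thus a supermartingale from time `U` on. At the end of the chairs it is at least `T`
  -- on that event, and Markov's inequality concludes.
  let w : ℕ → ℕ → ℝ≥0∞ := fun t m =>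
    ENNReal.ofReal (Real.exp (p / M * ((min t (chairEnd K T m) - chairStart m : ℕ) : ℝ)))
  let W : ℕ → Outcome K M → ℝ≥0∞ := fun t ω =>
    {ω | ω ∈ GoodEst T p l ∧ NoRank T ω j (m ω) t}.indicator (fun ω => w t (m ω)) ω
  have hset : ∀ t, MeasurableSet {ω | ω ∈ GoodEst T p l ∧ NoRank T ω j (m ω) t} := fun t => by
    refine (measurableSet_goodEst T p l).inter ?_
    have : {ω | NoRank T ω j (m ω) t} = ⋂ i ∈ Finset.range t,
        ({ω | chairStart (m ω) ≤ i ∧ i < chairEnd K T (m ω)}ᶜ ∪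
          {ω | 0 < (record (play K M T) ω j i).2.2}ᶜ) := by
      ext ω
      simp only [NoRank, Set.mem_ofPred_eq, Finset.mem_range, Set.mem_iInter, Set.mem_union,
        Set.mem_compl_iff, ← imp_iff_not_or, and_imp]
    change MeasurableSet {ω | NoRank T ω j (m ω) t}
    rw [this]
    refine Finset.measurableSet_biInter _ fun i _ => MeasurableSet.union ?_ ?_
    · exact (hm (MeasurableSet.of_discrete
        (s := {m : ℕ | chairStart m ≤ i ∧ i < chairEnd K T m}))).compl
    · exact (measurableSet_lt measurable_const
        (measurable_snd.comp (measurable_snd.comp (measurable_record T i j)))).compl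
  have hWm : ∀ t, Measurable (W t) := fun t =>
    Measurable.indicator ((measurable_of_countable (w t)).comp hm) (hset t)
  have hNR : ∀ ω t y, U ≤ t → (NoRank T (Function.update ω t y) j (m ω) (t + 1) ↔
      NoRank T ω j (m ω) t ∧ (chairStart (m ω) ≤ t → t < chairEnd K T (m ω) →
        ¬ 0 < (record (play K M T) (Function.update ω t y) j t).2.2)) := fun ω t y ht => by
    unfold NoRank
    constructor
    · intro h
      refine ⟨fun i hi => ?_, h t (Nat.lt_succ_self t)⟩
      have := h i (hi.trans (Nat.lt_succ_self t))
      rwa [record_update_of_lt _ _ hi] at this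
    · rintro ⟨h1, h2⟩ i hi
      rcases Nat.lt_succ_iff_lt_or_eq.1 hi with h | rfl
      · rw [record_update_of_lt _ _ h]; exact h1 i h
      · exact h2
  have hstep : ∀ t, U ≤ t → ∫⁻ ω, W (t + 1) ω ∂(law M ν) ≤ ∫⁻ ω, W t ω ∂(law M ν) := by
    intro t ht
    refine lintegral_le_of_step ν t (hWm (t + 1)) fun ω => ?_
    have hval : ∀ y, W (t + 1) (Function.update ω t y) =
        if ω ∈ GoodEst T p l ∧ NoRank T ω j (m ω) t ∧ (chairStart (m ω) ≤ t →
          t < chairEnd K T (m ω) →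
            ¬ 0 < (record (play K M T) (Function.update ω t y) j t).2.2)
        then w (t + 1) (m ω) else 0 := fun y => by
      simp only [W, Set.indicator, Set.mem_ofPred_eq, hm_update ω t y ht,
        goodEst_update hL ht, hNR ω t y ht]
    simp only [hval]
    by_cases hg : ω ∈ GoodEst T p l
    swap
    · simp [hg]
    by_cases hn : NoRank T ω j (m ω) t
    swap
    · simp [hn]
    have hWt : W t ω = w t (m ω) := by simp [W, hg, hn]
    rw [hWt]
    by_cases hin : chairStart (m ω) ≤ t ∧ t < chairEnd K T (m ω)
    · simp only [hg, hn, hin, true_and, true_imp_iff]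
      rw [hm_good ω hg] at hin hn ⊢
      have hr := le_measure_rank ν hK hM hMK hT hp hmin hL hg j hin.1 hin.2 hn
      have hpos : MeasurableSet {y | 0 < (record (play K M T) (Function.update ω t y) j t).2.2} := by
        have h1 : Measurable fun y : (Fin K → I) × (Fin M → I) => Function.update ω t y :=
          measurable_update ω
        exact measurableSet_lt measurable_const
          ((measurable_snd.comp (measurable_snd.comp (measurable_record T t j))).comp h1)
      have h2 : ∀ y, (if ¬ 0 < (record (play K M T) (Function.update ω t y) j t).2.2 then
          w (t + 1) (tm T ω j) else 0)
          = {y | 0 < (record (play K M T) (Function.update ω t y) j t).2.2}ᶜ.indicator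
            (fun _ => w (t + 1) (tm T ω j)) y := fun y => by
        simp only [Set.indicator, Set.mem_compl_iff, Set.mem_ofPred_eq]
      simp only [h2]
      rw [lintegral_indicator_const hpos.compl, prob_compl_eq_one_sub hpos]
      have h3 : 1 - roundLaw M ν {y | 0 < (record (play K M T) (Function.update ω t y) j t).2.2}
          ≤ ENNReal.ofReal (Real.exp (-(p / M))) := by
        refine (tsub_le_tsub_left hr 1).trans ?_
        rw [← ENNReal.ofReal_one, ← ENNReal.ofReal_sub _ (by positivity)]
        refine ENNReal.ofReal_le_ofReal ?_
        linarith [Real.add_one_le_exp (-(p / M))]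
      refine (mul_le_mul_right h3 _).trans ?_
      simp only [w]
      rw [← ENNReal.ofReal_mul (Real.exp_pos _).le, ← Real.exp_add]
      refine ENNReal.ofReal_le_ofReal (Real.exp_le_exp.2 ?_)
      have h4 : min (t + 1) (chairEnd K T (tm T ω j)) - chairStart (tm T ω j)
          = (min t (chairEnd K T (tm T ω j)) - chairStart (tm T ω j)) + 1 := by omega
      rw [h4]
      push_cast
      linarith
    · have h4 : w (t + 1) (m ω) = w t (m ω) := by
        simp only [w]
        have : min (t + 1) (chairEnd K T (m ω)) - chairStart (m ω)
          = min t (chairEnd K T (m ω)) - chairStart (m ω) := by omega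
        rw [this]
      refine (lintegral_mono (g := fun _ => w t (m ω)) fun y => ?_).trans (by simp)
      rw [h4]
      dsimp only
      split_ifs
      · exact le_rfl
      · exact zero_le
  have hU1 : ∫⁻ ω, W U ω ∂(law M ν) ≤ 1 := by
    refine (lintegral_mono (g := fun _ => 1) fun ω => ?_).trans (by simp)
    by_cases hg : ω ∈ GoodEst T p l ∧ NoRank T ω j (m ω) U
    · simp only [W, Set.indicator, Set.mem_ofPred_eq, hg, and_self, if_true, w]
      have h1 := le_chairStart hL (tm_bounds hL hg.1 j).1
      rw [← hm_good ω hg.1] at h1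
      have : min U (chairEnd K T (m ω)) - chairStart (m ω) = 0 := by omega
      simp [this]
    · simp only [W, Set.indicator, Set.mem_ofPred_eq, hg, if_false]; exact zero_le
  have hWle : ∀ t, U ≤ t → ∫⁻ ω, W t ω ∂(law M ν) ≤ 1 := fun t ht => by
    induction t, ht using Nat.le_induction with
    | base => exact hU1
    | succ t ht ih => exact (hstep t ht).trans ih
  let B := U + ⌈3 / 2 * scale p K T⌉₊
  have hB := hWle B (Nat.le_add_right _ _)
  have hBset := hset B
  have hsub : {ω | ω ∈ GoodEst T p l ∧ ∀ t, NoRank T ω j (tm T ω j) t}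
      ⊆ {ω | ENNReal.ofReal T ≤ W B ω} := by
    rintro ω ⟨hg, hn⟩
    have hmem : ω ∈ GoodEst T p l ∧ NoRank T ω j (m ω) B := ⟨hg, by rw [hm_good ω hg]; exact hn B⟩
    simp only [Set.mem_ofPred_eq, W, Set.indicator, hmem, and_self, if_true, w]
    refine ENNReal.ofReal_le_ofReal ?_
    rw [hm_good ω hg]
    have hb := tm_bounds hL hg j
    have h1 : chairEnd K T (tm T ω j) ≤ B := by
      refine (chairEnd_le hK hlog hL hb.1 hb.2).trans ?_
      have := (initEnd_le hK hL hb.2).trans (Nat.le_ceil _)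
      have h2 : initEnd K (tm T ω j) ≤ ⌈3 / 2 * scale p K T⌉₊ := by exact_mod_cast this
      omega
    rw [min_eq_right h1]
    have h2 := le_chairLen hK hlog hb.1
    have h3 : Real.log T ≤ p / M * ((chairEnd K T (tm T ω j) - chairStart (tm T ω j) : ℕ) : ℝ) := by
      calc Real.log T = p / M * (M * Real.log T / p) := by field_simp
        _ ≤ p / M * (K * Real.log T / p) := by gcongr
        _ ≤ _ := by gcongr
    calc (T : ℝ) = Real.exp (Real.log T) := (Real.exp_log hT0).symm
      _ ≤ _ := Real.exp_le_exp.2 h3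
  have h1 := (mul_meas_ge_le_lintegral (μ := law M ν) (hWm B) (ENNReal.ofReal T)).trans hB
  have h2 := (mul_le_mul_right (measure_mono (μ := law M ν) hsub) _).trans h1
  rw [one_div, ENNReal.ofReal_inv_of_pos hT0, ENNReal.le_inv_iff_mul_le, mul_comm]
  exact h2

end Chairs

end MMAB

end

noncomputable section

set_option linter.unusedSectionVars false

namespace MMAB

open MeasureTheory

/-! ## The ranks after the musical chairs -/

section Ranks

variable {K M : ℕ} [NeZero K] {T : ℕ} {p : ℝ} {l : Fin K} {ω : Outcome K M}

theorem initEnd_ge (hK : 2 ≤ K) (hT : 0 < Real.log T) (hL : 1000 ≤ scale p K T)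
    (hω : ω ∈ GoodEst T p l) (i j : Fin M) :
    upperTime p K T ≤ chairStart (tm T ω i) ∧ chairStart (tm T ω i) ≤ initEnd K (tm T ω j) ∧
      chairEnd K T (tm T ω i) ≤ initEnd K (tm T ω j) := by
  have h := chairEnd_le hK hT hL (tm_bounds hL hω j).1 (tm_bounds hL hω i).2
  exact ⟨le_chairStart hL (tm_bounds hL hω i).1, (Nat.le_add_right _ _).trans h, h⟩

/-- Once everybody found a rank, the ranks are distinct, and all players run the
exploration-exploitation phase with the right number of players. -/
theorem exists_ranks (hK : 2 ≤ K) (hM : 1 ≤ M) (hMK : M ≤ K) (hT : 2 ≤ T)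
    (hL : 1000 ≤ scale p K T) (hω : ω ∈ GoodEst T p l)
    (hseed : ∀ t j, ((ω t).2 j : ℝ) < 1) (hrank : ∀ j, ¬ ∀ t, NoRank T ω j (tm T ω j) t) :
    ∃ r : Fin M → Fin K, Function.Injective r ∧ (∀ j, (r j).val < M) ∧
      ∀ j t, initEnd K (tm T ω j) ≤ t → ∀ u, selfishRobust T t (history (play K M T) ω t j) u
        = explore M (((r j).val : ℤ) + 1) t (history (play K M T) ω t j) u := by
  have hlog : 0 < Real.log T := Real.log_pos (by exact_mod_cast hT)
  have hfirst : ∀ j, ∃ i, chairStart (tm T ω j) ≤ i ∧ i < chairEnd K T (tm T ω j) ∧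
      0 < (record (play K M T) ω j i).2.2 ∧
      ∀ i' < i, chairStart (tm T ω j) ≤ i' → ¬ 0 < (record (play K M T) ω j i').2.2 := by
    intro j
    have hex : ∃ i, chairStart (tm T ω j) ≤ i ∧ i < chairEnd K T (tm T ω j) ∧
      0 < (record (play K M T) ω j i).2.2 := by
      have := hrank j
      unfold NoRank at this
      push Not at this
      obtain ⟨t, i, _, h1, h2, h3⟩ := this
      exact ⟨i, h1, h2, h3⟩
    refine ⟨Nat.find hex, (Nat.find_spec hex).1, (Nat.find_spec hex).2.1,
      (Nat.find_spec hex).2.2, fun i' hi' ha hpos => ?_⟩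
    exact Nat.find_min hex hi' ⟨ha, hi'.trans (Nat.find_spec hex).2.1, hpos⟩
  choose f hf1 hf2 hf3 hf4 using hfirst
  let r : Fin M → Fin K := fun j => action (play K M T) ω (f j) j
  have hsome : ∀ j t, f j < t → rank (history (play K M T) ω t j) (chairStart (tm T ω j))
      (chairEnd K T (tm T ω j)) = some (r j) := fun j t ht => by
    rw [history_eq]
    exact rank_eq_some_iff.2 ⟨f j, ht, hf1 j, hf2 j, hf3 j, hf4 j, rfl⟩
  have hnone : ∀ j, rank (history (play K M T) ω (f j) j) (chairStart (tm T ω j))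
      (chairEnd K T (tm T ω j)) = none := fun j => by
    rw [rank_history_eq_none_iff]
    exact fun i hi ha _ => hf4 j i hi ha
  -- A player who found her rank first keeps pulling it at least until everybody has finished the
  -- chairs.
  have hfix : ∀ i j, f i < f j → action (play K M T) ω (f j) i = r i := fun i j hij => by
    obtain ⟨h1, _, _⟩ := initEnd_ge hK hlog hL hω i i
    obtain ⟨_, _, h2⟩ := initEnd_ge hK hlog hL hω j i
    have := selfishRobust_history hK hM hMK hT hL hω i (t := f j)
      (by have := hf1 i; omega) ((ω (f j)).2 i)
    rw [if_neg (by have := hf1 i; omega), if_pos ((hf2 j).trans_le h2), hsome i _ hij] at this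
    exact this
  have halone : ∀ j i, i ≠ j → action (play K M T) ω (f j) i ≠ r j := fun j => by
    have h := hf3 j
    simp only [record] at h
    refine (collision_eq_zero_iff (action (play K M T) ω (f j)) j).1 ?_
    rcases collision_mem (action (play K M T) ω (f j)) (action (play K M T) ω (f j) j) with h0 | h0
    · exact h0
    · rw [h0] at h; simp at h
  refine ⟨r, ?_, ?_, ?_⟩
  -- The later of two players obtains a positive reward, hence is alone on her arm at a round when
  -- the earlier one pulls her own rank.
  · have key : ∀ i j, i ≠ j → f i ≤ f j → r i ≠ r j := fun i j hij hle heq => by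
      rcases hle.eq_or_lt with h | h
      · have := halone j i hij
        rw [← h] at this
        exact this heq
      · exact halone j i hij ((hfix i j h).trans heq)
    intro i j heq
    by_contra hij
    rcases le_total (f i) (f j) with h | h
    · exact key i j hij h heq
    · exact key j i (Ne.symm hij) h heq.symm
  · intro j
    obtain ⟨h1, _, h2⟩ := initEnd_ge hK hlog hL hω j j
    have := selfishRobust_history hK hM hMK hT hL hω j (t := f j)
      (h1.trans (hf1 j)) ((ω (f j)).2 j)
    rw [if_neg (not_lt.2 (hf1 j)), if_pos ((hf2 j).trans_le h2), hnone j] at this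
    have hne : (firstArms K M).Nonempty := by
      rw [← Finset.card_pos, card_firstArms hMK]; omega
    have hmem := pick_mem hne (hseed (f j) j)
    have hr : r j = pick (firstArms K M) ((ω (f j)).2 j) := this
    rw [← hr] at hmem
    exact (Finset.mem_filter.1 hmem).2
  · intro j t ht u
    obtain ⟨h0, h1, h2⟩ := initEnd_ge hK hlog hL hω j j
    rw [selfishRobust_history hK hM hMK hT hL hω j (by omega) u, if_neg (by omega),
      if_neg (by omega), hsome j t ((hf2 j).trans_le (h2.trans ht))]

end Ranks

end MMAB

end

noncomputable section

set_option linter.unusedSectionVars false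

namespace MMAB

open MeasureTheory

/-! ## Sorting arms -/

section Sorting

variable {K : ℕ} (x : Fin K → ℝ)

/-- `l` comes before `k` when sorting by decreasing values. -/
def Better (l k : Fin K) : Prop := x k < x l ∨ (x l = x k ∧ l < k)

/-- Number of arms before `k`. -/
def position (k : Fin K) : ℕ := (Finset.univ.filter fun l => Better x l k).card

/-- The first `N` arms. -/
def topSet (N : ℕ) : Finset (Fin K) := Finset.univ.filter fun k => position x k < N

variable {x}

theorem Better.irrefl (k : Fin K) : ¬ Better x k k := by
  rintro (h | h)
  · exact lt_irrefl _ h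
  · exact lt_irrefl _ h.2

theorem Better.trans {a b c : Fin K} (h1 : Better x a b) (h2 : Better x b c) : Better x a c := by
  rcases h1 with h1 | ⟨h1, h1'⟩ <;> rcases h2 with h2 | ⟨h2, h2'⟩
  · exact Or.inl (h2.trans h1)
  · exact Or.inl (h2 ▸ h1)
  · exact Or.inl (h1 ▸ h2)
  · exact Or.inr ⟨h1.trans h2, h1'.trans h2'⟩

theorem Better.total {a b : Fin K} (h : a ≠ b) : Better x a b ∨ Better x b a := by
  rcases lt_trichotomy (x a) (x b) with h1 | h1 | h1
  · exact Or.inr (Or.inl h1)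
  · rcases lt_or_gt_of_ne h with h2 | h2
    · exact Or.inl (Or.inr ⟨h1, h2⟩)
    · exact Or.inr (Or.inr ⟨h1.symm, h2⟩)
  · exact Or.inl (Or.inl h1)

theorem position_lt {a b : Fin K} (h : Better x a b) : position x a < position x b := by
  refine Finset.card_lt_card ⟨fun c hc => ?_, fun hsub => ?_⟩
  · simp only [Finset.mem_filter, Finset.mem_univ, true_and] at hc ⊢
    exact hc.trans h
  · have : a ∈ Finset.univ.filter fun l => Better x l a := hsub (by simpa using h)
    simp only [Finset.mem_filter, Finset.mem_univ, true_and] at this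
    exact Better.irrefl a this

theorem better_of_position_lt {a b : Fin K} (h : position x a < position x b) : Better x a b := by
  have hne : a ≠ b := by rintro rfl; exact lt_irrefl _ h
  rcases Better.total (x := x) hne with h1 | h1
  · exact h1
  · exact absurd (position_lt h1) (by omega)

theorem position_injective : Function.Injective (position x) := by
  intro a b h
  by_contra hne
  rcases Better.total (x := x) hne with h1 | h1
  · exact absurd (position_lt h1) (by omega)
  · exact absurd (position_lt h1) (by omega)

theorem position_lt_card (k : Fin K) : position x k < K := by
  have : position x k < (Finset.univ : Finset (Fin K)).card := by
    refine Finset.card_lt_card ⟨Finset.filter_subset _ _, fun hsub => ?_⟩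
    have := hsub (Finset.mem_univ k)
    simp only [Finset.mem_filter, Finset.mem_univ, true_and] at this
    exact Better.irrefl k this
  simpa using this

theorem exists_position_eq {n : ℕ} (hn : n < K) : ∃ k, position x k = n := by
  let f : Fin K → Fin K := fun k => ⟨position x k, position_lt_card k⟩
  have hf : Function.Injective f := fun a b h => position_injective (Fin.mk.inj_iff.1 h)
  obtain ⟨k, hk⟩ := (Finite.injective_iff_surjective.1 hf) ⟨n, hn⟩
  exact ⟨k, Fin.mk.inj_iff.1 hk⟩

theorem card_topSet {N : ℕ} (hN : N ≤ K) : (topSet x N).card = N := by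
  have h : (topSet x N).image (position x) = Finset.range N := by
    ext n
    simp only [topSet, Finset.mem_image, Finset.mem_filter, Finset.mem_univ, true_and,
      Finset.mem_range]
    constructor
    · rintro ⟨k, h, rfl⟩; exact h
    · intro hn
      obtain ⟨k, hk⟩ := exists_position_eq (x := x) (hn.trans_le hN)
      exact ⟨k, hk ▸ hn, hk⟩
  rw [← Finset.card_image_of_injective _ (position_injective (x := x)), h, Finset.card_range]

end Sorting

/-! ## One block of the exploration-exploitation phase -/

section Block

variable {K M : ℕ} [NeZero K]

theorem empRank_eq {t : ℕ} (h : Fin t → Record K) (s : ℕ) (k : Fin K) :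
    empRank h s k = position (fun k => empMean h k s) k := by
  unfold empRank position Better
  congr

theorem bestArms_eq {t : ℕ} (h : Fin t → Record K) (s N : ℕ) :
    bestArms h s N = topSet (fun k => empMean h k s) N := by
  unfold bestArms topSet
  simp only [empRank_eq]

/-- Position of a player of rank `r + 1` at round `t + 1`. -/
def turn (M r t : ℕ) : ℕ := (t + r + 2) % M

/-- The arm of the list that is due at round `t + 1`, given the empirical means `x`. -/
def slot (x : Fin K → ℝ) (M r t : ℕ) : Fin K :=
  ((topSet x M).sort (· ≤ ·)).getD (turn M r t) 0

/-- The arms worth exploring, given the empirical means `x` and the indices `v`. -/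
def exploreSet (x v : Fin K → ℝ) (M : ℕ) (a : Fin K) : Finset (Fin K) :=
  Finset.univ.filter fun k => k ∉ topSet x M ∧ x a ≤ v k

/-- The arm pulled by the exploration-exploitation algorithm. -/
def exploreArm (x v : Fin K → ℝ) (M r t : ℕ) (u : ℝ) : Fin K :=
  if position x (slot x M r t) + 1 ≠ M then slot x M r t
  else if exploreSet x v M (slot x M r t) = ∅ then slot x M r t
  else if u < 1 / 2 then slot x M r t
  else pick (exploreSet x v M (slot x M r t)) (2 * u - 1)

theorem explore_eq {x v : Fin K → ℝ} {t r : ℕ} {h : Fin t → Record K}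
    (hx : ∀ k, empMean h k (M * ((t + 1) / M) - 1) = x k)
    (hv : ∀ k, klIndex h (M * ((t + 1) / M)) k = v k) (u : ℝ) :
    explore M ((r : ℤ) + 1) t h u = exploreArm x v M r t u := by
  have ht : (((t : ℤ) + 1 + ((r : ℤ) + 1)) % (M : ℤ)).toNat = turn M r t := by
    unfold turn
    have : ((t : ℤ) + 1 + ((r : ℤ) + 1)) = ((t + r + 2 : ℕ) : ℤ) := by push_cast; ring
    rw [this, ← Int.natCast_mod, Int.toNat_natCast]
  unfold explore
  simp only [empRank_eq, bestArms_eq, hx, hv, ht]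
  rfl

variable {x v : Fin K → ℝ} {r : ℕ}

theorem turn_lt (hM : 1 ≤ M) (r t : ℕ) : turn M r t < M := Nat.mod_lt _ hM

theorem slot_mem (hM : 1 ≤ M) (hMK : M ≤ K) (r t : ℕ) : slot x M r t ∈ topSet x M :=
  getD_sort_mem _ (by rw [card_topSet hMK]; exact turn_lt hM r t)

theorem slot_inj (hM : 1 ≤ M) (hMK : M ≤ K) {r t r' t' : ℕ}
    (h : slot x M r t = slot x M r' t') : turn M r t = turn M r' t' := by
  have h1 := (sort_getD_eq_iff (topSet x M)
    (by rw [card_topSet hMK]; exact turn_lt hM r t) (slot_mem hM hMK r' t')).1 h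
  have h2 := (sort_getD_eq_iff (topSet x M)
    (by rw [card_topSet hMK]; exact turn_lt hM r' t') (slot_mem hM hMK r' t')).1 rfl
  rw [h1, h2]

theorem turn_inj_time {r t t' : ℕ} (h : turn M r t = turn M r t') (h1 : t ≤ t') (h2 : t' < t + M) :
    t = t' := by
  unfold turn at h
  have h3 := (Nat.modEq_iff_dvd' (by omega : t + r + 2 ≤ t' + r + 2)).1 h
  have h4 : t' + r + 2 - (t + r + 2) = t' - t := by omega
  rw [h4] at h3
  have := Nat.eq_zero_of_dvd_of_lt h3 (by omega)
  omega

theorem turn_inj_rank {r r' t : ℕ} (h : turn M r t = turn M r' t) (hr : r < M) (hr' : r' < M) :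
    r = r' := by
  wlog hle : r ≤ r' generalizing r r'
  · exact (this h.symm hr' hr (by omega)).symm
  unfold turn at h
  have h3 := (Nat.modEq_iff_dvd' (by omega : t + r + 2 ≤ t + r' + 2)).1 h
  have h4 : t + r' + 2 - (t + r + 2) = r' - r := by omega
  rw [h4] at h3
  have := Nat.eq_zero_of_dvd_of_lt h3 (by omega)
  omega

/-- Every arm of the list is due once in a block. -/
theorem exists_slot_eq (hM : 1 ≤ M) (hMK : M ≤ K) (r n : ℕ) {k : Fin K} (hk : k ∈ topSet x M) :
    ∃ t, n ≤ t ∧ t < n + M ∧ slot x M r t = k := by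
  have hinj : Set.InjOn (slot x M r) (Finset.Ico n (n + M)) := by
    intro t ht t' ht' h
    simp only [Finset.coe_Ico, Set.mem_Ico] at ht ht'
    have h1 := slot_inj hM hMK h
    rcases le_total t t' with hle | hle
    · exact turn_inj_time h1 hle (by omega)
    · exact (turn_inj_time h1.symm hle (by omega)).symm
  have himg : (Finset.Ico n (n + M)).image (slot x M r) = topSet x M := by
    refine Finset.eq_of_subset_of_card_le ?_ ?_
    · intro k hk
      obtain ⟨t, _, rfl⟩ := Finset.mem_image.1 hk
      exact slot_mem hM hMK r t
    · rw [Finset.card_image_of_injOn hinj, card_topSet hMK, Nat.card_Ico]; omega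
  rw [← himg] at hk
  obtain ⟨t, ht, h⟩ := Finset.mem_image.1 hk
  rw [Finset.mem_Ico] at ht
  exact ⟨t, ht.1, ht.2, h⟩

theorem exploreArm_cases {t : ℕ} {u : ℝ} (hu : u < 1) :
    exploreArm x v M r t u = slot x M r t ∨
      (position x (slot x M r t) + 1 = M ∧
        exploreArm x v M r t u ∈ exploreSet x v M (slot x M r t)) := by
  unfold exploreArm
  split_ifs with h1 h2 h3
  · exact Or.inl rfl
  · exact Or.inl rfl
  · exact Or.inl rfl
  · exact Or.inr ⟨not_not.1 h1, pick_mem (Finset.nonempty_iff_ne_empty.2 h2) (by linarith)⟩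

theorem exploreArm_of_mem {t : ℕ} {u : ℝ} (hu : u < 1)
    (h : exploreArm x v M r t u ∈ topSet x M) : exploreArm x v M r t u = slot x M r t := by
  rcases exploreArm_cases (x := x) (v := v) (M := M) (r := r) (t := t) hu with h1 | ⟨_, h1⟩
  · exact h1
  · exact absurd h (Finset.mem_filter.1 h1).2.1

theorem exploreArm_of_notMem (hM : 1 ≤ M) (hMK : M ≤ K) {t : ℕ} {u : ℝ} (hu : u < 1)
    (h : exploreArm x v M r t u ∉ topSet x M) :
    position x (slot x M r t) + 1 = M ∧ x (slot x M r t) ≤ v (exploreArm x v M r t u) := by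
  rcases exploreArm_cases (x := x) (v := v) (M := M) (r := r) (t := t) hu with h1 | ⟨h1, h2⟩
  · exact absurd (h1 ▸ slot_mem hM hMK r t) h
  · exact ⟨h1, (Finset.mem_filter.1 h2).2.2⟩

theorem half_le_volume_slot (t : ℕ) :
    ENNReal.ofReal (1 / 2) ≤ volume {u : I | exploreArm x v M r t u = slot x M r t} := by
  have h : ENNReal.ofReal (1 / 2) = (volume : Measure I) {u : I | (0 : ℝ) ≤ u ∧ (u : ℝ) < 1 / 2} := by
    rw [volume_unitInterval_Ico le_rfl (by norm_num), sub_zero]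
  rw [h]
  refine measure_mono fun u hu => ?_
  simp only [Set.mem_ofPred_eq, exploreArm, hu.2, if_true, ite_self]

theorem le_volume_explore {t : ℕ} {k : Fin K} (h : position x (slot x M r t) + 1 = M)
    (hk : k ∉ topSet x M) (hv : x (slot x M r t) ≤ v k) :
    ENNReal.ofReal (1 / (2 * K)) ≤ volume {u : I | exploreArm x v M r t u = k} := by
  have hmem : k ∈ exploreSet x v M (slot x M r t) := by
    simp only [exploreSet, Finset.mem_filter, Finset.mem_univ, true_and]; exact ⟨hk, hv⟩
  have hcard : (0 : ℝ) < (exploreSet x v M (slot x M r t)).card := by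
    exact_mod_cast Finset.card_pos.2 ⟨k, hmem⟩
  have hle : ((exploreSet x v M (slot x M r t)).card : ℝ) ≤ K := by
    exact_mod_cast (Finset.card_le_univ _).trans_eq (Fintype.card_fin K)
  refine (ENNReal.ofReal_le_ofReal ?_).trans ((volume_half_pick hmem).trans
    (measure_mono fun u hu => ?_))
  · exact one_div_le_one_div_of_le (by linarith) (by linarith)
  · simp only [Set.mem_ofPred_eq, exploreArm]
    rw [if_neg (not_not.2 h), if_neg (Finset.ne_empty_of_mem hmem), if_neg (not_lt.2 hu.1)]
    exact hu.2

end Block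

end MMAB

end

noncomputable section

set_option linter.unusedSectionVars false

namespace MMAB

open MeasureTheory

/-! ### Blocks without deviations: correctness of the list and regret of a round -/

section BlockCore

variable {K M : ℕ} [NeZero K]

/-- Empirical means of player `j` after `n` rounds. -/
def meanVec (s : Fin M → Strategy K) (ω : Outcome K M) (j : Fin M) (n : ℕ) (k : Fin K) : ℝ :=
  qsum s ω j k n / cnt s ω j k n

/-- Indices of player `j` at round `b`. -/
def indexVec (s : Fin M → Strategy K) (ω : Outcome K M) (j : Fin M) (b : ℕ) (k : Fin K) : ℝ :=
  klUCB (cnt s ω j k (b - 1)) (explorationThreshold b) (meanVec s ω j (b - 1) k)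

theorem meanVec_mem (s : Fin M → Strategy K) (ω : Outcome K M) (j : Fin M) (n : ℕ) (k : Fin K) :
    meanVec s ω j n k ∈ Set.Icc (0 : ℝ) 1 := by
  have := empMean_mem (h := history s ω n j)
    (fun i => by rw [history_eq]; exact record_quality_mem s ω j i) k n
  rwa [empMean_history s ω j k le_rfl] at this

/-- Round at which the current block starts. -/
def blockStart (M t : ℕ) : ℕ := M * ((t + 1) / M)

theorem blockStart_le (M t : ℕ) : blockStart M t - 1 ≤ t := by
  have : blockStart M t ≤ t + 1 := Nat.mul_div_le _ _
  omega

theorem lt_blockStart_add (hM : 1 ≤ M) (t : ℕ) : t + 1 < blockStart M t + M := by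
  have h1 := Nat.div_add_mod (t + 1) M
  have h2 := Nat.mod_lt (t + 1) hM
  unfold blockStart
  omega

theorem blockStart_eq_of_mem {t t' : ℕ} (h1 : blockStart M t ≤ t' + 1)
    (h2 : t' + 1 < blockStart M t + M) : blockStart M t' = blockStart M t := by
  have hM : 0 < M := by omega
  unfold blockStart at *
  congr 1
  refine Nat.div_eq_of_lt_le ?_ ?_
  · rw [mul_comm]; exact h1
  · rw [Nat.succ_mul, mul_comm]; exact h2

variable {T : ℕ} {ω : Outcome K M} {j : Fin M} {r τ : ℕ}

/-- From round `τ + 1` on, player `j` explores and exploits with the right number of players and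
the rank `r + 1`. -/
def Exploring (T : ℕ) (ω : Outcome K M) (j : Fin M) (r τ : ℕ) : Prop :=
  ∀ t, τ ≤ t → ∀ u, selfishRobust T t (history (play K M T) ω t j) u
    = explore M ((r : ℤ) + 1) t (history (play K M T) ω t j) u

theorem Exploring.arm (h : Exploring T ω j r τ) {t : ℕ} (ht : τ ≤ t) (u : ℝ) :
    selfishRobust T t (history (play K M T) ω t j) u
      = exploreArm (meanVec (play K M T) ω j (blockStart M t - 1))
        (indexVec (play K M T) ω j (blockStart M t)) M r t u := by
  rw [h t ht]
  refine explore_eq (fun k => ?_) (fun k => ?_) u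
  · exact empMean_history _ _ _ _ (blockStart_le M t)
  · change klIndex _ (blockStart M t) k = _
    rw [klIndex_eq, pulls_history _ _ _ _ (blockStart_le M t),
      empMean_history _ _ _ _ (blockStart_le M t)]
    rfl

theorem Exploring.action_eq (h : Exploring T ω j r τ) {t : ℕ} (ht : τ ≤ t) :
    action (play K M T) ω t j
      = exploreArm (meanVec (play K M T) ω j (blockStart M t - 1))
        (indexVec (play K M T) ω j (blockStart M t)) M r t ((ω t).2 j) := h.arm ht _

theorem Exploring.pullProb_eq (h : Exploring T ω j r τ) {t : ℕ} (ht : τ ≤ t) (k : Fin K) :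
    pullProb (play K M T) j k t ω = volume {u : I |
      exploreArm (meanVec (play K M T) ω j (blockStart M t - 1))
        (indexVec (play K M T) ω j (blockStart M t)) M r t u = k} := by
  unfold pullProb
  congr 1
  ext u
  simp only [Set.mem_ofPred_eq]
  rw [← h.arm ht]

/-- Arm `k` may only be pulled at this position of the block. -/
def Due (x : Fin K → ℝ) (M r t : ℕ) (k : Fin K) : Prop :=
  (k ∈ topSet x M ∧ slot x M r t = k) ∨ (k ∉ topSet x M ∧ position x (slot x M r t) + 1 = M)

theorem due_of_exploreArm (hM : 1 ≤ M) (hMK : M ≤ K) {x v : Fin K → ℝ} {t : ℕ} {u : ℝ}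
    (hu : u < 1) : Due x M r t (exploreArm x v M r t u) := by
  by_cases h : exploreArm x v M r t u ∈ topSet x M
  · exact Or.inl ⟨h, (exploreArm_of_mem hu h).symm⟩
  · exact Or.inr ⟨h, (exploreArm_of_notMem hM hMK hu h).1⟩

/-- An arm of the list has its own position, and all arms outside it share the position of the last
empirical arm. Hence an arm is due at most once per block. -/
theorem Due.turn_eq (hM : 1 ≤ M) (hMK : M ≤ K) {x : Fin K → ℝ} {t t' : ℕ} {k : Fin K}
    (h : Due x M r t k) (h' : Due x M r t' k) : turn M r t = turn M r t' := by
  refine slot_inj (x := x) hM hMK ?_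
  rcases h with ⟨h1, h2⟩ | ⟨h1, h2⟩ <;> rcases h' with ⟨h3, h4⟩ | ⟨h3, h4⟩
  · rw [h2, h4]
  · exact absurd h1 h3
  · exact absurd h3 h1
  · exact position_injective (x := x) (by omega)

theorem stats_congr (s : Fin M → Strategy K) (ω : Outcome K M) (j : Fin M) (k : Fin K) {n t : ℕ}
    (hn : n ≤ t) (h : ∀ t', n ≤ t' → t' < t → action s ω t' j ≠ k) :
    cnt s ω j k t = cnt s ω j k n ∧ qsum s ω j k t = qsum s ω j k n := by
  have : (Finset.range t).filter (fun i => action s ω i j = k)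
      = (Finset.range n).filter fun i => action s ω i j = k := by
    ext i
    simp only [Finset.mem_filter, Finset.mem_range]
    constructor
    · rintro ⟨h1, h2⟩
      refine ⟨?_, h2⟩
      by_contra! h3
      exact h i h3 h1 h2
    · rintro ⟨h1, h2⟩; exact ⟨by omega, h2⟩
  unfold cnt qsum
  rw [this]
  exact ⟨rfl, rfl⟩

/-- The statistics of an arm do not change in a block before this arm is due. -/
theorem Exploring.stats (h : Exploring T ω j r τ) (hM : 1 ≤ M) (hMK : M ≤ K)
    (hseed : ∀ t j, ((ω t).2 j : ℝ) < 1) {t : ℕ} (hτ : τ + 1 ≤ blockStart M t) {k : Fin K}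
    (hdue : Due (meanVec (play K M T) ω j (blockStart M t - 1)) M r t k) :
    cnt (play K M T) ω j k t = cnt (play K M T) ω j k (blockStart M t - 1) ∧
      qsum (play K M T) ω j k t = qsum (play K M T) ω j k (blockStart M t - 1) := by
  refine stats_congr _ _ _ _ (blockStart_le M t) fun t' h1 h2 hact => ?_
  have hlt := lt_blockStart_add hM t
  have hb : blockStart M t' = blockStart M t := blockStart_eq_of_mem (by omega) (by omega)
  have hd := due_of_exploreArm (x := meanVec (play K M T) ω j (blockStart M t - 1))
    (v := indexVec (play K M T) ω j (blockStart M t)) (r := r) (t := t') hM hMK (hseed t' j)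
  have ha := h.action_eq (t := t') (by omega)
  rw [hb] at ha
  rw [← ha, hact] at hd
  have := turn_inj_time (hd.turn_eq hM hMK hdue) (by omega) (by omega)
  omega

variable (ν : Fin K → Measure I)

/-- Arm `k` has a fair chance to be pulled by `j` in spite of a deviation of its mean. -/
def hitSet (T : ℕ) (δ ε : ℝ) (j : Fin M) (k : Fin K) (t : ℕ) : Set (Outcome K M) :=
  {ω | ENNReal.ofReal (1 / (2 * K)) ≤ pullProb (play K M T) j k t ω ∧
    1 ≤ pot (play K M T) (devWeight (mean ν k) δ ε) j k t ω}

/-- Deviations of the means and of the indices that may perturb the block starting at `b`. -/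
def BadBlock (T : ℕ) (δ : ℝ) (j : Fin M) (b : ℕ) (ω : Outcome K M) : Prop :=
  (∃ t, b ≤ t + 1 ∧ t + 1 < b + M ∧ ∃ k, ω ∈ hitSet ν T δ 1 j k t ∨ ω ∈ hitSet ν T δ (-1) j k t) ∨
    ∃ k, UnderEst (play K M T) ω j k (b - 1) (explorationThreshold b) (mean ν k - δ)

/-- `top` is the set of the `M` best arms and `w` is the worst of them, with gaps `2 δ`. -/
structure IsTop (M : ℕ) (top : Finset (Fin K)) (w : Fin K) (δ : ℝ) : Prop where
  card : top.card = M
  mem : w ∈ top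
  gap_top : ∀ k ∈ top, k ≠ w → mean ν w + 2 * δ ≤ mean ν k
  gap_out : ∀ k, k ∉ top → mean ν k + 2 * δ ≤ mean ν w

variable {ν} [∀ k, IsProbabilityMeasure (ν k)]

theorem IsTop.le {top : Finset (Fin K)} {w : Fin K} {δ : ℝ} (h : IsTop ν M top w δ) (hδ : 0 < δ)
    {k : Fin K} (hk : k ∈ top) : mean ν w ≤ mean ν k := by
  by_cases hkw : k = w
  · rw [hkw]
  · linarith [h.gap_top k hk hkw]

/-- In a block without deviations the list is right, its last arm is right and accurate. -/
theorem Exploring.right_block (h : Exploring T ω j r τ) (hM : 1 ≤ M) (hMK : M ≤ K)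
    (hseed : ∀ t j, ((ω t).2 j : ℝ) < 1) {b t₀ : ℕ} (hb : b = blockStart M t₀) (hτ : τ + 1 ≤ b)
    {δ : ℝ} (hδ : 0 < δ) (hμ : ∀ k, δ < mean ν k) {top : Finset (Fin K)} {w : Fin K}
    (htop : IsTop ν M top w δ) (hgood : ¬ BadBlock ν T δ j b ω) :
    topSet (meanVec (play K M T) ω j (b - 1)) M = top ∧
      (∀ k, position (meanVec (play K M T) ω j (b - 1)) k + 1 = M → k = w) ∧
      |meanVec (play K M T) ω j (b - 1) w - mean ν w| < δ := by
  set x := meanVec (play K M T) ω j (b - 1) with hx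
  set v := indexVec (play K M T) ω j b with hv
  unfold BadBlock at hgood
  rw [not_or] at hgood
  obtain ⟨hhit, hunder⟩ := hgood
  push Not at hhit hunder
  have hblock : ∀ t, b ≤ t + 1 → t + 1 < b + M → blockStart M t = b := fun t h1 h2 => by
    rw [hb] at h1 h2 ⊢; exact blockStart_eq_of_mem h1 h2
  have hK1 : (1 : ℝ) ≤ K := by exact_mod_cast NeZero.one_le
  -- At the round where an arm is due, its statistics are still those frozen at the block start. The
  -- absence of a hit at that round therefore says that the frozen mean is accurate, provided the
  -- arm has a fair chance of being pulled.
  have haccurate : ∀ t k, b ≤ t + 1 → t + 1 < b + M → Due x M r t k →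
      ENNReal.ofReal (1 / (2 * K)) ≤ pullProb (play K M T) j k t ω →
      |x k - mean ν k| < δ := by
    intro t k h1 h2 hdue hprob
    have hbt := hblock t h1 h2
    have hst := h.stats hM hMK hseed (t := t) (k := k) (by omega) (by rw [hbt]; exact hdue)
    rw [hbt] at hst
    obtain ⟨hn1, hn2⟩ := hhit t h1 h2 k
    have := abs_empMean_sub_lt (play K M T) (mean ν k) hδ j k t ω (fun hc => hn1 ⟨hprob, hc⟩)
      (fun hc => hn2 ⟨hprob, hc⟩)
    rwa [hst.1, hst.2] at this
  have hprobArm : ∀ t k, b ≤ t + 1 → t + 1 < b + M →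
      pullProb (play K M T) j k t ω = volume {u : I | exploreArm x v M r t u = k} := by
    intro t k h1 h2
    have := h.pullProb_eq (t := t) (by omega) k
    rw [hblock t h1 h2] at this
    exact this
  have hlist : ∀ k ∈ topSet x M, |x k - mean ν k| < δ := by
    intro k hk
    obtain ⟨t, h1, h2, h3⟩ := exists_slot_eq (x := x) hM hMK r (b - 1) hk
    refine haccurate t k (by omega) (by omega) (Or.inl ⟨hk, h3⟩) ?_
    rw [hprobArm t k (by omega) (by omega), ← h3]
    refine le_trans (ENNReal.ofReal_le_ofReal ?_) (half_le_volume_slot t)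
    exact one_div_le_one_div_of_le (by norm_num) (by linarith)
  obtain ⟨a, ha⟩ := exists_position_eq (x := x) (show M - 1 < K by omega)
  have hatop : a ∈ topSet x M := by
    simp only [topSet, Finset.mem_filter, Finset.mem_univ, true_and]; omega
  have hlast : ∀ k ∈ topSet x M, x a ≤ x k := by
    intro k hk
    simp only [topSet, Finset.mem_filter, Finset.mem_univ, true_and] at hk
    rcases eq_or_ne k a with rfl | hne
    · exact le_rfl
    · have : position x k ≠ position x a := fun h => hne (position_injective h)
      rcases better_of_position_lt (x := x) (a := k) (b := a) (by omega) with h1 | h1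
      · exact h1.le
      · exact h1.1.ge
  have hfirst : ∀ k, k ∉ topSet x M → x k ≤ x a := by
    intro k hk
    simp only [topSet, Finset.mem_filter, Finset.mem_univ, true_and, not_lt] at hk
    rcases better_of_position_lt (x := x) (a := a) (b := k) (by omega) with h1 | h1
    · exact h1.le
    · exact h1.1.ge
  -- Otherwise a bad arm `k₁` is listed and a good arm `k₂` is not. The listed arms are accurate, so
  -- the last one has mean below that of `k₂` minus `δ`, hence below the index of `k₂`. Then `k₂` is
  -- explored with a fair chance, so it is accurate too, and its empirical mean beats the last
  -- listed arm: a contradiction.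
  have htopeq : topSet x M = top := by
    by_contra hne
    have hcard : (topSet x M).card = top.card := by rw [card_topSet hMK, htop.card]
    obtain ⟨k₁, hk₁, hk₁'⟩ : ∃ k ∈ topSet x M, k ∉ top := by
      by_contra! hc
      exact hne (Finset.eq_of_subset_of_card_le hc hcard.ge)
    obtain ⟨k₂, hk₂, hk₂'⟩ : ∃ k ∈ top, k ∉ topSet x M := by
      by_contra! hc
      exact hne (Finset.eq_of_subset_of_card_le hc hcard.le).symm
    have h1 : x a < mean ν k₂ - δ := by
      have h2 := (abs_lt.1 (hlist k₁ hk₁)).2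
      linarith [hlast k₁ hk₁, htop.gap_out k₁ hk₁', htop.le hδ hk₂]
    have hindex : x a ≤ v k₂ := by
      refine h1.le.trans (not_lt.1 fun hlt => ?_)
      have hmem := meanVec_mem (play K M T) ω j (b - 1) k₂
      have h3 := of_klUCB_lt hmem.1 hmem.2 (by linarith [hμ k₂])
        (by linarith [(mean_mem ν k₂).2]) hlt
      exact hunder k₂ h3
    obtain ⟨t, h4, h5, h6⟩ := exists_slot_eq (x := x) hM hMK r (b - 1) hatop
    have hpos : position x (slot x M r t) + 1 = M := by rw [h6, ha]; omega
    have h7 := haccurate t k₂ (by omega) (by omega) (Or.inr ⟨hk₂', hpos⟩) (by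
      rw [hprobArm t k₂ (by omega) (by omega)]
      exact le_volume_explore hpos hk₂' (by rw [h6]; exact hindex))
    linarith [(abs_lt.1 h7).1, hfirst k₂ hk₂']
  have haw : a = w := by
    by_contra hne
    have h1 := htop.gap_top a (htopeq ▸ hatop) hne
    have hw : w ∈ topSet x M := htopeq ▸ htop.mem
    linarith [hlast w hw, (abs_lt.1 (hlist a hatop)).1, (abs_lt.1 (hlist w hw)).2]
  refine ⟨htopeq, fun k hk => ?_, hlist w (htopeq ▸ htop.mem)⟩
  rw [← haw]
  exact position_injective (x := x) (by omega)

/-- In a good block a suboptimal arm is only pulled if it was pulled few times, or if its empirical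
mean is too large. -/
theorem Exploring.suboptimal_pull (h : Exploring T ω j r τ) (hM : 1 ≤ M) (hMK : M ≤ K)
    (hseed : ∀ t j, ((ω t).2 j : ℝ) < 1) {t : ℕ} (hτ : τ + 1 ≤ blockStart M t)
    {δ : ℝ} (hδ : 0 < δ) (hμ : ∀ k, δ < mean ν k) {top : Finset (Fin K)} {w : Fin K}
    (htop : IsTop ν M top w δ) (hgood : ¬ BadBlock ν T δ j (blockStart M t) ω) {k : Fin K}
    (hk : k ∉ top) (hact : action (play K M T) ω t j = k)
    (hf : 0 ≤ explorationThreshold (blockStart M t)) :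
    cnt (play K M T) ω j k t * klr (mean ν k + δ) (mean ν w - δ)
        ≤ explorationThreshold (blockStart M t) ∨
      1 ≤ pot (play K M T) (devWeight (mean ν k) δ 1) j k t ω := by
  obtain ⟨h1, h2, h3⟩ := h.right_block hM hMK hseed rfl hτ hδ hμ htop hgood
  set b := blockStart M t with hb
  set x := meanVec (play K M T) ω j (b - 1) with hx
  have hbt := blockStart_le M t
  have ha := h.action_eq (t := t) (by omega)
  rw [← hb, ← hx, hact] at ha
  have hdue : Due x M r t k := by
    rw [ha]; exact due_of_exploreArm hM hMK (hseed t j)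
  have hst := h.stats hM hMK hseed (t := t) (k := k) hτ hdue
  have hout : exploreArm x (indexVec (play K M T) ω j b) M r t ((ω t).2 j) ∉ topSet x M := by
    rw [← ha, h1]; exact hk
  have h4 := exploreArm_of_notMem hM hMK (hseed t j) hout
  rw [h2 _ h4.1, ← ha] at h4
  have hxk : x k = qsum (play K M T) ω j k t / cnt (play K M T) ω j k t := by
    rw [hst.1, hst.2]; rfl
  -- The pull means that the index of `k` passed the empirical mean of `w`, which exceeds `mean ν w
  -- - δ`. Either the empirical mean of `k` is reasonable and the index bound limits its pulls, or
  -- it deviates upwards.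
  by_cases hdev : x k < mean ν k + δ
  · left
    have hmem := meanVec_mem (play K M T) ω j (b - 1) k
    have h5 := (abs_lt.1 h3).1
    have h6 : mean ν w - δ < indexVec (play K M T) ω j b k := by linarith [h4.2]
    have h8 := htop.gap_out k hk
    have hw1 : mean ν w - δ < 1 := by linarith [(mean_mem ν w).2]
    have h7 := of_lt_klUCB (n := cnt (play K M T) ω j k (b - 1)) hf hmem.1 (by linarith) hw1 h6
    rw [← hst.1] at h7
    refine le_trans (mul_le_mul_of_nonneg_left ?_ (Nat.cast_nonneg _)) h7
    exact klr_anti_left hmem.1 hdev.le (by linarith) hw1 (by linarith [hμ w])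
  · right
    refine one_le_pot_of_dev _ _ hδ j k t ω ?_
    rw [← hxk]
    linarith

/-- The counter increases strictly at each pull, so these rounds have distinct counter values below
`n₀`. -/
theorem card_pulls_lt (s : Fin M → Strategy K) (ω : Outcome K M) (j : Fin M) (k : Fin K)
    (n₀ n : ℕ) :
    ((Finset.range n).filter fun t => action s ω t j = k ∧ cnt s ω j k t < n₀).card ≤ n₀ := by
  have : (((Finset.range n).filter fun t => action s ω t j = k ∧ cnt s ω j k t < n₀).image
      (cnt s ω j k)).card ≤ n₀ := by
    refine (Finset.card_le_card (t := Finset.range n₀) ?_).trans_eq (Finset.card_range _)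
    intro c hc
    obtain ⟨t, ht, rfl⟩ := Finset.mem_image.1 hc
    exact Finset.mem_range.2 (Finset.mem_filter.1 ht).2.2
  rwa [Finset.card_image_of_injOn] at this
  have hlt : ∀ t t', t < t' → action s ω t j = k → cnt s ω j k t < cnt s ω j k t' := by
    intro t t' htt' hact
    unfold cnt
    refine Finset.card_lt_card ⟨Finset.filter_subset_filter _
      (Finset.range_subset_range.2 htt'.le), fun hsub => ?_⟩
    have := hsub (Finset.mem_filter.2 ⟨Finset.mem_range.2 htt', hact⟩)
    simp at this
  intro t ht t' ht' heq
  simp only [Finset.coe_filter, Set.mem_ofPred_eq] at ht ht'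
  rcases lt_trichotomy t t' with h | h | h
  · exact absurd heq (hlt t t' h ht.2.1).ne
  · exact h
  · exact absurd heq.symm (hlt t' t h ht'.2.1).ne

/-- Regret of one round where all players are in a good block. -/
theorem round_regret_eq {r : Fin M → ℕ} (hinj : Function.Injective r) (hr : ∀ j, r j < M)
    (h : ∀ j, Exploring T ω j (r j) τ) (hM : 1 ≤ M) (hMK : M ≤ K)
    (hseed : ∀ t j, ((ω t).2 j : ℝ) < 1) {t : ℕ} (hτ : τ + 1 ≤ blockStart M t)
    {δ : ℝ} (hδ : 0 < δ) (hμ : ∀ k, δ < mean ν k) {top : Finset (Fin K)} {w : Fin K}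
    (htop : IsTop ν M top w δ) (hgood : ∀ j, ¬ BadBlock ν T δ j (blockStart M t) ω) :
    ∑ k ∈ top, mean ν k - ∑ j, mean ν (action (play K M T) ω t j)
        * (1 - collision (action (play K M T) ω t) (action (play K M T) ω t j))
      = ∑ j, ∑ k ∈ topᶜ, if action (play K M T) ω t j = k then mean ν w - mean ν k else 0 := by
  have hright := fun j => (h j).right_block hM hMK hseed rfl hτ hδ hμ htop (hgood j)
  have hbt := blockStart_le M t
  set b := blockStart M t with hb
  let x : Fin M → Fin K → ℝ := fun j => meanVec (play K M T) ω j (b - 1)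
  have hact := fun j => (h j).action_eq (t := t) (by omega)
  have hslot : ∀ j, slot (x j) M (r j) t = (top.sort (· ≤ ·)).getD (turn M (r j) t) 0 := fun j => by
    unfold slot; rw [(hright j).1]
  -- All players hold the same list, and distinct ranks give distinct positions: the due arms form a
  -- bijection with `top`. Only the player whose due arm is `w` may leave the list, so nobody
  -- collides and her loss is `mean ν w - mean ν k`.
  let S : Fin M → Fin K := fun j => (top.sort (· ≤ ·)).getD (turn M (r j) t) 0
  have hSmem : ∀ j, S j ∈ top := fun j =>
    getD_sort_mem top (by rw [htop.card]; exact turn_lt hM _ _)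
  have hSinj : Function.Injective S := by
    intro i j hij
    have h1 := slot_inj (x := x i) hM hMK (r := r i) (t := t) (r' := r j) (t' := t) (by
      unfold slot; rw [(hright i).1]; exact hij)
    exact hinj (turn_inj_rank h1 (hr i) (hr j))
  have hcases : ∀ j, action (play K M T) ω t j = S j ∨
      (S j = w ∧ action (play K M T) ω t j ∉ top) := by
    intro j
    by_cases hin : action (play K M T) ω t j ∈ top
    · left
      have h1 := exploreArm_of_mem (x := x j) (v := indexVec (play K M T) ω j b) (M := M) (r := r j)
        (t := t) (hseed t j) (by rw [(hright j).1, ← hact j]; exact hin)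
      rw [← hact j, hslot] at h1
      exact h1
    · right
      have h1 := exploreArm_of_notMem (x := x j) (v := indexVec (play K M T) ω j b) (r := r j) hM hMK
        (t := t) (hseed t j) (by rw [(hright j).1, ← hact j]; exact hin)
      have h2 := (hright j).2.1 _ h1.1
      rw [hslot] at h2
      exact ⟨h2, hin⟩
  have hainj : ∀ j i, i ≠ j → action (play K M T) ω t i ≠ action (play K M T) ω t j := by
    intro j i hij heq
    rcases hcases i with h1 | ⟨h1, h1'⟩ <;> rcases hcases j with h2 | ⟨h2, h2'⟩
    · exact hij (hSinj (h1.symm.trans (heq.trans h2)))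
    · exact h2' (heq ▸ h1 ▸ hSmem i)
    · exact h1' (heq ▸ h2 ▸ hSmem j)
    · exact hij (hSinj (h1.trans h2.symm))
  have himg : Finset.univ.image S = top := by
    refine Finset.eq_of_subset_of_card_le ?_ ?_
    · intro k hk
      obtain ⟨j, _, rfl⟩ := Finset.mem_image.1 hk
      exact hSmem j
    · rw [Finset.card_image_of_injective _ hSinj, Finset.card_univ, Fintype.card_fin, htop.card]
  have hsum : ∑ k ∈ top, mean ν k = ∑ j, mean ν (S j) := by
    rw [← himg, Finset.sum_image fun i _ j _ hij => hSinj hij]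
  rw [hsum, ← Finset.sum_sub_distrib]
  refine Finset.sum_congr rfl fun j _ => ?_
  rw [(collision_eq_zero_iff _ j).2 (hainj j), sub_zero, mul_one, Finset.sum_ite_eq]
  rcases hcases j with h1 | ⟨h1, h2⟩
  · rw [h1, if_neg (by simpa using hSmem j), sub_self]
  · rw [h1, if_pos (by simpa using h2)]

end BlockCore

end MMAB

end

noncomputable section

set_option linter.unusedSectionVars false

namespace MMAB

open MeasureTheory Filter Topology

/-! ## Ordered means -/

section Order

variable {K M : ℕ} (m : Fin K → ℝ)

/-- The arms sorted by decreasing means. -/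
def armOrder : Equiv.Perm (Fin K) := Tuple.sort fun k => -m k

/-- The `M` best arms. -/
def topArms (M : ℕ) : Finset (Fin K) := Finset.univ.filter fun k => ((armOrder m).symm k).val < M

variable {m}

theorem armOrder_antitone {i i' : Fin K} (h : i ≤ i') : m (armOrder m i') ≤ m (armOrder m i) := by
  have := Tuple.monotone_sort (fun k => -m k) h
  simp only [Function.comp] at this
  unfold armOrder
  linarith

theorem armOrder_strictAnti (hm : Function.Injective m) {i i' : Fin K} (h : i < i') :
    m (armOrder m i') < m (armOrder m i) :=
  lt_of_le_of_ne (armOrder_antitone h.le)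
    fun he => h.ne' ((armOrder m).injective (hm he))

theorem ordMean_succ {i : ℕ} (hi : i < K) : ordMean m (i + 1) = m (armOrder m ⟨i, hi⟩) := by
  unfold ordMean
  rw [dif_pos ⟨by omega, by omega⟩]
  rfl

theorem ordMean_last_le (k : Fin K) : ordMean m K ≤ m k := by
  have hK : 0 < K := k.pos
  obtain ⟨n, rfl⟩ := Nat.exists_eq_succ_of_ne_zero hK.ne'
  change ordMean m (n + 1) ≤ m k
  have h := ordMean_succ (m := m) (Nat.lt_succ_self n)
  have := armOrder_antitone (m := m) (Fin.le_last ((armOrder m).symm k))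
  rw [Equiv.apply_symm_apply] at this
  exact h.le.trans this

theorem sum_ordMean (F : ℝ → ℝ) (S : Finset ℕ) (hS : ∀ i ∈ S, 1 ≤ i ∧ i ≤ K) :
    ∑ i ∈ S, F (ordMean m i)
      = ∑ k ∈ Finset.univ.filter (fun k => ((armOrder m).symm k).val + 1 ∈ S), F (m k) := by
  symm
  refine Finset.sum_bij (fun k _ => ((armOrder m).symm k).val + 1) ?_ ?_ ?_ ?_
  · intro k hk; exact (Finset.mem_filter.1 hk).2
  · intro k _ k' _ h
    exact (armOrder m).symm.injective (Fin.ext (by omega))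
  · intro i hi
    obtain ⟨h1, h2⟩ := hS i hi
    refine ⟨armOrder m ⟨i - 1, by omega⟩, ?_, ?_⟩
    · simp only [Finset.mem_filter, Finset.mem_univ, true_and, Equiv.symm_apply_apply]
      rwa [Nat.sub_add_cancel h1]
    · simp only [Equiv.symm_apply_apply]; omega
  · intro k _
    rw [ordMean_succ ((armOrder m).symm k).2]
    simp

theorem sum_Icc_ordMean (hMK : M ≤ K) :
    ∑ i ∈ Finset.Icc 1 M, ordMean m i = ∑ k ∈ topArms m M, m k := by
  have := sum_ordMean (m := m) id (Finset.Icc 1 M) (fun i hi => by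
    rw [Finset.mem_Icc] at hi; omega)
  simp only [id] at this
  rw [this]
  refine Finset.sum_congr ?_ fun _ _ => rfl
  ext k
  simp only [topArms, Finset.mem_filter, Finset.mem_univ, true_and, Finset.mem_Icc]
  omega

theorem sum_Ioc_ordMean (F : ℝ → ℝ) :
    ∑ i ∈ Finset.Ioc M K, F (ordMean m i) = ∑ k ∈ (topArms m M)ᶜ, F (m k) := by
  rw [sum_ordMean F _ (fun i hi => by rw [Finset.mem_Ioc] at hi; omega)]
  refine Finset.sum_congr ?_ fun _ _ => rfl
  ext k
  simp only [topArms, Finset.mem_filter, Finset.mem_univ, true_and, Finset.mem_Ioc,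
    Finset.mem_compl]
  omega

theorem card_topArms [NeZero K] (hMK : M ≤ K) : (topArms m M).card = M := by
  have : (topArms m M).map (armOrder m).symm.toEmbedding = firstArms K M := by
    ext i
    simp only [topArms, firstArms, Finset.mem_map, Finset.mem_filter, Finset.mem_univ, true_and,
      Equiv.coe_toEmbedding]
    exact ⟨fun ⟨k, hk, h⟩ => h ▸ hk, fun hi => ⟨armOrder m i, by simpa using hi, by simp⟩⟩
  rw [← Finset.card_map (armOrder m).symm.toEmbedding, this, card_firstArms hMK]

end Order

/-! ## Choice of the accuracy -/

section Accuracy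

variable {K M : ℕ} [NeZero K] {ν : Fin K → Measure I} [∀ k, IsProbabilityMeasure (ν k)]

theorem eventually_const_mul_lt {a : ℝ} (ha : 0 < a) (c : ℝ) :
    ∀ᶠ δ in 𝓝[>] (0 : ℝ), c * δ < a := by
  have h : Tendsto (fun δ : ℝ => c * δ) (𝓝[>] 0) (𝓝 0) := by
    have : Tendsto (fun δ : ℝ => c * δ) (𝓝 0) (𝓝 (c * 0)) := tendsto_id.const_mul c
    rw [mul_zero] at this
    exact this.mono_left nhdsWithin_le_nhds
  exact h.eventually (gt_mem_nhds ha)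

theorem eventually_isTop (hM : 1 ≤ M) (hMK : M ≤ K) (hinj : Function.Injective (mean ν)) :
    ∀ᶠ δ in 𝓝[>] (0 : ℝ), IsTop ν M (topArms (mean ν) M) (armOrder (mean ν) ⟨M - 1, by omega⟩) δ := by
  set w := armOrder (mean ν) ⟨M - 1, by omega⟩ with hw
  have htop : ∀ k ∈ topArms (mean ν) M, k ≠ w → mean ν w < mean ν k := by
    intro k hk hne
    simp only [topArms, Finset.mem_filter, Finset.mem_univ, true_and] at hk
    have hlt : (armOrder (mean ν)).symm k < ⟨M - 1, by omega⟩ := by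
      refine lt_of_le_of_ne (Fin.le_def.2 (by simp only; omega)) fun h => hne ?_
      rw [hw, ← h, Equiv.apply_symm_apply]
    have := armOrder_strictAnti hinj hlt
    rwa [Equiv.apply_symm_apply] at this
  have hout : ∀ k, k ∉ topArms (mean ν) M → mean ν k < mean ν w := by
    intro k hk
    simp only [topArms, Finset.mem_filter, Finset.mem_univ, true_and, not_lt] at hk
    have hlt : (⟨M - 1, by omega⟩ : Fin K) < (armOrder (mean ν)).symm k := by
      rw [Fin.lt_def]; simp only; omega
    have := armOrder_strictAnti hinj hlt
    rwa [Equiv.apply_symm_apply] at this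
  have h1 : ∀ᶠ δ in 𝓝[>] (0 : ℝ), ∀ k, k ∈ topArms (mean ν) M → k ≠ w →
      mean ν w + 2 * δ ≤ mean ν k := by
    refine eventually_all.2 fun k => ?_
    by_cases h : k ∈ topArms (mean ν) M ∧ k ≠ w
    · filter_upwards [eventually_const_mul_lt (sub_pos.2 (htop k h.1 h.2)) 2] with δ hδ _ _
      linarith
    · exact Eventually.of_forall fun δ h1 h2 => absurd ⟨h1, h2⟩ h
  have h2 : ∀ᶠ δ in 𝓝[>] (0 : ℝ), ∀ k, k ∉ topArms (mean ν) M →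
      mean ν k + 2 * δ ≤ mean ν w := by
    refine eventually_all.2 fun k => ?_
    by_cases h : k ∈ topArms (mean ν) M
    · exact Eventually.of_forall fun δ h1 => absurd h h1
    · filter_upwards [eventually_const_mul_lt (sub_pos.2 (hout k h)) 2] with δ hδ _
      linarith
  filter_upwards [h1, h2] with δ h1 h2
  refine ⟨card_topArms hMK, ?_, h1, h2⟩
  simp only [topArms, Finset.mem_filter, Finset.mem_univ, true_and, hw, Equiv.symm_apply_apply]
  omega

theorem neg_one_le_mul_log {x : ℝ} (hx : 0 ≤ x) : -1 ≤ x * Real.log x := by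
  have := sub_le_mul_log_div hx one_pos
  rw [div_one] at this
  linarith

/-- The divergence between slightly perturbed means is not much smaller. -/
theorem eventually_inv_klr_le {a b : ℝ} (ha : 0 < a) (hab : a < b) (hb : b ≤ 1) :
    ∀ᶠ δ in 𝓝[>] (0 : ℝ), 0 < klr (a + δ) (b - δ) ∧
      (klr (a + δ) (b - δ))⁻¹ ≤ ((kl a b)⁻¹).toReal + 1 / 2 := by
  have hpos : ∀ᶠ δ in 𝓝[>] (0 : ℝ), 0 < klr (a + δ) (b - δ) := by
    filter_upwards [eventually_const_mul_lt (sub_pos.2 hab) 2, self_mem_nhdsWithin] with δ h1 h2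
    have h2 : 0 < δ := h2
    exact klr_pos (by linarith) (by linarith) (by linarith) (by linarith) (by linarith)
  refine hpos.and ?_
  rcases hb.eq_or_lt with rfl | hb1
  -- When `b = 1` the divergence is infinite and its inverse zero, so it suffices that the perturbed
  -- divergence be at least `2`. The cross-entropy term is at least `4` once `-log δ ≥ 8/(1 - a)`,
  -- and the two entropy terms lose at most `1` each.
  · have hlog : Tendsto (fun δ : ℝ => -Real.log δ) (𝓝[>] 0) atTop :=
      tendsto_neg_atBot_atTop.comp Real.tendsto_log_nhdsGT_zero
    filter_upwards [eventually_const_mul_lt (sub_pos.2 hab) 2, self_mem_nhdsWithin,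
      hlog.eventually_ge_atTop (8 / (1 - a))] with δ h1 h2 h3
    have h2 : 0 < δ := h2
    have h4 : 2 ≤ klr (a + δ) (1 - δ) := by
      rw [klr_eq (a + δ) (by linarith) (by linarith)]
      have h5 := neg_one_le_mul_log (by linarith : 0 ≤ a + δ)
      have h6 := neg_one_le_mul_log (by linarith : 0 ≤ 1 - (a + δ))
      have h7 : Real.log (1 - δ) ≤ 0 := Real.log_nonpos (by linarith) (by linarith)
      have h8 : (a + δ) * Real.log (1 - δ) ≤ 0 :=
        mul_nonpos_of_nonneg_of_nonpos (by linarith) h7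
      have h9 : (1 - a) / 2 * (8 / (1 - a)) ≤ (1 - (a + δ)) * -Real.log δ := by
        refine mul_le_mul (by linarith) h3 ?_ (by linarith)
        exact div_nonneg (by norm_num) (by linarith)
      have h10 : (1 - a) / 2 * (8 / (1 - a)) = 4 := by
        have : 1 - a ≠ 0 := by linarith
        field_simp; norm_num
      rw [show 1 - (1 - δ) = δ by ring]
      linarith
    have h5 : (klr (a + δ) (1 - δ))⁻¹ ≤ 2⁻¹ := inv_anti₀ (by norm_num) h4
    have h6 : 0 ≤ ((kl a 1)⁻¹).toReal := ENNReal.toReal_nonneg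
    have h7 : (2 : ℝ)⁻¹ = 1 / 2 := by norm_num
    linarith
  · have hb0 : 0 < b := ha.trans hab
    have hkl : ((kl a b)⁻¹).toReal = (klr a b)⁻¹ := by
      rw [kl_eq_ofReal hb0 hb1, ENNReal.toReal_inv,
        ENNReal.toReal_ofReal (klr_nonneg ha.le (hab.trans hb1).le hb0 hb1)]
    have hklpos : 0 < klr a b := klr_pos ha.le (hab.trans hb1).le hb0 hb1 hab.ne
    have hcont : ContinuousAt (fun δ : ℝ => (klr (a + δ) (b - δ))⁻¹) 0 := by
      have h1 : ContinuousAt (fun δ : ℝ => klr (a + δ) (b - δ)) 0 := by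
        unfold klr
        have hA : ContinuousAt (fun δ : ℝ => Real.log ((a + δ) / (b - δ))) 0 := by
          refine ContinuousAt.log (ContinuousAt.div (by fun_prop) (by fun_prop) ?_) ?_
          · simpa using hb0.ne'
          · simpa using ⟨ha.ne', hb0.ne'⟩
        have hB : ContinuousAt (fun δ : ℝ => Real.log ((1 - (a + δ)) / (1 - (b - δ)))) 0 := by
          refine ContinuousAt.log (ContinuousAt.div (by fun_prop) (by fun_prop) ?_) ?_
          · simp only [sub_zero]; linarith
          · simp only [sub_zero, add_zero]
            exact (div_pos (by linarith) (by linarith)).ne'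
        have hC : ContinuousAt (fun δ : ℝ => a + δ) 0 := by fun_prop
        have hD : ContinuousAt (fun δ : ℝ => 1 - (a + δ)) 0 := by fun_prop
        exact (hC.mul hA).add (hD.mul hB)
      refine h1.inv₀ ?_
      simpa using hklpos.ne'
    have hlim : Tendsto (fun δ : ℝ => (klr (a + δ) (b - δ))⁻¹) (𝓝[>] 0) (𝓝 (klr a b)⁻¹) := by
      have := hcont.tendsto
      simp only [add_zero, sub_zero] at this
      exact this.mono_left nhdsWithin_le_nhds
    rw [hkl]
    filter_upwards [hlim.eventually (gt_mem_nhds (by linarith :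
      (klr a b)⁻¹ < (klr a b)⁻¹ + 1 / 2))] with δ h
    exact h.le

end Accuracy

/-! ## Domination of expectations -/

section Dominated

variable {Ω : Type*} [MeasurableSpace Ω] (μ : Measure Ω) [IsProbabilityMeasure μ]

/-- The expectation of `f` is at most `c`, without measurability. -/
def Dominated (f : Ω → ℝ) (c : ℝ) : Prop :=
  ∃ g : Ω → ℝ, Integrable g μ ∧ (∀ ω, f ω ≤ g ω) ∧ ∫ ω, g ω ∂μ ≤ c

variable {μ}

theorem Dominated.const (c : ℝ) : Dominated μ (fun _ => c) c :=
  ⟨fun _ => c, integrable_const c, fun _ => le_rfl, by simp⟩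

theorem Dominated.add {f g : Ω → ℝ} {c d : ℝ} (hf : Dominated μ f c) (hg : Dominated μ g d) :
    Dominated μ (fun ω => f ω + g ω) (c + d) := by
  obtain ⟨f', h1, h2, h3⟩ := hf
  obtain ⟨g', h4, h5, h6⟩ := hg
  refine ⟨fun ω => f' ω + g' ω, h1.add h4, fun ω => add_le_add (h2 ω) (h5 ω), ?_⟩
  rw [integral_add h1 h4]
  exact add_le_add h3 h6

theorem Dominated.const_mul {f : Ω → ℝ} {c : ℝ} (hf : Dominated μ f c) {a : ℝ} (ha : 0 ≤ a) :
    Dominated μ (fun ω => a * f ω) (a * c) := by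
  obtain ⟨f', h1, h2, h3⟩ := hf
  refine ⟨fun ω => a * f' ω, h1.const_mul a, fun ω => mul_le_mul_of_nonneg_left (h2 ω) ha, ?_⟩
  rw [integral_const_mul]
  exact mul_le_mul_of_nonneg_left h3 ha

theorem Dominated.sum {ι : Type*} (s : Finset ι) {f : ι → Ω → ℝ} {c : ι → ℝ}
    (h : ∀ i ∈ s, Dominated μ (f i) (c i)) :
    Dominated μ (fun ω => ∑ i ∈ s, f i ω) (∑ i ∈ s, c i) := by
  induction s using Finset.induction_on with
  | empty => simpa using Dominated.const (μ := μ) 0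
  | insert a s ha ih =>
    simp only [Finset.sum_insert ha]
    exact (h a (Finset.mem_insert_self a s)).add
      (ih fun i hi => h i (Finset.mem_insert_of_mem hi))

/-- A measurable hull has the same measure, so the bad events never have to be proved measurable. -/
theorem Dominated.indicator {S : Set Ω} {c : ℝ} (hS : μ.real S ≤ c) :
    Dominated μ (S.indicator fun _ => 1) c := by
  refine ⟨(toMeasurable μ S).indicator fun _ => 1,
    (integrable_const 1).indicator (measurableSet_toMeasurable μ S), fun ω => ?_, ?_⟩
  · exact Set.indicator_le_indicator_of_subset (subset_toMeasurable μ S) (fun _ => zero_le_one) ω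
  · have := integral_indicator_one (μ := μ) (measurableSet_toMeasurable μ S)
    have h2 : μ.real (toMeasurable μ S) = μ.real S := by
      simp only [Measure.real, measure_toMeasurable]
    calc _ = μ.real (toMeasurable μ S) := this
      _ ≤ c := h2 ▸ hS

theorem Dominated.mono {f f' : Ω → ℝ} {c c' : ℝ} (hf : Dominated μ f c) (h : ∀ ω, f' ω ≤ f ω)
    (hc : c ≤ c') : Dominated μ f' c' := by
  obtain ⟨g, h1, h2, h3⟩ := hf
  exact ⟨g, h1, fun ω => (h ω).trans (h2 ω), h3.trans hc⟩

theorem Dominated.integral_le {f f' : Ω → ℝ} {c : ℝ} (hf : Dominated μ f c) (hi : Integrable f' μ)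
    (h : ∀ᵐ ω ∂μ, f' ω ≤ f ω) : ∫ ω, f' ω ∂μ ≤ c := by
  obtain ⟨g, h1, h2, h3⟩ := hf
  exact (integral_mono_ae hi h1 (h.mono fun ω hω => hω.trans (h2 ω))).trans h3

end Dominated

end MMAB

end

noncomputable section

set_option linter.unusedSectionVars false

namespace MMAB

open MeasureTheory Filter Topology

/-! ## Expected numbers of deviations -/

section Expectations

variable {K M : ℕ} [NeZero K] (ν : Fin K → Measure I) [∀ k, IsProbabilityMeasure (ν k)]

theorem sum_measureReal_le {Ω : Type*} [MeasurableSpace Ω] {μ : Measure Ω}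
    [IsProbabilityMeasure μ] {s : Finset ℕ} {S : ℕ → Set Ω} {a : ℝ} (ha : 0 < a)
    (h : ENNReal.ofReal a * ∑ t ∈ s, μ (S t) ≤ 1) : ∑ t ∈ s, μ.real (S t) ≤ a⁻¹ := by
  have h1 : ∑ t ∈ s, μ.real (S t) = (∑ t ∈ s, μ (S t)).toReal :=
    (ENNReal.toReal_sum fun t _ => measure_ne_top μ (S t)).symm
  have h2 := ENNReal.toReal_mono ENNReal.one_ne_top h
  rw [ENNReal.toReal_mul, ENNReal.toReal_ofReal ha.le, ENNReal.toReal_one, ← h1] at h2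
  rwa [← one_div, le_div_iff₀' ha]

/-- Rate of decay of the deviations of the empirical means. -/
def devRate (δ : ℝ) : ℝ := 1 - Real.exp (-(δ ^ 2 / 4))

theorem devRate_pos {δ : ℝ} (hδ : 0 < δ) : 0 < devRate δ := by
  have : Real.exp (-(δ ^ 2 / 4)) < 1 := Real.exp_lt_one_iff.2 (by have := pow_pos hδ 2; linarith)
  unfold devRate
  linarith

/-- Arm `k` is pulled by `j` although its empirical mean is too large. -/
def overSet (T : ℕ) (δ : ℝ) (j : Fin M) (k : Fin K) (t : ℕ) : Set (Outcome K M) :=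
  {ω | action (play K M T) ω t j = k ∧
    1 ≤ pot (play K M T) (devWeight (mean ν k) δ 1) j k t ω}

theorem sum_overSet_le (T : ℕ) {δ : ℝ} (hδ0 : 0 < δ) (hδ : δ ≤ 1) (j : Fin M) (k : Fin K) (n : ℕ) :
    ∑ t ∈ Finset.range n, (law M ν).real (overSet ν T δ j k t) ≤ (devRate δ)⁻¹ :=
  sum_measureReal_le (devRate_pos hδ0) (sum_measure_pull_le ν (measurable_action T)
    (measurable_play_seed T) (measurable_devWeight _ _ _) j k
    (lintegral_devWeight ν k hδ0 hδ (Or.inl rfl)) n)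

theorem sum_hitSet_le (T : ℕ) {δ ε : ℝ} (hδ0 : 0 < δ) (hδ : δ ≤ 1) (hε : ε = 1 ∨ ε = -1)
    (j : Fin M) (k : Fin K) (n : ℕ) :
    ∑ t ∈ Finset.range n, (law M ν).real (hitSet ν T δ ε j k t) ≤ 2 * K * (devRate δ)⁻¹ := by
  have hK : (0 : ℝ) < K := by exact_mod_cast NeZero.pos K
  have hpos := devRate_pos hδ0
  have h := sum_measure_hit_le ν (measurable_action T) (measurable_play_seed T)
    (measurable_devWeight (mean ν k) δ ε) j k (lintegral_devWeight ν k hδ0 hδ hε)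
    (measurable_pullProb T j k) (ENNReal.ofReal (1 / (2 * K))) n
  change ENNReal.ofReal (devRate δ) * _ * _ ≤ 1 at h
  rw [← ENNReal.ofReal_mul hpos.le] at h
  refine (sum_measureReal_le (by positivity) h).trans_eq ?_
  field_simp

/-- The intermediate point `mean - δ/2` provides the gap required by `measure_underEst_le` and stays
below `1` even for an arm of mean `1`. The constant does not depend on `T`, so it can be fixed
before the horizon. -/
theorem exists_underEst_le {δ : ℝ} (hδ : 0 < δ) (hμ : ∀ k, δ < mean ν k) :
    ∃ c : ℝ, 0 ≤ c ∧ ∀ (T : ℕ) (j : Fin M) (k : Fin K) (n : ℕ) (f : ℝ), 0 < f →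
      (law M ν).real {ω | UnderEst (play K M T) ω j k n f (mean ν k - δ)}
        ≤ Real.exp (-f) * c := by
  have hterm : ∀ k, 0 ≤ (1 - Real.exp (-klr (mean ν k - δ) (mean ν k - δ / 2)))⁻¹ := by
    intro k
    have h1 := (mean_mem ν k).2
    have h2 := hμ k
    have : 0 ≤ klr (mean ν k - δ) (mean ν k - δ / 2) :=
      klr_nonneg (by linarith) (by linarith) (by linarith) (by linarith)
    exact inv_nonneg.2 (sub_nonneg.2 (Real.exp_le_one_iff.2 (by linarith)))
  refine ⟨∑ k, (1 - Real.exp (-klr (mean ν k - δ) (mean ν k - δ / 2)))⁻¹,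
    Finset.sum_nonneg fun k _ => hterm k, fun T j k n f hf => ?_⟩
  have h1 := (mean_mem ν k).2
  have h2 := hμ k
  have h := measure_underEst_le ν (measurable_action T) (measurable_play_seed T) j k
    (c := mean ν k - δ) (p := mean ν k - δ / 2) (by linarith) (by linarith) (by linarith)
    (by linarith) hf n
  have h3 := ENNReal.toReal_mono ENNReal.ofReal_ne_top h
  rw [ENNReal.toReal_ofReal (mul_nonneg (Real.exp_pos _).le (hterm k))] at h3
  exact h3.trans (mul_le_mul_of_nonneg_left
    (Finset.single_le_sum (fun k _ => hterm k) (Finset.mem_univ k)) (Real.exp_pos _).le)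

variable {ν}

/-- Every round of the block of `t` is less than `M` away from `t`, so it has the form `t + d - M`
with `d < 2M`. Fixed shifts let the sum over `t` be bounded by the global sums of hits. -/
theorem measureReal_badBlock_le (hM : 1 ≤ M) (T : ℕ) (δ : ℝ) (j : Fin M) (t : ℕ) :
    (law M ν).real {ω | BadBlock ν T δ j (blockStart M t) ω}
      ≤ ∑ d ∈ Finset.range (2 * M), ∑ k, ((law M ν).real (hitSet ν T δ 1 j k (t + d - M))
          + (law M ν).real (hitSet ν T δ (-1) j k (t + d - M)))
        + ∑ k, (law M ν).real {ω | UnderEst (play K M T) ω j k (blockStart M t - 1)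
            (explorationThreshold (blockStart M t)) (mean ν k - δ)} := by
  have hsub : {ω | BadBlock ν T δ j (blockStart M t) ω}
      ⊆ (⋃ d ∈ Finset.range (2 * M), ⋃ k ∈ Finset.univ,
          (hitSet ν T δ 1 j k (t + d - M) ∪ hitSet ν T δ (-1) j k (t + d - M)))
        ∪ ⋃ k ∈ Finset.univ, {ω | UnderEst (play K M T) ω j k (blockStart M t - 1)
            (explorationThreshold (blockStart M t)) (mean ν k - δ)} := by
    intro ω hω
    have h1 := blockStart_le M t
    have h2 := lt_blockStart_add hM t
    rcases hω with ⟨t', h3, h4, k, h5⟩ | ⟨k, h3⟩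
    · left
      refine Set.mem_biUnion (x := t' + M - t) (by simp only [Finset.coe_range, Set.mem_Iio]; omega)
        (Set.mem_biUnion (x := k) (by simp) ?_)
      have : t + (t' + M - t) - M = t' := by omega
      rw [this]
      exact h5
    · exact Or.inr (Set.mem_biUnion (x := k) (by simp) h3)
  refine (measureReal_mono hsub).trans ((measureReal_union_le _ _).trans (add_le_add ?_ ?_))
  · refine (measureReal_biUnion_finset_le _ _).trans (Finset.sum_le_sum fun d _ => ?_)
    exact (measureReal_biUnion_finset_le _ _).trans
      (Finset.sum_le_sum fun k _ => measureReal_union_le _ _)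
  · exact measureReal_biUnion_finset_le _ _

/-- The condition `m ≤ a` keeps the truncated subtraction injective on the range of summation. -/
theorem sum_shift_le {g : ℕ → ℝ} (hg : ∀ t, 0 ≤ g t) {a m : ℕ} (hm : m ≤ a) (d n : ℕ) :
    ∑ t ∈ Finset.Ico a n, g (t + d - m) ≤ ∑ t ∈ Finset.range (n + d), g t := by
  rw [← Finset.sum_image (f := g) (g := fun t => t + d - m) (s := Finset.Ico a n)]
  · refine Finset.sum_le_sum_of_subset_of_nonneg ?_ fun t _ _ => hg t
    intro i hi
    obtain ⟨t, ht, rfl⟩ := Finset.mem_image.1 hi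
    rw [Finset.mem_Ico] at ht
    exact Finset.mem_range.2 (by omega)
  · intro t ht t' ht' h
    simp only [Finset.coe_Ico, Set.mem_Ico] at ht ht' h
    omega

/-- The deviations of the indices are rarer than any multiple of `1 / b`. -/
theorem eventually_exp_neg_explorationThreshold_le {η : ℝ} (hη : 0 < η) :
    ∀ᶠ b : ℕ in atTop, 0 < explorationThreshold b ∧
      Real.exp (-explorationThreshold b) ≤ η / b := by
  have hlog : Tendsto (fun b : ℕ => Real.log b) atTop atTop :=
    Real.tendsto_log_atTop.comp tendsto_natCast_atTop_atTop
  filter_upwards [hlog.eventually_ge_atTop (max 1 η⁻¹), eventually_ge_atTop 1] with b h1 hb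
  have hb0 : (0 : ℝ) < b := by exact_mod_cast hb
  have h2 : 1 ≤ Real.log b := (le_max_left _ _).trans h1
  have h3 : η⁻¹ ≤ Real.log b := (le_max_right _ _).trans h1
  have h4 : 0 ≤ Real.log (Real.log b) := Real.log_nonneg h2
  have h5 : 0 < explorationThreshold b := by unfold explorationThreshold; linarith
  refine ⟨h5, ?_⟩
  have h6 : Real.exp (explorationThreshold b) = b * Real.log b ^ 4 := by
    unfold explorationThreshold
    rw [Real.exp_add, Real.exp_log hb0, mul_comm 4, ← Real.rpow_def_of_pos (by linarith)]
    norm_cast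
  -- One factor `log b` of `exp f(b) = b (log b)⁴` already beats `1/η`. Summability is not needed,
  -- since a small multiple of `log T` is affordable.
  have h7 : Real.log b ≤ Real.log b ^ 4 := le_self_pow₀ h2 (by norm_num)
  rw [Real.exp_neg, h6, mul_inv, div_eq_mul_inv, mul_comm η]
  refine mul_le_mul_of_nonneg_left ?_ (inv_nonneg.2 hb0.le)
  rw [inv_le_comm₀ (by positivity) hη]
  exact h3.trans h7

/-- From round `2M` on, the start of the block is at least half the current round, and the sum is
dominated by `2η` times a harmonic sum. -/
theorem sum_exp_neg_explorationThreshold_le (hM : 1 ≤ M) {η : ℝ} (hη : 0 < η) {N a n : ℕ}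
    (hN : ∀ b : ℕ, N ≤ b → Real.exp (-explorationThreshold b) ≤ η / b) (ha : N + 2 * M ≤ a) :
    ∑ t ∈ Finset.Ico a n, Real.exp (-explorationThreshold (blockStart M t))
      ≤ 2 * η * (1 + Real.log n) := by
  have h1 : ∀ t ∈ Finset.Ico a n, Real.exp (-explorationThreshold (blockStart M t))
      ≤ 2 * η * ((t + 1 : ℕ) : ℝ)⁻¹ := by
    intro t ht
    rw [Finset.mem_Ico] at ht
    have h2 := lt_blockStart_add hM t
    refine (hN _ (by omega)).trans ?_
    have h3 : ((t + 1 : ℕ) : ℝ) ≤ 2 * (blockStart M t : ℝ) := by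
      exact_mod_cast (by omega : t + 1 ≤ 2 * blockStart M t)
    have h4 : (0 : ℝ) < (t + 1 : ℕ) := by positivity
    rw [div_le_iff₀ (by linarith), mul_assoc, mul_comm 2, mul_assoc]
    refine le_mul_of_one_le_right hη.le ?_
    rw [inv_mul_eq_div, ← mul_div_assoc, le_div_iff₀ h4]
    linarith
  refine (Finset.sum_le_sum h1).trans ?_
  rw [← Finset.mul_sum]
  refine mul_le_mul_of_nonneg_left ?_ (by positivity)
  have h2 := harmonic_le_one_add_log n
  unfold harmonic at h2
  push_cast at h2 ⊢
  refine le_trans (Finset.sum_le_sum_of_subset_of_nonneg ?_ fun i _ _ => by positivity) h2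
  intro i hi
  rw [Finset.mem_Ico] at hi
  exact Finset.mem_range.2 hi.2

/-- There are `2M` shifts, `K` arms and two signs, each contributing at most `2K` times the inverse
rate. The under-estimations add the part proportional to `η`. -/
theorem sum_badBlock_le (hM : 1 ≤ M) (T : ℕ) {δ c η : ℝ} (hδ0 : 0 < δ) (hδ : δ ≤ 1) (hη : 0 < η)
    (hc0 : 0 ≤ c) (hc : ∀ (j : Fin M) (k : Fin K) (n : ℕ) (f : ℝ), 0 < f →
      (law M ν).real {ω | UnderEst (play K M T) ω j k n f (mean ν k - δ)} ≤ Real.exp (-f) * c)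
    {N a n : ℕ} (hN : ∀ b : ℕ, N ≤ b → 0 < explorationThreshold b ∧
      Real.exp (-explorationThreshold b) ≤ η / b) (ha : N + 2 * M ≤ a) (j : Fin M) :
    ∑ t ∈ Finset.Ico a n, (law M ν).real {ω | BadBlock ν T δ j (blockStart M t) ω}
      ≤ 8 * M * K ^ 2 * (devRate δ)⁻¹ + K * c * (2 * η * (1 + Real.log n)) := by
  refine (Finset.sum_le_sum fun t _ => measureReal_badBlock_le hM T δ j t).trans ?_
  rw [Finset.sum_add_distrib]
  refine add_le_add ?_ ?_
  · rw [Finset.sum_comm]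
    have h1 : ∀ d ∈ Finset.range (2 * M), ∑ t ∈ Finset.Ico a n, ∑ k,
        ((law M ν).real (hitSet ν T δ 1 j k (t + d - M))
          + (law M ν).real (hitSet ν T δ (-1) j k (t + d - M)))
        ≤ K * (2 * K * (devRate δ)⁻¹ + 2 * K * (devRate δ)⁻¹) := by
      intro d _
      rw [Finset.sum_comm]
      have h2 : ∀ k ∈ (Finset.univ : Finset (Fin K)), ∑ t ∈ Finset.Ico a n,
          ((law M ν).real (hitSet ν T δ 1 j k (t + d - M))
            + (law M ν).real (hitSet ν T δ (-1) j k (t + d - M)))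
          ≤ 2 * K * (devRate δ)⁻¹ + 2 * K * (devRate δ)⁻¹ := by
        intro k _
        rw [Finset.sum_add_distrib]
        refine add_le_add ?_ ?_
        · exact (sum_shift_le (g := fun t => (law M ν).real (hitSet ν T δ 1 j k t))
            (fun _ => measureReal_nonneg) (by omega) d n).trans
            (sum_hitSet_le ν T hδ0 hδ (Or.inl rfl) j k _)
        · exact (sum_shift_le (g := fun t => (law M ν).real (hitSet ν T δ (-1) j k t))
            (fun _ => measureReal_nonneg) (by omega) d n).trans
            (sum_hitSet_le ν T hδ0 hδ (Or.inr rfl) j k _)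
      refine (Finset.sum_le_sum h2).trans_eq ?_
      rw [Finset.sum_const, Finset.card_univ, Fintype.card_fin, nsmul_eq_mul]
    refine (Finset.sum_le_sum h1).trans_eq ?_
    simp only [Finset.sum_const, Finset.card_range, nsmul_eq_mul, Nat.cast_mul, Nat.cast_ofNat]
    ring
  · have h1 : ∀ t ∈ Finset.Ico a n, ∑ k, (law M ν).real {ω | UnderEst (play K M T) ω j k
        (blockStart M t - 1) (explorationThreshold (blockStart M t)) (mean ν k - δ)}
        ≤ K * c * Real.exp (-explorationThreshold (blockStart M t)) := by
      intro t ht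
      rw [Finset.mem_Ico] at ht
      have h2 := lt_blockStart_add hM t
      refine (Finset.sum_le_sum fun k _ => hc j k _ _ (hN _ (by omega)).1).trans_eq ?_
      simp only [Finset.sum_const, Finset.card_univ, Fintype.card_fin, nsmul_eq_mul]
      ring
    refine (Finset.sum_le_sum h1).trans ?_
    rw [← Finset.mul_sum]
    exact mul_le_mul_of_nonneg_left
      (sum_exp_neg_explorationThreshold_le hM hη (fun b hb => (hN b hb).2) ha) (by positivity)

end Expectations

/-! ## Pathwise bound on the regret -/

section Pathwise

variable {K M : ℕ} [NeZero K] {ν : Fin K → Measure I} [∀ k, IsProbabilityMeasure (ν k)]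
  {T : ℕ} {ω : Outcome K M}

theorem sum_ite_pulls_le (s : Fin M → Strategy K) (ω : Outcome K M) (j : Fin M) (k : Fin K)
    (n₀ : ℕ) (S : Finset ℕ) (hS : S ⊆ Finset.range T) :
    ∑ t ∈ S, (if action s ω t j = k ∧ cnt s ω j k t < n₀ then (1 : ℝ) else 0) ≤ n₀ := by
  rw [Finset.sum_boole]
  exact_mod_cast (Finset.card_le_card (Finset.filter_subset_filter _ hS)).trans
    (card_pulls_lt s ω j k n₀ T)

theorem pay_nonneg (a : Fin M → Fin K) (j : Fin M) :
    0 ≤ mean ν (a j) * (1 - collision a (a j)) := by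
  have := (mean_mem ν (a j)).1
  rcases collision_mem a (a j) with h | h <;> simp [h, this]

/-- Regret of round `t + 1`. -/
def roundRegret (ν : Fin K → Measure I) (s : Fin M → Strategy K) (ω : Outcome K M) (t : ℕ) : ℝ :=
  ∑ k ∈ topArms (mean ν) M, mean ν k
    - ∑ j, mean ν (action s ω t j) * (1 - collision (action s ω t) (action s ω t j))

theorem regret_eq (hMK : M ≤ K) (s : Fin M → Strategy K) :
    regret ν s T ω = ∑ t ∈ Finset.range T, roundRegret ν s ω t := by
  unfold regret roundRegret
  rw [sum_Icc_ordMean hMK, Finset.sum_sub_distrib, Finset.sum_const, Finset.card_range,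
    nsmul_eq_mul]

theorem roundRegret_le (hMK : M ≤ K) (s : Fin M → Strategy K) (t : ℕ) :
    roundRegret ν s ω t ≤ M := by
  have h1 : ∑ k ∈ topArms (mean ν) M, mean ν k ≤ M := by
    refine (Finset.sum_le_sum fun k _ => (mean_mem ν k).2).trans_eq ?_
    simp [card_topArms hMK]
  have h2 : 0 ≤ ∑ j, mean ν (action s ω t j) * (1 - collision (action s ω t) (action s ω t j)) :=
    Finset.sum_nonneg fun j _ => pay_nonneg _ _
  unfold roundRegret
  linarith

/-- The first `τ + M + 1` rounds, after which every current block starts beyond `τ`, are charged `M`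
each, and so is each round in which some player has a bad block. In the other rounds each suboptimal
pull is charged either to the first `n₀ k` pulls of the arm or to an upward deviation. -/
theorem regret_le_of_exploring {r : Fin M → ℕ} {τ : ℕ} (hinj : Function.Injective r)
    (hr : ∀ j, r j < M) (h : ∀ j, Exploring T ω j (r j) τ) (hM : 1 ≤ M) (hMK : M ≤ K)
    (hseed : ∀ t j, ((ω t).2 j : ℝ) < 1) {δ : ℝ} (hδ : 0 < δ) (hμ : ∀ k, δ < mean ν k)
    {w : Fin K} (htop : IsTop ν M (topArms (mean ν) M) w δ) {n₀ : Fin K → ℕ} {F : ℝ}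
    (hf : ∀ t, τ + M + 1 ≤ t → t < T → 0 ≤ explorationThreshold (blockStart M t) ∧
      explorationThreshold (blockStart M t) ≤ F)
    (hn : ∀ k, k ∉ topArms (mean ν) M → F < n₀ k * klr (mean ν k + δ) (mean ν w - δ))
    (hκ : ∀ k, k ∉ topArms (mean ν) M → 0 < klr (mean ν k + δ) (mean ν w - δ)) :
    regret ν (play K M T) T ω ≤ M * (τ + M + 1)
      + M * ∑ t ∈ Finset.Ico (τ + M + 1) T, ∑ j,
          {ω | BadBlock ν T δ j (blockStart M t) ω}.indicator (fun _ => (1 : ℝ)) ω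
      + ∑ j, ∑ k ∈ (topArms (mean ν) M)ᶜ, (mean ν w - mean ν k) * (n₀ k
          + ∑ t ∈ Finset.range T, (overSet ν T δ j k t).indicator (fun _ => (1 : ℝ)) ω) := by
  set top := topArms (mean ν) M with htopdef
  have hgap : ∀ k ∈ topᶜ, 0 ≤ mean ν w - mean ν k := by
    intro k hk
    have := htop.gap_out k (Finset.mem_compl.1 hk)
    linarith
  have hind : ∀ (S : Set (Outcome K M)), 0 ≤ S.indicator (fun _ => (1 : ℝ)) ω :=
    fun S => Set.indicator_nonneg (fun _ _ => zero_le_one) ω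
  let few : Fin M → Fin K → ℕ → ℝ := fun j k t =>
    if action (play K M T) ω t j = k ∧ cnt (play K M T) ω j k t < n₀ k then 1 else 0
  have hfew : ∀ j k t, 0 ≤ few j k t := fun j k t => by
    simp only [few]; split_ifs <;> norm_num
  have hround : ∀ t ∈ Finset.Ico (τ + M + 1) T, roundRegret ν (play K M T) ω t
      ≤ M * ∑ j, {ω | BadBlock ν T δ j (blockStart M t) ω}.indicator (fun _ => (1 : ℝ)) ω
        + ∑ j, ∑ k ∈ topᶜ, (mean ν w - mean ν k) *
          (few j k t + (overSet ν T δ j k t).indicator (fun _ => (1 : ℝ)) ω) := by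
    intro t ht
    rw [Finset.mem_Ico] at ht
    have hlt := lt_blockStart_add hM t
    have hrest : ∀ j : Fin M, ∀ k ∈ topᶜ, 0 ≤ (mean ν w - mean ν k) *
        (few j k t + (overSet ν T δ j k t).indicator (fun _ => (1 : ℝ)) ω) := fun j k hk =>
      mul_nonneg (hgap k hk) (add_nonneg (hfew j k t) (hind _))
    by_cases hbad : ∃ j, BadBlock ν T δ j (blockStart M t) ω
    · obtain ⟨j, hj⟩ := hbad
      have h1 : (1 : ℝ) ≤ ∑ j, {ω | BadBlock ν T δ j (blockStart M t) ω}.indicator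
          (fun _ => (1 : ℝ)) ω := by
        have h2 := Finset.single_le_sum (f := fun j => {ω | BadBlock ν T δ j (blockStart M t)
          ω}.indicator (fun _ => (1 : ℝ)) ω) (fun j _ => hind _) (Finset.mem_univ j)
        have h3 : {ω | BadBlock ν T δ j (blockStart M t) ω}.indicator (fun _ => (1 : ℝ)) ω = 1 :=
          Set.indicator_of_mem (by exact hj) _
        simp only [h3] at h2
        exact h2
      have h2 := roundRegret_le (ν := ν) (ω := ω) hMK (play K M T) t
      have h3 : (M : ℝ) ≤ M * ∑ j, {ω | BadBlock ν T δ j (blockStart M t) ω}.indicator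
          (fun _ => (1 : ℝ)) ω := le_mul_of_one_le_right (Nat.cast_nonneg _) h1
      have h4 := Finset.sum_nonneg fun j (_ : j ∈ (Finset.univ : Finset (Fin M))) =>
        Finset.sum_nonneg (hrest j)
      linarith
    · push Not at hbad
      have h1 := round_regret_eq hinj hr h hM hMK hseed (t := t) (by omega) hδ hμ htop hbad
      have h2 : roundRegret ν (play K M T) ω t = _ := h1
      rw [h2]
      refine le_add_of_nonneg_of_le (mul_nonneg (Nat.cast_nonneg _)
        (Finset.sum_nonneg fun j _ => hind _)) ?_
      refine Finset.sum_le_sum fun j _ => Finset.sum_le_sum fun k hk => ?_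
      by_cases hact : action (play K M T) ω t j = k
      · rw [if_pos hact]
        refine le_mul_of_one_le_right (hgap k hk) ?_
        have hk' := Finset.mem_compl.1 hk
        obtain ⟨h3, h4⟩ := hf t ht.1 ht.2
        rcases (h j).suboptimal_pull hM hMK hseed (t := t) (by omega) hδ hμ htop (hbad j) hk' hact
          h3 with h5 | h5
        · have h6 : (cnt (play K M T) ω j k t : ℝ) < n₀ k :=
            lt_of_mul_lt_mul_right ((h5.trans h4).trans_lt (hn k hk')) (hκ k hk').le
          have h7 : few j k t = 1 := if_pos ⟨hact, by exact_mod_cast h6⟩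
          rw [h7]
          linarith [hind (overSet ν T δ j k t)]
        · have h7 : (overSet ν T δ j k t).indicator (fun _ => (1 : ℝ)) ω = 1 :=
            Set.indicator_of_mem (by exact ⟨hact, h5⟩) _
          rw [h7]
          linarith [hfew j k t]
      · rw [if_neg hact]
        exact hrest j k hk
  have hsplit : regret ν (play K M T) T ω
      ≤ M * (τ + M + 1) + ∑ t ∈ Finset.Ico (τ + M + 1) T, roundRegret ν (play K M T) ω t := by
    rw [regret_eq hMK]
    have h1 : Finset.range T = (Finset.range T).filter (· < τ + M + 1)
        ∪ Finset.Ico (τ + M + 1) T := by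
      ext t
      simp only [Finset.mem_union, Finset.mem_filter, Finset.mem_range, Finset.mem_Ico]
      omega
    rw [h1, Finset.sum_union]
    · refine add_le_add ?_ le_rfl
      refine (Finset.sum_le_sum fun t _ => roundRegret_le hMK (play K M T) t).trans ?_
      rw [Finset.sum_const, nsmul_eq_mul, mul_comm]
      refine mul_le_mul_of_nonneg_left ?_ (Nat.cast_nonneg _)
      have h2 : ((Finset.range T).filter (· < τ + M + 1)).card ≤ τ + M + 1 := by
        refine (Finset.card_le_card (t := Finset.range (τ + M + 1)) ?_).trans_eq
          (Finset.card_range _)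
        intro t ht
        exact Finset.mem_range.2 (Finset.mem_filter.1 ht).2
      exact_mod_cast h2
    · rw [Finset.disjoint_left]
      intro t ht ht'
      have h2 := (Finset.mem_filter.1 ht).2
      have h3 := (Finset.mem_Ico.1 ht').1
      omega
  refine (hsplit.trans (add_le_add le_rfl (Finset.sum_le_sum hround))).trans ?_
  rw [Finset.sum_add_distrib, ← Finset.mul_sum, ← add_assoc]
  refine add_le_add le_rfl ?_
  rw [Finset.sum_comm]
  refine Finset.sum_le_sum fun j _ => ?_
  rw [Finset.sum_comm]
  refine Finset.sum_le_sum fun k hk => ?_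
  rw [← Finset.mul_sum, Finset.sum_add_distrib]
  have hIco : Finset.Ico (τ + M + 1) T ⊆ Finset.range T := fun t ht =>
    Finset.mem_range.2 (Finset.mem_Ico.1 ht).2
  refine mul_le_mul_of_nonneg_left (add_le_add ?_ ?_) (hgap k hk)
  · exact sum_ite_pulls_le _ _ _ _ _ _ hIco
  · exact Finset.sum_le_sum_of_subset_of_nonneg hIco fun t _ _ => hind _

theorem regret_le_mul (hMK : M ≤ K) (s : Fin M → Strategy K) :
    regret ν s T ω ≤ M * T := by
  rw [regret_eq hMK]
  refine (Finset.sum_le_sum fun t _ => roundRegret_le hMK s t).trans_eq ?_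
  rw [Finset.sum_const, Finset.card_range, nsmul_eq_mul, mul_comm]

end Pathwise

/-! ### Integrability of the regret and almost sure range of the seeds -/

section Integrability

variable {K M : ℕ} [NeZero K] (ν : Fin K → Measure I) [∀ k, IsProbabilityMeasure (ν k)]

theorem integrable_regret (T : ℕ) : Integrable (regret ν (play K M T) T) (law M ν) := by
  unfold regret
  refine (integrable_const _).sub (integrable_finsetSum _ fun t _ =>
    integrable_finsetSum _ fun j _ => ?_)
  have hact : Measurable fun ω => action (play K M T) ω t :=
    measurable_pi_lambda _ fun j => measurable_action T t j
  have hg : Measurable fun a : Fin M → Fin K => mean ν (a j) * (1 - collision a (a j)) :=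
    measurable_of_countable _
  refine Integrable.of_bound (hg.comp hact).aestronglyMeasurable 1 (Eventually.of_forall fun ω => ?_)
  rw [Real.norm_eq_abs, abs_of_nonneg (pay_nonneg _ j)]
  have h1 := mean_mem ν (action (play K M T) ω t j)
  rcases collision_mem (action (play K M T) ω t) (action (play K M T) ω t j) with h | h <;> rw [h]
  · simpa using h1.2
  · simp

theorem ae_seeds_lt_one : ∀ᵐ ω ∂(law M ν), ∀ t j, ((ω t).2 j : ℝ) < 1 := by
  refine ae_all_iff.2 fun t => ae_all_iff.2 fun j => ?_
  have h1 : MeasurePreserving (fun ω : Outcome K M => ω t) (law M ν) (roundLaw M ν) :=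
    measurePreserving_eval_infinitePi _ t
  have hA : MeasurableSet {u : I | (u : ℝ) < 1} :=
    measurableSet_lt measurable_subtype_coe measurable_const
  have h2 : ∀ᵐ y ∂(roundLaw M ν), ((y.2 j : I) : ℝ) < 1 := by
    have h3 := roundLaw_seed (M := M) ν j hA.compl
    rw [ae_iff]
    have h4 := ae_iff.1 ae_seed_lt_one
    exact h3.trans h4
  exact h1.quasiMeasurePreserving.ae h2

end Integrability

end MMAB

end

noncomputable section

set_option linter.unusedSectionVars false

namespace MMAB

open MeasureTheory Filter Topology

/-! ## Bound on the expected regret -/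

section Regret

variable {K M : ℕ} [NeZero K] {ν : Fin K → Measure I} [∀ k, IsProbabilityMeasure (ν k)]

theorem explorationThreshold_mono {b n : ℕ} (hb : 3 ≤ b) (h : b ≤ n) :
    explorationThreshold b ≤ explorationThreshold n := by
  have h3 : (3 : ℝ) ≤ b := by exact_mod_cast hb
  have h1 : 0 < Real.log b := Real.log_pos (by linarith)
  have h2 : Real.log b ≤ Real.log n := Real.log_le_log (by linarith) (by exact_mod_cast h)
  have h4 := Real.log_le_log h1 h2
  unfold explorationThreshold
  linarith

variable (T : ℕ) (p : ℝ) (l : Fin K) in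
/-- Failure of the initialization of some player. -/
def initFailure : Set (Outcome K M) :=
  (GoodEst T p l)ᶜ ∪ ⋃ j ∈ (Finset.univ : Finset (Fin M)),
    {ω | ω ∈ GoodEst T p l ∧ ∀ t, NoRank T ω j (tm T ω j) t}

variable {T : ℕ} {p : ℝ} {l : Fin K}

theorem measureReal_initFailure_le (hK : 2 ≤ K) (hM : 1 ≤ M) (hMK : M ≤ K) (hT : 2 ≤ T)
    (hp : 0 < p) (hmin : ∀ k, p ≤ obsProb ν k) (hl : obsProb ν l = p)
    (hL : 1000 ≤ scale p K T) (hup : upperTime p K T + 1 ≤ T) :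
    (law M ν).real (initFailure T p l) ≤ 4 * M * K / (T : ℝ) ^ 2 + M * (1 / T) := by
  have hT0 : (0 : ℝ) < T := by exact_mod_cast (by omega : 0 < T)
  refine (measureReal_union_le _ _).trans (add_le_add ?_ ?_)
  · exact ENNReal.toReal_le_of_le_ofReal (by positivity)
      (measure_goodEst_compl_le ν hK (by omega) hp hmin hl hup)
  · refine (measureReal_biUnion_finset_le _ _).trans ?_
    refine (Finset.sum_le_sum fun j _ => ENNReal.toReal_le_of_le_ofReal (by positivity)
      (measure_noRank_le ν hK hM hMK hT hp hmin hL j)).trans_eq ?_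
    simp

theorem exists_exploring (hK : 2 ≤ K) (hM : 1 ≤ M) (hMK : M ≤ K) (hT : 2 ≤ T)
    (hL : 1000 ≤ scale p K T) {ω : Outcome K M} (hω : ω ∉ initFailure T p l)
    (hseed : ∀ t j, ((ω t).2 j : ℝ) < 1) :
    ∃ r : Fin M → ℕ, Function.Injective r ∧ (∀ j, r j < M) ∧
      ∀ j, Exploring T ω j (r j) ⌊3 / 2 * scale p K T⌋₊ := by
  simp only [initFailure, Set.mem_union, Set.mem_compl_iff, Set.mem_iUnion, Finset.mem_univ,
    exists_prop, true_and, Set.mem_ofPred_eq, not_or, not_not, not_exists, not_and] at hω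
  obtain ⟨hgood, hrank⟩ := hω
  obtain ⟨r, h1, h2, h3⟩ := exists_ranks hK hM hMK hT hL hgood hseed fun j => hrank j hgood
  refine ⟨fun j => (r j).val, fun i j hij => h1 (Fin.ext hij), h2, fun j t ht => h3 j t ?_⟩
  exact (Nat.le_floor (initEnd_le hK hL (tm_bounds hL hgood j).2)).trans ht

/-- On a failed initialization the trivial bound `M * T` is used, and its probability of order `1/T`
makes this a constant; otherwise the pathwise bound applies and its terms are summed in expectation.
All parameters are still free. -/
theorem integral_regret_le (hK : 2 ≤ K) (hM : 1 ≤ M) (hMK : M ≤ K) (hT : 2 ≤ T)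
    (hp : 0 < p) (hmin : ∀ k, p ≤ obsProb ν k) (hl : obsProb ν l = p)
    (hL : 1000 ≤ scale p K T) (hup : upperTime p K T + 1 ≤ T) {δ c η : ℝ} (hδ0 : 0 < δ)
    (hδ : δ ≤ 1) (hμ : ∀ k, δ < mean ν k) (hη : 0 < η) (hc0 : 0 ≤ c)
    (hc : ∀ (j : Fin M) (k : Fin K) (n : ℕ) (f : ℝ), 0 < f →
      (law M ν).real {ω | UnderEst (play K M T) ω j k n f (mean ν k - δ)} ≤ Real.exp (-f) * c)
    {N : ℕ} (hN3 : 3 ≤ N) (hN : ∀ b : ℕ, N ≤ b → 0 < explorationThreshold b ∧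
      Real.exp (-explorationThreshold b) ≤ η / b) (hτ : N + M ≤ ⌊3 / 2 * scale p K T⌋₊)
    {w : Fin K} (htop : IsTop ν M (topArms (mean ν) M) w δ) {n₀ : Fin K → ℕ}
    (hn : ∀ k, k ∉ topArms (mean ν) M →
      explorationThreshold T < n₀ k * klr (mean ν k + δ) (mean ν w - δ))
    (hκ : ∀ k, k ∉ topArms (mean ν) M → 0 < klr (mean ν k + δ) (mean ν w - δ)) :
    ∫ ω, regret ν (play K M T) T ω ∂(law M ν)
      ≤ M * T * (4 * M * K / (T : ℝ) ^ 2 + M * (1 / T))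
        + (M * (⌊3 / 2 * scale p K T⌋₊ + M + 1)
          + M * (M * (8 * M * K ^ 2 * (devRate δ)⁻¹ + K * c * (2 * η * (1 + Real.log T))))
          + M * ∑ k ∈ (topArms (mean ν) M)ᶜ, (mean ν w - mean ν k) * (n₀ k + (devRate δ)⁻¹)) := by
  set τ := ⌊3 / 2 * scale p K T⌋₊ with hτdef
  have hgap : ∀ k ∈ (topArms (mean ν) M)ᶜ, 0 ≤ mean ν w - mean ν k := by
    intro k hk
    have := htop.gap_out k (Finset.mem_compl.1 hk)
    linarith
  have h1 : Dominated (law M ν)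
      (fun ω => M * T * (initFailure T p l).indicator (fun _ => (1 : ℝ)) ω) _ :=
    (Dominated.indicator
      (measureReal_initFailure_le hK hM hMK hT hp hmin hl hL hup)).const_mul (by positivity)
  have h2 : Dominated (law M ν) (fun ω => M * ∑ t ∈ Finset.Ico (τ + M + 1) T, ∑ j,
      {ω | BadBlock ν T δ j (blockStart M t) ω}.indicator (fun _ => (1 : ℝ)) ω)
      (M * (M * (8 * M * K ^ 2 * (devRate δ)⁻¹ + K * c * (2 * η * (1 + Real.log T))))) := by
    refine Dominated.const_mul (Dominated.mono (Dominated.sum _ fun t _ => Dominated.sum _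
      fun j _ => Dominated.indicator le_rfl) (fun ω => le_rfl) ?_) (Nat.cast_nonneg _)
    rw [Finset.sum_comm]
    refine (Finset.sum_le_sum fun j _ => sum_badBlock_le hM T hδ0 hδ hη hc0 hc hN
      (by omega) j).trans_eq ?_
    rw [Finset.sum_const, Finset.card_univ, Fintype.card_fin, nsmul_eq_mul]
  have h3 : Dominated (law M ν) (fun ω => ∑ j, ∑ k ∈ (topArms (mean ν) M)ᶜ,
      (mean ν w - mean ν k) * (n₀ k
          + ∑ t ∈ Finset.range T, (overSet ν T δ j k t).indicator (fun _ => (1 : ℝ)) ω))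
      (M * ∑ k ∈ (topArms (mean ν) M)ᶜ, (mean ν w - mean ν k) * (n₀ k + (devRate δ)⁻¹)) := by
    refine Dominated.mono (Dominated.sum _ fun j _ => Dominated.sum _ fun k hk =>
      ((Dominated.const _).add ((Dominated.sum _ fun t _ => Dominated.indicator le_rfl).mono
        (fun ω => le_rfl) (sum_overSet_le ν T hδ0 hδ j k T))).const_mul (hgap k hk))
      (fun ω => le_rfl) ?_
    rw [Finset.sum_const, Finset.card_univ, Fintype.card_fin, nsmul_eq_mul]
  refine (h1.add (((Dominated.const _).add h2).add h3)).integral_le (integrable_regret ν T) ?_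
  filter_upwards [ae_seeds_lt_one ν] with ω hseed
  have hind : ∀ (S : Set (Outcome K M)), 0 ≤ S.indicator (fun _ => (1 : ℝ)) ω :=
    fun S => Set.indicator_nonneg (fun _ _ => zero_le_one) ω
  by_cases hω : ω ∈ initFailure T p l
  · have h4 := regret_le_mul (ν := ν) (T := T) (ω := ω) hMK (play K M T)
    rw [Set.indicator_of_mem hω, mul_one]
    refine le_add_of_le_of_nonneg h4 (add_nonneg (add_nonneg (by positivity)
      (mul_nonneg (Nat.cast_nonneg _) (Finset.sum_nonneg fun t _ => Finset.sum_nonneg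
        fun j _ => hind _))) ?_)
    exact Finset.sum_nonneg fun j _ => Finset.sum_nonneg fun k hk => mul_nonneg (hgap k hk)
      (add_nonneg (Nat.cast_nonneg _) (Finset.sum_nonneg fun t _ => hind _))
  · obtain ⟨r, h4, h5, h6⟩ := exists_exploring hK hM hMK hT hL hω hseed
    rw [Set.indicator_of_notMem hω, mul_zero, zero_add]
    refine regret_le_of_exploring h4 h5 h6 hM hMK hseed hδ0 hμ htop (fun t h7 h8 => ?_) hn hκ
    have h9 := lt_blockStart_add hM t
    have h10 : blockStart M t ≤ t + 1 := Nat.mul_div_le _ _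
    exact ⟨(hN _ (by omega)).1.le, explorationThreshold_mono (hN3.trans (by omega)) (by omega)⟩

theorem eventually_mul_log_le (c : ℝ) : ∀ᶠ x : ℝ in atTop, c * Real.log x ≤ x / 2 := by
  have h := Real.isLittleO_log_id_atTop.def (c := 1 / (2 * (|c| + 1))) (by positivity)
  filter_upwards [h, eventually_ge_atTop 0] with x hx hx0
  simp only [id, Real.norm_eq_abs, abs_of_nonneg hx0] at hx
  calc c * Real.log x ≤ |c| * |Real.log x| := by rw [← abs_mul]; exact le_abs_self _
    _ ≤ (|c| + 1) * (1 / (2 * (|c| + 1)) * x) :=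
      mul_le_mul (by linarith) hx (abs_nonneg _) (by positivity)
    _ = x / 2 := by
      have : |c| + 1 ≠ 0 := by positivity
      field_simp

theorem exists_obsProb_min (hμ : ∀ k, 0 < mean ν k) :
    ∃ l, ordMean (mean ν) K ≤ obsProb ν l ∧ 0 < obsProb ν l ∧
      ∀ k, obsProb ν l ≤ obsProb ν k := by
  obtain ⟨l, -, hl⟩ := Finset.exists_min_image Finset.univ (obsProb ν) ⟨0, Finset.mem_univ _⟩
  have h := mean_le_obsProb ν l
  exact ⟨l, (ordMean_last_le l).trans h, (hμ l).trans_le h, fun k => hl k (Finset.mem_univ k)⟩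

theorem ordMean_last_pos (hμ : ∀ k, 0 < mean ν k) : 0 < ordMean (mean ν) K := by
  have hK : 1 ≤ K := NeZero.one_le
  have h := ordMean_succ (m := mean ν) (i := K - 1) (by omega)
  rw [Nat.sub_add_cancel hK] at h
  rw [h]
  exact hμ _

-- The order of choices matters: `δ` depends on the instance, `c` on `δ`, `η` on `c`, `N` on `η`,
-- and only then is `T` taken large. Every term other than the leading ones is a constant
-- independent of `T`, or a multiple of `log T` bounded by `M K³ / μ_(K)` times an absolute
-- constant.
set_option maxHeartbeats 1000000 in
theorem eventually_integral_regret_le (hK : 2 ≤ K) (hM : 1 ≤ M) (hMK : M ≤ K)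
    (hinj : Function.Injective (mean ν)) (hμ : ∀ k, 0 < mean ν k) :
    ∀ᶠ T : ℕ in atTop, ∫ ω, regret ν (play K M T) T ω ∂(law M ν)
      ≤ M * (∑ k ∈ Finset.Ioc M K, (ordMean (mean ν) M - ordMean (mean ν) k) *
          ((kl (ordMean (mean ν) k) (ordMean (mean ν) M))⁻¹).toReal) * Real.log T
        + 3000 * (M * (K : ℝ) ^ 3 / ordMean (mean ν) K * Real.log T) := by
  set w := armOrder (mean ν) ⟨M - 1, by omega⟩ with hw
  set top := topArms (mean ν) M with htopdef
  have hordM : ordMean (mean ν) M = mean ν w := by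
    have h := ordMean_succ (m := mean ν) (i := M - 1) (by omega)
    rwa [Nat.sub_add_cancel hM] at h
  rw [sum_Ioc_ordMean (m := mean ν) (M := M)
    (fun x => (ordMean (mean ν) M - x) * ((kl x (ordMean (mean ν) M))⁻¹).toReal), hordM]
  obtain ⟨l, hpl, hp, hmin⟩ := exists_obsProb_min hμ
  set p := obsProb ν l with hpdef
  have hlast := ordMean_last_pos hμ
  have hδev : ∀ᶠ δ in 𝓝[>] (0 : ℝ), 0 < δ ∧ δ ≤ 1 ∧ (∀ k, δ < mean ν k) ∧ IsTop ν M top w δ ∧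
      ∀ k, k ∉ top → 0 < klr (mean ν k + δ) (mean ν w - δ) ∧
        (klr (mean ν k + δ) (mean ν w - δ))⁻¹
          ≤ ((kl (mean ν k) (mean ν w))⁻¹).toReal + 1 / 2 := by
    have h1 : ∀ᶠ δ in 𝓝[>] (0 : ℝ), ∀ k, δ < mean ν k := eventually_all.2 fun k =>
      (eventually_const_mul_lt (hμ k) 1).mono fun δ h => by linarith
    have htopev := eventually_isTop hM hMK hinj
    have h2 : ∀ᶠ δ in 𝓝[>] (0 : ℝ), ∀ k, k ∉ top → 0 < klr (mean ν k + δ) (mean ν w - δ) ∧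
        (klr (mean ν k + δ) (mean ν w - δ))⁻¹
          ≤ ((kl (mean ν k) (mean ν w))⁻¹).toReal + 1 / 2 := by
      refine eventually_all.2 fun k => ?_
      by_cases hk : k ∈ top
      · exact Eventually.of_forall fun δ h => absurd hk h
      · obtain ⟨δ', h3, h4⟩ := (htopev.and self_mem_nhdsWithin).exists
        have h4 : 0 < δ' := h4
        have h5 := h3.gap_out k hk
        exact (eventually_inv_klr_le (hμ k) (by linarith) (mean_mem ν w).2).mono fun δ h _ => h
    filter_upwards [self_mem_nhdsWithin, eventually_const_mul_lt one_pos 1, h1, htopev, h2]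
      with δ h3 h4 h5 h6 h7
    exact ⟨h3, by linarith, h5, h6, h7⟩
  obtain ⟨δ, hδ0, hδ1, hδμ, htop, hκ⟩ := hδev.exists
  obtain ⟨c, hc0, hc⟩ := exists_underEst_le (M := M) ν hδ0 hδμ
  -- Chosen so that the under-estimations of all players contribute at most `1 + log T` to the
  -- regret.
  set η : ℝ := 1 / (2 * (M * (M * (K * c)) + 1)) with hηdef
  have hη : 0 < η := by positivity
  obtain ⟨N, hN3, hN⟩ : ∃ N : ℕ, 3 ≤ N ∧ ∀ b : ℕ, N ≤ b → 0 < explorationThreshold b ∧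
      Real.exp (-explorationThreshold b) ≤ η / b := by
    obtain ⟨N, hN⟩ := eventually_atTop.1 (eventually_exp_neg_explorationThreshold_le hη)
    exact ⟨max N 3, le_max_right _ _, fun b hb => hN b ((le_max_left _ _).trans hb)⟩
  set e := (devRate δ)⁻¹ with he
  have he0 : 0 ≤ e := inv_nonneg.2 (devRate_pos hδ0).le
  set iv : Fin K → ℝ := fun k => ((kl (mean ν k) (mean ν w))⁻¹).toReal with hiv
  have hiv0 : ∀ k, 0 ≤ iv k := fun k => ENNReal.toReal_nonneg
  set c₀ : ℝ := β ^ 2 * K ^ 2 * K / p with hc₀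
  have hβ : β = 39 := rfl
  have hKpos : (0 : ℝ) < K := by exact_mod_cast (by omega : 0 < K)
  have hMpos : (1 : ℝ) ≤ M := by exact_mod_cast hM
  have hMK' : (M : ℝ) ≤ K := by exact_mod_cast hMK
  have hK2 : (2 : ℝ) ≤ K := by exact_mod_cast hK
  have hc₀pos : 0 < c₀ := by rw [hc₀, hβ]; positivity
  have hscale : ∀ T : ℕ, scale p K T = c₀ * Real.log T := fun T => by
    unfold scale obsTarget; rw [hc₀]; ring
  -- Sum of all the contributions that do not grow with `T`; it is eventually below `log T`.
  set D : ℝ := 4 * M * M * K + M * M + M * (M + 1) + 8 * M * M * M * K ^ 2 * e + 1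
    + M * (K * (1 + e)) with hD
  have hcast : Tendsto (fun T : ℕ => (T : ℝ)) atTop atTop := tendsto_natCast_atTop_atTop
  have hlog : Tendsto (fun T : ℕ => Real.log T) atTop atTop := Real.tendsto_log_atTop.comp hcast
  have hloglog : ∀ᶠ T : ℕ in atTop, ∀ k, (4 * iv k + 2) * Real.log (Real.log T)
      ≤ Real.log T / 2 :=
    eventually_all.2 fun k => hlog.eventually (eventually_mul_log_le (4 * iv k + 2))
  filter_upwards [eventually_ge_atTop 4, hloglog, hlog.eventually_ge_atTop D,
    hlog.eventually_ge_atTop 1, hlog.eventually_ge_atTop ((N + M + 1000) / c₀),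
    hcast.eventually (eventually_mul_log_le (53 / 50 * c₀)),
    eventually_ge_atTop N] with T hT4 hll hDT hL1 hLN hupT hNT
  set L := Real.log T with hLdef
  have hT4' : (4 : ℝ) ≤ T := by exact_mod_cast hT4
  have hsc : (N + M + 1000 : ℝ) ≤ scale p K T := by
    rw [hscale]; rwa [div_le_iff₀' hc₀pos] at hLN
  have hN0 : (0 : ℝ) ≤ N := Nat.cast_nonneg _
  have hup : upperTime p K T + 1 ≤ T := by
    have h1 : (upperTime p K T : ℝ) < 53 / 50 * scale p K T + 1 :=
      Nat.ceil_lt_add_one (by linarith)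
    rw [hscale] at h1
    have h2 : ((upperTime p K T + 1 : ℕ) : ℝ) < T + 1 := by push_cast; linarith
    have h3 : upperTime p K T + 1 < T + 1 := by exact_mod_cast h2
    omega
  have hF0 : 0 ≤ explorationThreshold T := (hN T hNT).1.le
  set F := explorationThreshold T with hFdef
  set κ : Fin K → ℝ := fun k => klr (mean ν k + δ) (mean ν w - δ) with hκdef
  -- The choice of `n₀` is the least integer with `F < n₀ * κ`: after that many pulls the index test
  -- fails.
  have hmain := integral_regret_le (n₀ := fun k => ⌊F / κ k⌋₊ + 1) hK hM hMK (by omega) hp hmin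
    hpdef.symm (by linarith) hup hδ0 hδ1 hδμ hη hc0 (fun j k n f hf => hc T j k n f hf) hN3 hN
    (Nat.le_floor (by push_cast; linarith)) htop (fun k hk => by
      rw [← div_lt_iff₀ (hκ k hk).1]
      push_cast
      exact Nat.lt_floor_add_one _) (fun k hk => (hκ k hk).1)
  refine hmain.trans ?_
  set X : ℝ := M * (K : ℝ) ^ 3 / ordMean (mean ν) K with hX
  have hlast1 : ordMean (mean ν) K ≤ 1 := (ordMean_last_le 0).trans (mean_mem ν 0).2
  have hMKX : M * K ≤ X := by
    rw [hX, le_div_iff₀ hlast]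
    have h1 : (1 : ℝ) ≤ K ^ 2 := one_le_pow₀ (by linarith)
    calc (M : ℝ) * K * ordMean (mean ν) K ≤ M * K * K ^ 2 :=
          mul_le_mul_of_nonneg_left (hlast1.trans h1) (by positivity)
      _ = M * K ^ 3 := by ring
  have hX1 : 1 ≤ X := by nlinarith
  have hA : M * T * (4 * M * K / (T : ℝ) ^ 2 + M * (1 / T)) ≤ 4 * M * M * K + M * M := by
    have h1 : M * T * (4 * M * K / (T : ℝ) ^ 2 + M * (1 / T)) = 4 * M * M * K / T + M * M := by
      have : (T : ℝ) ≠ 0 := by linarith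
      field_simp
    rw [h1]
    exact add_le_add (div_le_self (by positivity) (by linarith)) le_rfl
  -- Cost of the initialization: `3/2 * β² = 2281.5`.
  have hB : M * ((⌊3 / 2 * scale p K T⌋₊ : ℝ) + M + 1) ≤ 2282 * (X * L) + M * (M + 1) := by
    have h1 : (⌊3 / 2 * scale p K T⌋₊ : ℝ) ≤ 3 / 2 * scale p K T :=
      Nat.floor_le (by linarith)
    have h2 : M * scale p K T ≤ 1521 * (X * L) := by
      rw [hscale, hc₀, hβ, hX]
      have h3 : M * (K : ℝ) ^ 3 / p ≤ M * (K : ℝ) ^ 3 / ordMean (mean ν) K :=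
        div_le_div_of_nonneg_left (by positivity) hlast hpl
      have h4 := mul_le_mul_of_nonneg_right h3 (by linarith : 0 ≤ L)
      calc M * (39 ^ 2 * (K : ℝ) ^ 2 * K / p * L) = 1521 * (M * (K : ℝ) ^ 3 / p * L) := by ring
        _ ≤ _ := by linarith
    have h3 : 0 ≤ X * L := by positivity
    calc M * ((⌊3 / 2 * scale p K T⌋₊ : ℝ) + M + 1) ≤ M * (3 / 2 * scale p K T + M + 1) :=
          mul_le_mul_of_nonneg_left (by linarith) (by linarith)
      _ = 3 / 2 * (M * scale p K T) + M * (M + 1) := by ring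
      _ ≤ _ := by linarith
  have hC : M * (M * (8 * M * K ^ 2 * e + K * c * (2 * η * (1 + L))))
      ≤ 8 * M * M * M * K ^ 2 * e + (1 + L) := by
    have h1 : M * (M * (K * c)) * (2 * η) ≤ 1 := by
      rw [hηdef]
      have h2 : 0 ≤ (M : ℝ) * (M * (K * c)) := by positivity
      rw [← mul_div_assoc, mul_one, ← mul_div_assoc, div_le_one (by positivity)]
      linarith
    have h2 := mul_le_mul_of_nonneg_right h1 (by linarith : 0 ≤ 1 + L)
    linarith
  have hDk : ∀ k ∈ topᶜ, (mean ν w - mean ν k) * (((⌊F / κ k⌋₊ + 1 : ℕ) : ℝ) + e)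
      ≤ (mean ν w - mean ν k) * iv k * L + (L + 1 + e) := by
    intro k hk
    have hk' := Finset.mem_compl.1 hk
    have h1 := htop.gap_out k hk'
    have h2 : mean ν w - mean ν k ≤ 1 := by linarith [(mean_mem ν w).2, hμ k]
    have h3 : (⌊F / κ k⌋₊ : ℝ) ≤ F / κ k :=
      Nat.floor_le (div_nonneg hF0 (hκ k hk').1.le)
    have h4 : F / κ k ≤ F * (iv k + 1 / 2) := by
      rw [div_eq_mul_inv]
      exact mul_le_mul_of_nonneg_left (hκ k hk').2 hF0
    -- The slack `1/2` costs `L/2`, and the other half of `L` absorbs the iterated logarithm `(4 *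
    -- iv k + 2) * log L`.
    have h5 : F * (iv k + 1 / 2) ≤ iv k * L + L := by
      have h6 : F = L + 4 * Real.log L := rfl
      rw [h6]
      linarith [hll k]
    have h6 : ((⌊F / κ k⌋₊ + 1 : ℕ) : ℝ) + e ≤ iv k * L + (L + 1 + e) := by
      push_cast; linarith
    have h7 : 0 ≤ mean ν w - mean ν k := by linarith
    calc _ ≤ (mean ν w - mean ν k) * (iv k * L + (L + 1 + e)) := mul_le_mul_of_nonneg_left h6 h7
      _ = (mean ν w - mean ν k) * iv k * L + (mean ν w - mean ν k) * (L + 1 + e) := by ring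
      _ ≤ _ := by
        have := mul_le_mul_of_nonneg_right h2 (by linarith : 0 ≤ L + 1 + e)
        linarith
  have hDsum : M * ∑ k ∈ topᶜ, (mean ν w - mean ν k) * (((⌊F / κ k⌋₊ + 1 : ℕ) : ℝ) + e)
      ≤ M * (∑ k ∈ topᶜ, (mean ν w - mean ν k) * iv k) * L + M * (K * (L + 1 + e)) := by
    rw [mul_assoc, ← mul_add]
    refine mul_le_mul_of_nonneg_left ?_ (by linarith)
    refine (Finset.sum_le_sum hDk).trans ?_
    rw [Finset.sum_add_distrib, ← Finset.sum_mul, Finset.sum_const, nsmul_eq_mul]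
    refine add_le_add le_rfl (mul_le_mul_of_nonneg_right ?_ (by linarith))
    have := Finset.card_le_univ (topᶜ)
    rw [Fintype.card_fin] at this
    exact_mod_cast this
  have hXL : L ≤ X * L := le_mul_of_one_le_left (by linarith) hX1
  have hMKL : M * K * L ≤ X * L := mul_le_mul_of_nonneg_right hMKX (by linarith)
  -- The multiples of `X * L` are `2282` for the initialization, and one each for the
  -- under-estimations, the slack of the divergences and the constant `D`; the total is well below
  -- `3000`.
  linarith

theorem regret_eq_zero_of_one (ν : Fin 1 → Measure I) (s : Fin 1 → Strategy 1) (T : ℕ)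
    (ω : Outcome 1 1) : regret ν s T ω = 0 := by
  have h1 : ordMean (mean ν) 1 = mean ν 0 := by
    have := ordMean_succ (m := mean ν) zero_lt_one
    rw [zero_add] at this
    rw [this, Subsingleton.elim (armOrder (mean ν) ⟨0, zero_lt_one⟩) 0]
  have h2 : ∀ a : Fin 1 → Fin 1, collision a 0 = 0 := fun a => by
    unfold collision
    exact if_neg (not_lt.2 ((Finset.card_le_univ _).trans_eq (Fintype.card_fin 1)))
  unfold regret
  have h3 : ∀ t, action s ω t 0 = 0 := fun t => Subsingleton.elim _ _
  simp [h1, h2, h3]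

end Regret

end MMAB

end

/-! ### The theorem -/

theorem theorem1 :
    ∃ C : ℝ, 0 < C ∧
      ∀ (K M : ℕ) [NeZero K] [NeZero M] (ν : Fin K → MeasureTheory.Measure unitInterval)
        [∀ k, MeasureTheory.IsProbabilityMeasure (ν k)],
        M ≤ K →
        Function.Injective (MMAB.mean ν) →
        (∀ k, 0 < MMAB.mean ν k) →
        ∀ᶠ T : ℕ in Filter.atTop,
          MeasureTheory.Integrable
              (MMAB.regret ν (fun _ : Fin M => MMAB.selfishRobust T) T) (MMAB.law M ν) ∧
            ∫ ω, MMAB.regret ν (fun _ : Fin M => MMAB.selfishRobust T) T ω ∂(MMAB.law M ν) ≤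
              M * (∑ k ∈ Finset.Ioc M K,
                  (MMAB.ordMean (MMAB.mean ν) M - MMAB.ordMean (MMAB.mean ν) k) *
                    ((MMAB.kl (MMAB.ordMean (MMAB.mean ν) k)
                      (MMAB.ordMean (MMAB.mean ν) M))⁻¹).toReal) * Real.log T
                + C * (M * (K : ℝ) ^ 3 / MMAB.ordMean (MMAB.mean ν) K * Real.log T) := by
  refine ⟨3000, by norm_num, ?_⟩
  intro K M _ _ ν _ hMK hinj hμ
  have hM : 1 ≤ M := NeZero.one_le
  rcases (NeZero.one_le (n := K)).eq_or_lt with hK | hK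
  -- With a single arm the estimator of `M` degenerates, as `log(1 - 1/K)` becomes `log 0`; but then
  -- the only player always pulls the only arm and the regret vanishes.
  · obtain rfl : K = 1 := hK.symm
    obtain rfl : M = 1 := le_antisymm hMK hM
    refine Filter.Eventually.of_forall fun T => ⟨MMAB.integrable_regret ν T, ?_⟩
    simp only [MMAB.regret_eq_zero_of_one, MeasureTheory.integral_zero, Finset.Ioc_self,
      Finset.sum_empty, mul_zero, zero_mul, zero_add]
    have h1 := MMAB.ordMean_last_pos hμ
    have h2 := Real.log_natCast_nonneg T
    positivity
  · filter_upwards [MMAB.eventually_integral_regret_le hK hM hMK hinj hμ] with T hT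
    exact ⟨MMAB.integrable_regret ν T, hT⟩
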